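/- For $a\in\mathbb{C}$ and $t\in\mathbb{R}$ let $H_t(a)$, $D(a)$, $N(a)$ be the operators generated in $L_2[0,\pi]$ by $-y''(x)+2a\cos(2x)\,y(x)$ and, respectively, the boundary conditions $y(\pi)=e^{it}y(0),\ y'(\pi)=e^{it}y'(0)$; Dirichlet conditions $y(0)=y(\pi)=0$; Neumann conditions $y'(0)=y'(\pi)=0$. Multiplicity means algebraic multiplicity, an eigenvalue of multiplicity $1$ is called simple, $D_r(z)=\{\lambda\in\mathbb{C}:|\lambda-z|\le r\}$ and $I(c)=\{ix:0<x<c\}$. An eigenvalue of $H_0(a)$ is called a PN (PD) eigenvalue if it is also an eigenvalue of $N(a)$ (of $D(a)$); an eigenvalue of $H_\pi(a)$ is called an AN (AD) eigenvalue if it is also an eigenvalue of $N(a)$ (of $D(a)$). (a) For all $a\in I(2)$ and $n=1,2,\dots$, the number of eigenvalues (counting multiplicity) of $H_\pi(a)$ lying in $D_4((2n-1)^2)$ is $2$. These eigenvalues are simple (hence distinct). They are either both real or nonreal and complex conjugate to each other. One of them is an AD eigenvalue (and not AN) and the other is an AN eigenvalue (and not AD). (b) For all $a\in I(2)$ and $n=2,3,\dots$,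 the number of eigenvalues (counting multiplicity) of $H_0(a)$ lying in $D_4((2n)^2)$ is $2$. These eigenvalues are simple (hence distinct). They are either both real or nonreal and complex conjugate to each other. One of them is a PD eigenvalue (and not PN) and the other is a PN eigenvalue (and not PD). (c) For all $a\in I(2)$, $H_0(a)$ has $3$ eigenvalues (counting multiplicity) in $D_6(3)$. Counting multiplicity, two of them are PN eigenvalues and the other one is a PD eigenvalue; each eigenvalue of $H_0(a)$ in $D_6(3)$ is of exactly one of these two types. The PN eigenvalues in $D_6(3)$ are simple for $a\in I(4/3)$, and the PD eigenvalue in $D_6(3)$ is simple for $a\in I(2)$. Moreover, if $a\in I(4/(1+2\sqrt2))$, then $D_{\sqrt2|a|}(0)$ contains exactly one eigenvalue of $H_0(a)$ (counting multiplicity), and it is a PN eigenvalue, while $D_{(1+\sqrt2)|a|}(4)$ contains exactly two eigenvalues of $H_0(a)$ (counting multiplicity), one PN and one PD. -/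

import Mathlib

open Complex MeasureTheory
open scoped ComplexConjugate Interval

noncomputable section

namespace Mathieu

/-- The Hilbert space `L₂[0, π]` of complex-valued functions. -/
abbrev L2 : Type := Lp ℂ 2 (volume.restrict (Set.Icc (0 : ℝ) Real.pi))

/-- `y` and `y₁ = y'` are absolutely continuous on `[0, π]` and `y'' = g` lies in `L₂[0, π]`;
that is, `y` is in the Sobolev space `W^{2,2}[0, π]` with first derivative `y₁` and second
derivative `g`. -/
structure IsH2 (y y₁ g : ℝ → ℂ) : Prop where
  memLp : MemLp g 2 (volume.restrict (Set.Icc (0 : ℝ) Real.pi))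
  deriv_eq : ∀ x ∈ Set.Icc (0 : ℝ) Real.pi, y₁ x = y₁ 0 + ∫ s in (0 : ℝ)..x, g s
  fun_eq : ∀ x ∈ Set.Icc (0 : ℝ) Real.pi, y x = y 0 + ∫ s in (0 : ℝ)..x, y₁ s

/-- A space of linear boundary conditions for `(y(0), y'(0), y(π), y'(π))`. -/
abbrev BoundaryCondition : Type := Submodule ℂ (ℂ × ℂ × ℂ × ℂ)

/-- `y(π) = e^{it} y(0)` and `y'(π) = e^{it} y'(0)`. -/
def quasiPeriodic (t : ℝ) : BoundaryCondition where
  carrier := {v | v.2.2.1 = exp (I * t) * v.1 ∧ v.2.2.2 = exp (I * t) * v.2.1}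
  add_mem' := by
    rintro v w ⟨h₁, h₂⟩ ⟨h₃, h₄⟩
    simp only [Set.mem_ofPred_eq, Prod.fst_add, Prod.snd_add]
    exact ⟨by rw [h₁, h₃]; ring, by rw [h₂, h₄]; ring⟩
  zero_mem' := by simp
  smul_mem' := by
    rintro c v ⟨h₁, h₂⟩
    simp only [Set.mem_ofPred_eq, Prod.smul_fst, Prod.smul_snd, smul_eq_mul]
    exact ⟨by rw [h₁]; ring, by rw [h₂]; ring⟩

/-- `y(0) = y(π) = 0`. -/
def dirichlet : BoundaryCondition where
  carrier := {v | v.1 = 0 ∧ v.2.2.1 = 0}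
  add_mem' := by
    rintro v w ⟨h₁, h₂⟩ ⟨h₃, h₄⟩
    simp [h₁, h₂, h₃, h₄]
  zero_mem' := by simp
  smul_mem' := by
    rintro c v ⟨h₁, h₂⟩
    simp [h₁, h₂]

/-- `y'(0) = y'(π) = 0`. -/
def neumann : BoundaryCondition where
  carrier := {v | v.2.1 = 0 ∧ v.2.2.2 = 0}
  add_mem' := by
    rintro v w ⟨h₁, h₂⟩ ⟨h₃, h₄⟩
    simp [h₁, h₂, h₃, h₄]
  zero_mem' := by simp
  smul_mem' := by
    rintro c v ⟨h₁, h₂⟩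
    simp [h₁, h₂]

/-- The potential `a e^{-i2x} + a e^{i2x}`. -/
def potential (a : ℂ) (x : ℝ) : ℂ := a * exp (-(I * 2 * x)) + a * exp (I * 2 * x)

theorem IsH2.intervalIntegrable {y y₁ g : ℝ → ℂ} (h : IsH2 y y₁ g) :
    IntervalIntegrable g volume 0 Real.pi := by
  rw [intervalIntegrable_iff_integrableOn_Icc_of_le Real.pi_pos.le]
  exact h.memLp.integrable (by norm_num)

theorem IsH2.continuousOn_deriv {y y₁ g : ℝ → ℂ} (h : IsH2 y y₁ g) :
    ContinuousOn y₁ (Set.Icc 0 Real.pi) := by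
  have h1 : ContinuousOn (fun x => y₁ 0 + ∫ s in (0 : ℝ)..x, g s) (Set.Icc 0 Real.pi) := by
    refine continuousOn_const.add ?_
    have := intervalIntegral.continuousOn_primitive_interval (μ := volume) (f := g)
      (a := 0) (b := Real.pi) (by
        rw [Set.uIcc_of_le Real.pi_pos.le]
        exact h.memLp.integrable (by norm_num))
    rwa [Set.uIcc_of_le Real.pi_pos.le] at this
  exact h1.congr h.deriv_eq

theorem IsH2.hasDerivWithinAt {y y₁ g : ℝ → ℂ} (h : IsH2 y y₁ g) {x : ℝ}
    (hx : x ∈ Set.Icc 0 Real.pi) : HasDerivWithinAt y (y₁ x) (Set.Icc 0 Real.pi) x := by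
  have hc := h.continuousOn_deriv
  have hi : IntervalIntegrable y₁ volume 0 x :=
    (hc.mono (Set.Icc_subset_Icc_right hx.2)).intervalIntegrable_of_Icc hx.1
  have : Fact (x ∈ Set.Icc 0 Real.pi) := ⟨hx⟩
  have h1 := intervalIntegral.integral_hasDerivWithinAt_right hi
    (s := Set.Icc 0 Real.pi) (t := Set.Icc 0 Real.pi)
    (hc.stronglyMeasurableAtFilter_nhdsWithin measurableSet_Icc x) (hc x hx)
  exact (h1.const_add (y 0)).congr h.fun_eq (h.fun_eq x hx)

theorem IsH2.continuousOn {y y₁ g : ℝ → ℂ} (h : IsH2 y y₁ g) :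
    ContinuousOn y (Set.Icc 0 Real.pi) :=
  fun _ hx => (h.hasDerivWithinAt hx).continuousWithinAt

/-- The graph of the operator `y ↦ -y'' + q y` in `L₂[0, π]`, whose domain consists of the
functions of `W^{2,2}[0, π]` satisfying the boundary conditions `B`. -/
def hillGraph (q : C(ℝ, ℂ)) (B : BoundaryCondition) : Submodule ℂ (L2 × L2) where
  carrier := {p | ∃ y y₁ g : ℝ → ℂ, IsH2 y y₁ g ∧ (y 0, y₁ 0, y Real.pi, y₁ Real.pi) ∈ B ∧
    p.1 =ᵐ[volume.restrict (Set.Icc (0 : ℝ) Real.pi)] y ∧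
    p.2 =ᵐ[volume.restrict (Set.Icc (0 : ℝ) Real.pi)] fun x => -g x + q x * y x}
  add_mem' := by
    rintro p p' ⟨y, y₁, g, h, hB, e₁, e₂⟩ ⟨y', y₁', g', h', hB', e₁', e₂'⟩
    have sub : ∀ x ∈ Set.Icc (0 : ℝ) Real.pi, Set.uIcc 0 x ⊆ Set.uIcc 0 Real.pi := by
      intro x hx
      rw [Set.uIcc_of_le hx.1, Set.uIcc_of_le Real.pi_pos.le]
      exact Set.Icc_subset_Icc_right hx.2
    refine ⟨y + y', y₁ + y₁', g + g', ⟨h.memLp.add h'.memLp, ?_, ?_⟩, B.add_mem hB hB', ?_, ?_⟩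
    · intro x hx
      have := intervalIntegral.integral_add (h.intervalIntegrable.mono_set (sub x hx))
        (h'.intervalIntegrable.mono_set (sub x hx))
      simp only [Pi.add_apply, this]
      rw [h.deriv_eq x hx, h'.deriv_eq x hx]; ring
    · intro x hx
      have := intervalIntegral.integral_add (μ := volume)
        ((h.continuousOn_deriv.mono (Set.Icc_subset_Icc_right hx.2)).intervalIntegrable_of_Icc hx.1)
        ((h'.continuousOn_deriv.mono
          (Set.Icc_subset_Icc_right hx.2)).intervalIntegrable_of_Icc hx.1)
      simp only [Pi.add_apply, this]
      rw [h.fun_eq x hx, h'.fun_eq x hx]; ring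
    · filter_upwards [Lp.coeFn_add p.1 p'.1, e₁, e₁'] with x a b c
      simp only [Prod.fst_add, a, Pi.add_apply, b, c]
    · filter_upwards [Lp.coeFn_add p.2 p'.2, e₂, e₂'] with x a b c
      simp only [Prod.snd_add, a, Pi.add_apply, b, c]; ring
  zero_mem' := by
    refine ⟨0, 0, 0, ⟨MemLp.zero, by simp, by simp⟩, B.zero_mem, Lp.coeFn_zero _ _ _, ?_⟩
    filter_upwards [Lp.coeFn_zero ℂ 2 (volume.restrict (Set.Icc (0 : ℝ) Real.pi))] with x a
    simp only [Prod.snd_zero, a, Pi.zero_apply, neg_zero, mul_zero, add_zero]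
  smul_mem' := by
    rintro c p ⟨y, y₁, g, h, hB, e₁, e₂⟩
    refine ⟨c • y, c • y₁, c • g, ⟨h.memLp.const_smul c, ?_, ?_⟩, B.smul_mem c hB, ?_, ?_⟩
    · intro x hx
      simp only [Pi.smul_apply, smul_eq_mul, intervalIntegral.integral_const_mul]
      rw [h.deriv_eq x hx]; ring
    · intro x hx
      simp only [Pi.smul_apply, smul_eq_mul, intervalIntegral.integral_const_mul]
      rw [h.fun_eq x hx]; ring
    · filter_upwards [Lp.coeFn_smul c p.1, e₁] with x a b
      simp [a, b]
    · filter_upwards [Lp.coeFn_smul c p.2, e₂] with x a b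
      simp only [Prod.smul_snd, a, Pi.smul_apply, b, smul_eq_mul]; ring

/-- `hillGraph q B` is the graph of a single-valued operator. -/
theorem hillGraph_single_valued (q : C(ℝ, ℂ)) (B : BoundaryCondition) :
    ∀ p : L2 × L2, p ∈ hillGraph q B → p.1 = 0 → p.2 = 0 := by
  rintro p ⟨y, y₁, g, h, -, e₁, e₂⟩ hp
  have hy0 : y =ᵐ[volume.restrict (Set.Icc (0 : ℝ) Real.pi)] (fun _ => 0) := by
    rw [hp] at e₁
    exact e₁.symm.trans (Lp.coeFn_zero _ _ _)
  have hy : Set.EqOn y (fun _ => 0) (Set.Icc 0 Real.pi) :=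
    Measure.eqOn_Icc_of_ae_eq volume Real.pi_pos.ne hy0 h.continuousOn continuousOn_const
  have hy₁ : ∀ x ∈ Set.Icc 0 Real.pi, y₁ x = 0 := by
    intro x hx
    have h1 : HasDerivWithinAt y 0 (Set.Icc 0 Real.pi) x :=
      (hasDerivWithinAt_const x _ (0 : ℂ)).congr hy (hy hx)
    exact (uniqueDiffOn_Icc Real.pi_pos x hx).eq_deriv _ (h.hasDerivWithinAt hx) h1
  have hg : ∀ᵐ x ∂(volume.restrict (Set.Icc (0 : ℝ) Real.pi)), g x = 0 := by
    rw [← restrict_Ioo_eq_restrict_Icc, ae_restrict_iff' measurableSet_Ioo]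
    filter_upwards [h.intervalIntegrable.ae_hasDerivAt_integral] with x hd hx
    have hx' : x ∈ Set.Icc 0 Real.pi := Set.Ioo_subset_Icc_self hx
    have h1 := hd (by rwa [Set.uIcc_of_le Real.pi_pos.le]) 0
      (by rw [Set.uIcc_of_le Real.pi_pos.le]; exact ⟨le_rfl, Real.pi_pos.le⟩)
    have h2 : (fun u => ∫ s in (0 : ℝ)..u, g s) =ᶠ[nhds x] fun _ => 0 := by
      filter_upwards [Ioo_mem_nhds hx.1 hx.2] with u hu
      have hu' := Set.Ioo_subset_Icc_self hu
      have := h.deriv_eq u hu'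
      rw [hy₁ u hu', hy₁ 0 ⟨le_rfl, Real.pi_pos.le⟩, zero_add] at this
      exact this.symm
    exact h1.unique ((hasDerivAt_const x (0 : ℂ)).congr_of_eventuallyEq h2)
  refine (Lp.eq_zero_iff_ae_eq_zero).2 ?_
  filter_upwards [e₂, hg, hy0] with x a b c
  simp [a, b, c]

/-- The operator generated in `L₂[0, π]` by `-y'' + q y` and the boundary conditions `B`. -/
def hillOperator (q : C(ℝ, ℂ)) (B : BoundaryCondition) : L2 →ₗ.[ℂ] L2 :=
  (hillGraph q B).toLinearPMap

theorem hillOperator_graph (q : C(ℝ, ℂ)) (B : BoundaryCondition) :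
    (hillOperator q B).graph = hillGraph q B :=
  Submodule.toLinearPMap_graph_eq _ (hillGraph_single_valued q B)

/-- The potential `2 a cos 2x` as a continuous function. -/
def mathieuPotential (a : ℂ) : C(ℝ, ℂ) where
  toFun := potential a
  continuous_toFun := by unfold potential; fun_prop

/-- The operator `H_t(a)` with the quasi-periodic boundary conditions. -/
def H (t : ℝ) (a : ℂ) : L2 →ₗ.[ℂ] L2 := hillOperator (mathieuPotential a) (quasiPeriodic t)

/-- The Dirichlet operator `D(a)`. -/
def D (a : ℂ) : L2 →ₗ.[ℂ] L2 := hillOperator (mathieuPotential a) dirichlet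

/-- The Neumann operator `N(a)`. -/
def N (a : ℂ) : L2 →ₗ.[ℂ] L2 := hillOperator (mathieuPotential a) neumann

section Spectral

variable {E : Type*} [AddCommGroup E] [Module ℂ E]

/-- `z` is an eigenvalue of the (unbounded) operator `A`. -/
def IsEigenvalue (A : E →ₗ.[ℂ] E) (z : ℂ) : Prop :=
  ∃ f : A.domain, f ≠ 0 ∧ A f = z • (f : E)

/-- The kernel of `(A - z)^k`, on its natural domain. -/
def kerPow (A : E →ₗ.[ℂ] E) (z : ℂ) : ℕ → Submodule ℂ E
  | 0 => ⊥
  | k + 1 => ((kerPow A z k).comap (A.toFun - z • A.domain.subtype)).map A.domain.subtype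

/-- The (algebraic) multiplicity of `z` as an eigenvalue of `A`: the dimension of the root
subspace `⋃ k, ker (A - z)^k`. It is `0` when `z` is not an eigenvalue. -/
def multiplicity (A : E →ₗ.[ℂ] E) (z : ℂ) : ℕ∞ :=
  Cardinal.toENat (Module.rank ℂ (⨆ k, kerPow A z k : Submodule ℂ E))

/-- The number of eigenvalues of `A` lying in `S`, counted with multiplicity. -/
def numEigenvalues (A : E →ₗ.[ℂ] E) (S : Set ℂ) : ℕ∞ :=
  ⨆ (s : Finset ℂ) (_ : (s : Set ℂ) ⊆ S), ∑ z ∈ s, multiplicity A z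

end Spectral

/-- The PN eigenvalues: periodic and Neumann. -/
def PN (a : ℂ) : Set ℂ := {z | IsEigenvalue (H 0 a) z ∧ IsEigenvalue (N a) z}

/-- The PD eigenvalues: periodic and Dirichlet. -/
def PD (a : ℂ) : Set ℂ := {z | IsEigenvalue (H 0 a) z ∧ IsEigenvalue (D a) z}

/-- The AN eigenvalues: antiperiodic and Neumann. -/
def AN (a : ℂ) : Set ℂ := {z | IsEigenvalue (H Real.pi a) z ∧ IsEigenvalue (N a) z}

/-- The AD eigenvalues: antiperiodic and Dirichlet. -/
def AD (a : ℂ) : Set ℂ := {z | IsEigenvalue (H Real.pi a) z ∧ IsEigenvalue (D a) z}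

/-- `I(c) = {ix : x ∈ (0, c)}`. -/
def imSegment (c : ℝ) : Set ℂ := {a | ∃ x ∈ Set.Ioo (0 : ℝ) c, a = I * x}

/-- The closed disc `D_r(z)`. -/
abbrev disc (r : ℝ) (z : ℂ) : Set ℂ := Metric.closedBall z r

end Mathieu

end

noncomputable section

namespace Mathieu

/-! ### Fixed points in boxes -/

/-! Integration against $e^{-i(2j+\tau)x}$ ($\tau=0$ periodic, $\tau=1$ antiperiodic) turns the
operator into the three-term recursion `mathieuSeq`, with diagonal $(2j+\tau)^2$ and off-diagonal
entries $a$. The coefficient map is injective (`coeffL_injective`), and bounded eigenvectors of the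
recursion decay fast enough to come from the operator domain (`summable_of_eigen`,
`exists_mem_domain`), so eigenvalues and root vectors can be studied on bounded sequences. The
reflection $x\mapsto\pi-x$ becomes $j\mapsto-j-\tau$; even eigenvectors are the Neumann ones and odd
eigenvectors the Dirichlet ones (`neumann_iff_hasMode`, `dirichlet_iff_hasMode`). A discrete
Wronskian shows that for $a\ne0$ the two parities never share an eigenvalue (`no_coexistence`), so
algebraic multiplicities can be computed inside one parity class.

Inside a parity class the pair of frequencies $\pm(2n+\tau)$ contributes one dimension, and $|a|<2$
is small against the gaps of the diagonal. With the normalisation $v_n=1$ the remaining entries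
solve a fixed-point equation that contracts in the supremum distance (`exists_mode`). A similar
estimate shows that $(L-z)f=cv$ forces $f$ to be a multiple of $v$ (`eq_smul_mode`); taking $c=0$
gives uniqueness of the eigenvalue in the disc, general $c$ gives algebraic simplicity. Each disc
thus holds one even and one odd simple eigenvalue. For imaginary $a$ the map
$v_j\mapsto(-1)^j\overline{v_j}$ sends the eigenvalue $z$ to $\bar z$ and multiplies the parity by
$(-1)^\tau$: in the periodic case both eigenvalues are real, in the antiperiodic case they are
conjugate, hence nonreal because they differ.

The even periodic frequencies $0$ and $\pm2$ are too close for this. They are treated together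
through an invariant plane (`exists_even_pair`), on which the operator is a $2\times2$ matrix with
trace $4+av$ and determinant $-2a^2(1+u)$, where $|u|\le1/8$ and $|v|\le1/3$. Its characteristic
roots carry the algebraic multiplicities (`exists_eigenvalue_pair`), and the explicit constants of
part (c) come from elementary estimates on this quadratic. -/

theorem eq_zero_of_contracting {ι : Type*} {f : ι → ℂ} {θ C : ℝ} (hθ0 : 0 ≤ θ) (hθ : θ < 1)
    (hC : ∀ i, ‖f i‖ ≤ C) (h : ∀ K, (∀ i, ‖f i‖ ≤ K) → ∀ i, ‖f i‖ ≤ θ * K) : f = 0 := by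
  have hpow : ∀ m : ℕ, ∀ i, ‖f i‖ ≤ θ ^ m * C := by
    intro m
    induction m with
    | zero => simpa using hC
    | succ m ih => intro i; rw [pow_succ', mul_assoc]; exact h _ ih i
  funext i
  have hlim : Filter.Tendsto (fun m : ℕ => θ ^ m * C) Filter.atTop (nhds 0) := by
    simpa using (tendsto_pow_atTop_nhds_zero_of_lt_one hθ0 hθ).mul_const C
  exact norm_le_zero_iff.1 (ge_of_tendsto' hlim fun m => hpow m i)

/-- Contraction principle for the supremum distance, with all bounds stated pointwise. The iterates
of `0` are Cauchy at each index with a geometric rate uniform in the index, which is what lets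
`hlip` pass to the limit. The radii may vary with the index, and radius `0` pins an entry to zero.
-/
theorem exists_unique_fixedPoint_box {ι : Type*} (T : (ι → ℂ) → ι → ℂ) (r : ι → ℝ) {R θ : ℝ}
    (hr0 : ∀ i, 0 ≤ r i) (hr : ∀ i, r i ≤ R) (hθ0 : 0 ≤ θ) (hθ : θ < 1)
    (hmap : ∀ w, (∀ i, ‖w i‖ ≤ r i) → ∀ i, ‖T w i‖ ≤ r i)
    (hlip : ∀ w w' K, (∀ i, ‖w i‖ ≤ r i) → (∀ i, ‖w' i‖ ≤ r i) → (∀ i, ‖w i - w' i‖ ≤ K) →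
      ∀ i, ‖T w i - T w' i‖ ≤ θ * K) :
    ∃ w, (∀ i, ‖w i‖ ≤ r i) ∧ T w = w ∧
      ∀ w', (∀ i, ‖w' i‖ ≤ r i) → T w' = w' → w' = w := by
  set u : ℕ → ι → ℂ := fun m => T^[m] 0 with hu
  have hus : ∀ m, u (m + 1) = T (u m) := fun m => Function.iterate_succ_apply' T m 0
  have hbox : ∀ m i, ‖u m i‖ ≤ r i := by
    intro m
    induction m with
    | zero => intro i; simpa [hu] using hr0 i
    | succ m ih => intro i; rw [hus]; exact hmap _ ih i
  have hstep : ∀ m i, dist (u m i) (u (m + 1) i) ≤ R * θ ^ m := by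
    intro m
    induction m with
    | zero => intro i; simpa [hu] using (hbox 1 i).trans (hr i)
    | succ m ih =>
      intro i
      rw [hus (m + 1)]
      nth_rewrite 1 [hus m]
      rw [dist_eq_norm]
      have := hlip (u m) (u (m + 1)) _ (hbox m) (hbox (m + 1))
        (fun i => by rw [← dist_eq_norm]; exact ih i) i
      calc _ ≤ _ := this
        _ = _ := by ring
  have hcau : ∀ i, CauchySeq fun m => u m i := fun i => cauchySeq_of_le_geometric θ R hθ (fun m => hstep m i)
  choose w hw using fun i => cauchySeq_tendsto_of_complete (hcau i)
  have hwbox : ∀ i, ‖w i‖ ≤ r i := fun i =>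
    le_of_tendsto' (hw i).norm fun m => hbox m i
  have hdist : ∀ m i, ‖u m i - w i‖ ≤ R * θ ^ m / (1 - θ) := by
    intro m i
    rw [← dist_eq_norm]
    exact dist_le_of_le_geometric_of_tendsto θ R hθ (fun m => hstep m i) (hw i) m
  have hfix : T w = w := by
    funext i
    have h1 : Filter.Tendsto (fun m => u (m + 1) i) Filter.atTop (nhds (w i)) :=
      (hw i).comp (Filter.tendsto_add_atTop_nat 1)
    have h2 : Filter.Tendsto (fun m => u (m + 1) i) Filter.atTop (nhds (T w i)) := by
      rw [tendsto_iff_norm_sub_tendsto_zero]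
      have h3 : Filter.Tendsto (fun m : ℕ => θ * (R * θ ^ m / (1 - θ))) Filter.atTop (nhds 0) := by
        simpa using ((((tendsto_pow_atTop_nhds_zero_of_lt_one hθ0 hθ).const_mul R).div_const
          (1 - θ)).const_mul θ)
      refine squeeze_zero (fun _ => norm_nonneg _) (fun m => ?_) h3
      rw [hus]
      exact hlip _ _ _ (hbox m) hwbox (hdist m) i
    exact tendsto_nhds_unique h2 h1
  refine ⟨w, hwbox, hfix, fun w' hw' hfix' => ?_⟩
  have : (fun i => w' i - w i) = 0 := by
    refine eq_zero_of_contracting hθ0 hθ (C := R + R)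
      (fun i => (norm_sub_le _ _).trans (add_le_add ((hw' i).trans (hr i)) ((hwbox i).trans (hr i))))
      fun K hK i => ?_
    have := hlip w' w K hw' hwbox hK i
    rwa [hfix, hfix'] at this
  funext i
  exact sub_eq_zero.1 (congrFun this i)

/-! ### The Mathieu operator on bilateral sequences -/

/-- The symbol `(2j + τ)²`. -/
def freqSq (τ j : ℤ) : ℂ := ((2 * j + τ : ℤ) : ℂ) ^ 2

/-- The operator `-y'' + 2a cos(2x) y` in the basis `e^{i(2j+τ)x}`. -/
def mathieuSeq (τ : ℤ) (a : ℂ) : (ℤ → ℂ) →ₗ[ℂ] (ℤ → ℂ) where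
  toFun v j := freqSq τ j * v j + a * (v (j - 1) + v (j + 1))
  map_add' v w := by funext j; simp only [Pi.add_apply]; ring
  map_smul' c v := by funext j; simp only [Pi.smul_apply, smul_eq_mul, RingHom.id_apply]; ring

theorem mathieuSeq_apply (τ : ℤ) (a : ℂ) (v : ℤ → ℂ) (j : ℤ) :
    mathieuSeq τ a v j = freqSq τ j * v j + a * (v (j - 1) + v (j + 1)) := rfl

/-- `v` is even (`ε = 1`) or odd (`ε = -1`) under the reflection `2j + τ ↦ -(2j + τ)`. -/
def IsSym (τ : ℤ) (ε : ℂ) (v : ℤ → ℂ) : Prop := ∀ j, v (-j - τ) = ε * v j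

theorem freqSq_reflect (τ j : ℤ) : freqSq τ (-j - τ) = freqSq τ j := by
  unfold freqSq; push_cast; ring

theorem IsSym.add {τ : ℤ} {ε : ℂ} {v w : ℤ → ℂ} (hv : IsSym τ ε v) (hw : IsSym τ ε w) :
    IsSym τ ε (v + w) := fun j => by simp only [Pi.add_apply, hv j, hw j]; ring

theorem IsSym.smul {τ : ℤ} {ε : ℂ} {v : ℤ → ℂ} (c : ℂ) (hv : IsSym τ ε v) :
    IsSym τ ε (c • v) := fun j => by simp only [Pi.smul_apply, smul_eq_mul, hv j]; ring

theorem IsSym.sub {τ : ℤ} {ε : ℂ} {v w : ℤ → ℂ} (hv : IsSym τ ε v) (hw : IsSym τ ε w) :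
    IsSym τ ε (v - w) := fun j => by simp only [Pi.sub_apply, hv j, hw j]; ring

/-- The diagonal is invariant under the reflection and the two neighbours are exchanged, so both
parity classes are invariant subspaces. -/
theorem IsSym.mathieuSeq {τ : ℤ} {ε a : ℂ} {v : ℤ → ℂ} (hv : IsSym τ ε v) :
    IsSym τ ε (mathieuSeq τ a v) := fun j => by
  have h1 : -j - τ - 1 = -(j + 1) - τ := by ring
  have h2 : -j - τ + 1 = -(j - 1) - τ := by ring
  rw [mathieuSeq_apply, mathieuSeq_apply, freqSq_reflect, hv j, h1, h2, hv, hv]; ring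

/-- The reflection of a sequence. -/
def reflect (τ : ℤ) (v : ℤ → ℂ) : ℤ → ℂ := fun j => v (-j - τ)

theorem mathieuSeq_reflect (τ : ℤ) (a : ℂ) (v : ℤ → ℂ) :
    mathieuSeq τ a (reflect τ v) = reflect τ (mathieuSeq τ a v) := by
  funext j
  have h1 : -j - τ - 1 = -(j + 1) - τ := by ring
  have h2 : -j - τ + 1 = -(j - 1) - τ := by ring
  simp only [mathieuSeq_apply, reflect, freqSq_reflect, h1, h2]; ring

theorem norm_add_le_of_le_of_le {x y : ℂ} {b c : ℝ} (hx : ‖x‖ ≤ b) (hy : ‖y‖ ≤ c) :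
    ‖x + y‖ ≤ b + c := (norm_add_le _ _).trans (add_le_add hx hy)

theorem norm_mul_le_of_le_of_le {x y : ℂ} {b c : ℝ} (hx : ‖x‖ ≤ b) (hy : ‖y‖ ≤ c) :
    ‖x * y‖ ≤ b * c := by
  rw [norm_mul]
  exact mul_le_mul hx hy (norm_nonneg _) ((norm_nonneg _).trans hx)

/-! ### A single mode of given parity near an isolated frequency -/

section SimpleMode

variable {τ : ℤ} {a ε : ℂ} {n : ℤ} {p : ℤ → ℂ} {P : Set ℤ}

/-- `P` is the set of indices where the eigenvector is prescribed to equal `p`: the index `n`, its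
mirror image, and possibly an index fixed by the reflection, where odd sequences vanish. The
correction `w` lives off `P`. Row `n` determines the eigenvalue, and the other rows become a
fixed-point equation for `w`. -/
theorem exists_mode (ha : ‖a‖ < 2) (hε : ε * ε = 1) (hp0 : ∀ j ∉ P, p j = 0) (hpn : p n = 1)
    (hnP : n ∈ P) (hpsym : IsSym τ ε p)
    (hP : ∀ j ∈ P, j = n ∨ j = -n - τ ∨ (ε = -1 ∧ -j - τ = j))
    (hp1 : ∀ j ∉ P, ‖p (j - 1) + p (j + 1)‖ ≤ 1)
    (hgap : ∀ j ∉ P, 16 ≤ ‖freqSq τ j - freqSq τ n - a * (p (n - 1) + p (n + 1))‖ ∨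
      (8 ≤ ‖freqSq τ j - freqSq τ n - a * (p (n - 1) + p (n + 1))‖ ∧ (j - 1 ∈ P ∨ j + 1 ∈ P))) :
    ∃ (l : ℂ) (v : ℤ → ℂ), IsSym τ ε v ∧ mathieuSeq τ a v = l • v ∧
      ‖l - freqSq τ n - a * (p (n - 1) + p (n + 1))‖ ≤ ‖a‖ ∧
      (∀ j ∉ P, ‖v j‖ ≤ 1 / 2) ∧ (∀ j ∈ P, v j = p j) := by
  classical
  have hε1 : ‖ε‖ = 1 := by
    have : ‖ε‖ * ‖ε‖ = 1 := by rw [← norm_mul, hε, norm_one]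
    nlinarith [norm_nonneg ε]
  set κ : ℂ := a * (p (n - 1) + p (n + 1)) with hκ
  set x := ‖a‖ with hx
  have hx0 : 0 ≤ x := norm_nonneg a
  have hPsym : ∀ j, j ∉ P → -j - τ ∉ P := by
    intro j hj hj'
    rcases hP _ hj' with h | h | ⟨-, h⟩
    · have hpj : p j = 0 := hp0 j hj
      have := hpsym j
      rw [h, hpn, hpj] at this
      simp at this
    · exact hj ((by omega : j = n) ▸ hnP)
    · exact hj ((by omega : -j - τ = j) ▸ hj')
  -- The quantity wanted in row `n` is `w (n - 1) + w (n + 1)`. It is averaged with its mirror image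
  -- so that `T` commutes with the reflection; `hSn` shows that nothing changes at the symmetric
  -- fixed point.
  set S : (ℤ → ℂ) → ℂ := fun w =>
    1 / 2 * (w (n - 1) + w (n + 1) + ε * (w (-n - τ - 1) + w (-n - τ + 1))) with hSdef
  have hS : ∀ (w : ℤ → ℂ) (K : ℝ), (∀ j, ‖w j‖ ≤ K) → ‖S w‖ ≤ K + K := by
    intro w K hK
    have h := norm_mul_le_of_le_of_le (le_of_eq (show ‖(1 / 2 : ℂ)‖ = 1 / 2 by norm_num))
      (norm_add_le_of_le_of_le (norm_add_le_of_le_of_le (hK (n - 1)) (hK (n + 1)))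
        (norm_mul_le_of_le_of_le hε1.le
          (norm_add_le_of_le_of_le (hK (-n - τ - 1)) (hK (-n - τ + 1)))))
    exact h.trans (by linarith)
  -- Row `j` of the eigenvalue equation for `p + w` with eigenvalue `freqSq τ n + κ + a * S w`,
  -- solved for the diagonal term.
  set T : (ℤ → ℂ) → ℤ → ℂ := fun w j => if j ∈ P then 0 else
    (a * (S w) * w j - a * (w (j - 1) + w (j + 1)) - a * (p (j - 1) + p (j + 1)))
      / (freqSq τ j - freqSq τ n - κ) with hT
  set r : ℤ → ℝ := fun j => if j ∈ P then 0 else 1 / 2 with hrdef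
  have hr0 : ∀ j, 0 ≤ r j := fun j => by simp only [hrdef]; split_ifs <;> norm_num
  have hrR : ∀ j, r j ≤ 1 / 2 := fun j => by simp only [hrdef]; split_ifs <;> norm_num
  have hrP : ∀ j ∈ P, r j = 0 := fun j hj => by simp [hrdef, hj]
  have hgap0 : ∀ j ∉ P, 0 < ‖freqSq τ j - freqSq τ n - κ‖ := fun j hj => by
    rcases hgap j hj with h | ⟨h, -⟩ <;> linarith
  -- With $x=|a|<2$ the numerator is at most $\frac52x<5$ in general and $2x<4$ if a neighbour lies
  -- in `P`, against $16\cdot\frac12$ and $8\cdot\frac12$. Differences are at most $4xK<8K$ and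
  -- $3xK<6K$, against $\frac34\cdot16K$ and $\frac34\cdot8K$; the last comparison fixes
  -- $\theta=\frac34$.
  obtain ⟨w, hwbox, hwfix, hwuniq⟩ := exists_unique_fixedPoint_box T r (R := 1 / 2) (θ := 3 / 4)
    hr0 hrR (by norm_num) (by norm_num) (by
      intro w hw j
      by_cases hj : j ∈ P
      · simp [hT, hj, hrdef]
      have hw' : ∀ j, ‖w j‖ ≤ 1 / 2 := fun j => (hw j).trans (hrR j)
      have hrj : r j = 1 / 2 := by simp [hrdef, hj]
      simp only [hT, hj, if_false, hrj]
      rw [norm_div, div_le_iff₀ (hgap0 j hj)]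
      have h1 : ‖a * (S w) * w j‖ ≤ x * (1 / 2 + 1 / 2) * (1 / 2) :=
        norm_mul_le_of_le_of_le (norm_mul_le_of_le_of_le le_rfl
          (hS w _ hw')) (hw' _)
      have h2 : ‖a * (w (j - 1) + w (j + 1))‖ ≤ x * (r (j - 1) + r (j + 1)) :=
        norm_mul_le_of_le_of_le le_rfl (norm_add_le_of_le_of_le (hw _) (hw _))
      have h3 : ‖a * (p (j - 1) + p (j + 1))‖ ≤ x * 1 :=
        norm_mul_le_of_le_of_le le_rfl (hp1 j hj)
      have h4 := norm_sub_le (a * (S w) * w j - a * (w (j - 1) + w (j + 1)))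
        (a * (p (j - 1) + p (j + 1)))
      have h5 := norm_sub_le (a * (S w) * w j) (a * (w (j - 1) + w (j + 1)))
      rcases hgap j hj with h | ⟨h, h' | h'⟩
      · nlinarith [hrR (j - 1), hrR (j + 1)]
      · nlinarith [hrR (j + 1), hrP _ h']
      · nlinarith [hrR (j - 1), hrP _ h'])
    (by
      intro w w' K hw hw' hK j
      have hK0 : 0 ≤ K := (norm_nonneg _).trans (hK 0)
      by_cases hj : j ∈ P
      · simp only [hT, hj, if_true, sub_self, norm_zero]; positivity
      have hzP : ∀ i ∈ P, w i - w' i = 0 := fun i hi => by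
        have h1 := hw i
        have h2 := hw' i
        rw [hrP i hi] at h1 h2
        rw [norm_le_zero_iff.1 h1, norm_le_zero_iff.1 h2, sub_zero]
      simp only [hT, hj, if_false]
      rw [← sub_div, norm_div, div_le_iff₀ (hgap0 j hj)]
      have e : a * (S w) * w j - a * (w (j - 1) + w (j + 1))
            - a * (p (j - 1) + p (j + 1)) - (a * (S w') * w' j
            - a * (w' (j - 1) + w' (j + 1)) - a * (p (j - 1) + p (j + 1)))
          = a * (S w) * (w j - w' j)
            + a * (S (w - w')) * w' j
            - a * ((w (j - 1) - w' (j - 1)) + (w (j + 1) - w' (j + 1))) := by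
        simp only [hSdef, Pi.sub_apply]; ring
      rw [e]
      have h1 : ‖a * (S w) * (w j - w' j)‖ ≤ x * (1 / 2 + 1 / 2) * K :=
        norm_mul_le_of_le_of_le (norm_mul_le_of_le_of_le le_rfl
          (hS w _ fun j => (hw j).trans (hrR j))) (hK _)
      have h2 : ‖a * (S (w - w')) * w' j‖
          ≤ x * (K + K) * (1 / 2) :=
        norm_mul_le_of_le_of_le (norm_mul_le_of_le_of_le le_rfl
          (hS _ _ hK)) ((hw' _).trans (hrR _))
      have h3 : ‖a * ((w (j - 1) - w' (j - 1)) + (w (j + 1) - w' (j + 1)))‖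
          ≤ x * (‖w (j - 1) - w' (j - 1)‖ + ‖w (j + 1) - w' (j + 1)‖) :=
        norm_mul_le_of_le_of_le le_rfl (norm_add_le _ _)
      have h4 := norm_sub_le (a * (S w) * (w j - w' j)
            + a * (S (w - w')) * w' j)
            (a * ((w (j - 1) - w' (j - 1)) + (w (j + 1) - w' (j + 1))))
      have h5 := norm_add_le (a * (S w) * (w j - w' j))
            (a * (S (w - w')) * w' j)
      have hxK : x * K ≤ 2 * K := mul_le_mul_of_nonneg_right ha.le hK0
      rcases hgap j hj with h | ⟨h, h' | h'⟩
      · have h6 : x * (‖w (j - 1) - w' (j - 1)‖ + ‖w (j + 1) - w' (j + 1)‖) ≤ x * (K + K) :=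
          mul_le_mul_of_nonneg_left (add_le_add (hK _) (hK _)) hx0
        have h7 : 3 / 4 * K * 16 ≤ 3 / 4 * K * ‖freqSq τ j - freqSq τ n - κ‖ :=
          mul_le_mul_of_nonneg_left h (by positivity)
        linarith
      · have h6 : x * (‖w (j - 1) - w' (j - 1)‖ + ‖w (j + 1) - w' (j + 1)‖) ≤ x * (0 + K) :=
          mul_le_mul_of_nonneg_left (add_le_add (by simp [hzP _ h']) (hK _)) hx0
        have h7 : 3 / 4 * K * 8 ≤ 3 / 4 * K * ‖freqSq τ j - freqSq τ n - κ‖ :=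
          mul_le_mul_of_nonneg_left h (by positivity)
        linarith
      · have h6 : x * (‖w (j - 1) - w' (j - 1)‖ + ‖w (j + 1) - w' (j + 1)‖) ≤ x * (K + 0) :=
          mul_le_mul_of_nonneg_left (add_le_add (hK _) (by simp [hzP _ h'])) hx0
        have h7 : 3 / 4 * K * 8 ≤ 3 / 4 * K * ‖freqSq τ j - freqSq τ n - κ‖ :=
          mul_le_mul_of_nonneg_left h (by positivity)
        linarith)
  have hwP : ∀ j ∈ P, w j = 0 := fun j hj => by
    have := hwbox j
    rw [hrP j hj] at this
    exact norm_le_zero_iff.1 this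
  have hwrow : ∀ j ∉ P, (freqSq τ j - freqSq τ n - κ) * w j =
      a * (S w) * w j - a * (w (j - 1) + w (j + 1))
        - a * (p (j - 1) + p (j + 1)) := by
    intro j hj
    have h := congrFun hwfix j
    simp only [hT, hj, if_false] at h
    rw [← h, mul_div_cancel₀ _ (norm_pos_iff.1 (hgap0 j hj)), h]
  have hPP : ∀ j, -j - τ ∈ P ↔ j ∈ P := fun j =>
    ⟨fun h => by
      by_contra h'
      exact hPsym j h' h, fun h => by
      by_contra h'
      have := hPsym _ h'
      rw [show -(-j - τ) - τ = j by ring] at this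
      exact this h⟩
  have hwsym : IsSym τ ε w := by
    have hsc : ∀ (n' : ℤ) (u : ℤ → ℂ) , u (-n' - τ - 1) + u (-n' - τ + 1)
        = u (-(n' + 1) - τ) + u (-(n' - 1) - τ) := fun n' u => by
      congr 2 <;> ring
    have hp' : ∀ j, p (j - 1) + p (j + 1)
        = ε * (p (-j - τ - 1) + p (-j - τ + 1)) := by
      intro j
      rw [hsc j p, hpsym, hpsym]
      linear_combination (-(p (j - 1) + p (j + 1))) * hε
    -- The reflected sequence is again a fixed point in the box, so uniqueness forces the parity of
    -- `w`.
    have key : (fun j => ε * w (-j - τ)) = w := by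
      refine hwuniq _ (fun j => ?_) ?_
      · rw [norm_mul, hε1, one_mul]
        refine (hwbox _).trans (le_of_eq ?_)
        simp only [hrdef, hPP]
      · funext j
        by_cases hj : j ∈ P
        · have : w (-j - τ) = 0 := hwP _ ((hPP j).2 hj)
          simp [hT, hj, this]
        · have hrw := hwrow (-j - τ) (hPsym j hj)
          rw [freqSq_reflect] at hrw
          simp only [hT, hj, if_false]
          rw [div_eq_iff (norm_pos_iff.1 (hgap0 j hj))]
          have hSsym : S (fun j => ε * w (-j - τ)) = S w := by
            simp only [hSdef]
            rw [show -(n - 1) - τ = -n - τ + 1 by ring, show -(n + 1) - τ = -n - τ - 1 by ring,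
              show -(-n - τ - 1) - τ = n + 1 by ring, show -(-n - τ + 1) - τ = n - 1 by ring]
            linear_combination (1 / 2 * (w (n - 1) + w (n + 1))) * hε
          have e3 : -(j - 1) - τ = -j - τ + 1 := by ring
          have e4 : -(j + 1) - τ = -j - τ - 1 := by ring
          rw [hSsym, e3, e4, hp' j]
          linear_combination (-ε) * hrw
    intro j
    rw [← congrFun key j]
    linear_combination (-w (-j - τ)) * hε
  have hSn : S w = w (n - 1) + w (n + 1) := by
    have h1 := hwsym (n - 1)
    have h2 := hwsym (n + 1)
    rw [show -(n - 1) - τ = -n - τ + 1 by ring] at h1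
    rw [show -(n + 1) - τ = -n - τ - 1 by ring] at h2
    simp only [hSdef]
    rw [h1, h2]
    linear_combination (1 / 2 * (w (n - 1) + w (n + 1))) * hε
  set l : ℂ := freqSq τ n + κ + a * S w with hl
  have hrow0 : ∀ j ∉ P, mathieuSeq τ a (p + w) j = l * (p + w) j := by
    intro j hj
    have := hwrow j hj
    simp only [mathieuSeq_apply, Pi.add_apply, hp0 j hj, hl]
    linear_combination this
  have hrown : mathieuSeq τ a (p + w) n = l * (p + w) n := by
    simp only [mathieuSeq_apply, Pi.add_apply, hpn, hwP n hnP, hl, hκ, hSn]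
    ring
  have hvsym : IsSym τ ε (p + w) := hpsym.add hwsym
  refine ⟨l, p + w, hvsym, ?_, ?_, ?_, ?_⟩
  · funext j
    show _ = l * (p + w) j
    by_cases hj : j ∈ P
    · rcases hP j hj with h | h | ⟨h, h'⟩
      · rw [h]; exact hrown
      · rw [h, hvsym.mathieuSeq n, hrown, hvsym n]; ring
      · have h1 := hvsym.mathieuSeq (a := a) j
        have h2 := hvsym j
        rw [h', h] at h1 h2
        have h3 : mathieuSeq τ a (p + w) j = 0 := by linear_combination h1 / 2
        have h4 : (p + w) j = 0 := by linear_combination h2 / 2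
        rw [h3, h4, mul_zero]
    · exact hrow0 j hj
  · rw [hl]
    have : freqSq τ n + κ + a * S w - freqSq τ n - κ
        = a * S w := by ring
    rw [this]
    refine (norm_mul_le_of_le_of_le (le_refl x) 
      (hS w _ fun j => (hwbox j).trans (hrR j))).trans (by linarith)
  · intro j hj
    simp only [Pi.add_apply, hp0 j hj, zero_add]
    exact (hwbox j).trans (hrR j)
  · intro j hj
    simp [hwP j hj]

/-- One statement serves two ends: `c = 0` says that any eigenvector of this parity is a multiple of
`v`, and `z = l` with arbitrary `c` excludes generalised eigenvectors of this parity. -/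
theorem eq_smul_mode (ha : ‖a‖ < 2) (hpn : p n = 1) (hnP : n ∈ P)
    (hP : ∀ j ∈ P, j = n ∨ j = -n - τ ∨ (ε = -1 ∧ -j - τ = j)) {l : ℂ} {v : ℤ → ℂ}
    (hvs : IsSym τ ε v) (hv : mathieuSeq τ a v = l • v) (hvP : ∀ j ∉ P, ‖v j‖ ≤ 1 / 2)
    (hvp : ∀ j ∈ P, v j = p j) {z : ℂ}
    (hgap : ∀ j ∉ P, 12 ≤ ‖freqSq τ j - z‖ ∨
      (4 ≤ ‖freqSq τ j - z‖ ∧ (j - 1 ∈ P ∨ j + 1 ∈ P)))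
    {f : ℤ → ℂ} {C : ℝ} (hfC : ∀ j, ‖f j‖ ≤ C) (hfs : IsSym τ ε f) {c : ℂ}
    (hf : mathieuSeq τ a f - z • f = c • v) : f = f n • v := by
  have hx0 : 0 ≤ ‖a‖ := norm_nonneg a
  have hvn : v n = 1 := (hvp n hnP).trans hpn
  set g : ℤ → ℂ := f - f n • v with hg
  have hgs : IsSym τ ε g := hfs.sub (hvs.smul _)
  have hgP : ∀ j ∈ P, g j = 0 := by
    have hgn : g n = 0 := by simp [hg, hvn]
    intro j hj
    rcases hP j hj with h | h | ⟨h, h'⟩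
    · rw [h, hgn]
    · rw [h, hgs n, hgn, mul_zero]
    · have h1 := hgs j
      rw [h', h] at h1
      linear_combination h1 / 2
  have hgrow : ∀ j, (freqSq τ j - z) * g j =
      (c - f n * (l - z)) * v j - a * (g (j - 1) + g (j + 1)) := by
    intro j
    have h1 := congrFun hf j
    have h2 := congrFun hv j
    simp only [Pi.sub_apply, Pi.smul_apply, smul_eq_mul, mathieuSeq_apply] at h1 h2
    simp only [hg, Pi.sub_apply, Pi.smul_apply, smul_eq_mul]
    linear_combination h1 - f n * h2
  -- Row `n`, where `g` vanishes, expresses the unknown scalar through `g` itself, so the equation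
  -- for `g` becomes homogeneous.
  have hc : c - f n * (l - z) = a * (g (n - 1) + g (n + 1)) := by
    have := hgrow n
    rw [hgP n hnP, hvn] at this
    linear_combination -this
  have hvb : ∃ B, ∀ j, ‖v j‖ ≤ B := by
    refine ⟨max (1 / 2) (‖p n‖ + ‖p (-n - τ)‖), fun j => ?_⟩
    by_cases hj : j ∈ P
    · refine le_max_of_le_right ?_
      have hpp := norm_nonneg (p n)
      have hpp' := norm_nonneg (p (-n - τ))
      rcases hP j hj with h | h | ⟨h, h'⟩
      · rw [hvp j hj, h]; linarith
      · rw [hvp j hj, h]; linarith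
      · have h1 := hvs j
        rw [h', h] at h1
        have : v j = 0 := by linear_combination h1 / 2
        rw [this, norm_zero]; linarith
    · exact le_max_of_le_left (hvP j hj)
  obtain ⟨B, hB⟩ := hvb
  have hg0 : g = 0 := by
    -- The right-hand side is at most $2|a|K$ when a neighbour lies in `P` and $3|a|K$ otherwise;
    -- division by the gaps $4$ and $12$ gives at most $\frac{|a|}{2}K$.
    refine eq_zero_of_contracting (θ := ‖a‖ / 2) (C := C + ‖f n‖ * B) (by positivity) (by linarith)
      (fun j => ?_) fun K hK j => ?_
    · refine (norm_sub_le _ _).trans (add_le_add (hfC j) ?_)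
      rw [Pi.smul_apply, smul_eq_mul, norm_mul]
      exact mul_le_mul_of_nonneg_left (hB j) (norm_nonneg _)
    · have hK0 : 0 ≤ K := (norm_nonneg _).trans (hK 0)
      by_cases hj : j ∈ P
      · rw [hgP j hj, norm_zero]; positivity
      have h1 := congrArg norm (hgrow j)
      rw [norm_mul, hc] at h1
      have h2 := norm_sub_le (a * (g (n - 1) + g (n + 1)) * v j) (a * (g (j - 1) + g (j + 1)))
      have h3 : ‖a * (g (n - 1) + g (n + 1)) * v j‖ ≤ ‖a‖ * (K + K) * (1 / 2) :=
        norm_mul_le_of_le_of_le (norm_mul_le_of_le_of_le le_rfl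
          (norm_add_le_of_le_of_le (hK _) (hK _))) (hvP j hj)
      have h4 : ‖a * (g (j - 1) + g (j + 1))‖ ≤ ‖a‖ * (‖g (j - 1)‖ + ‖g (j + 1)‖) :=
        norm_mul_le_of_le_of_le le_rfl (norm_add_le _ _)
      have hg0 := norm_nonneg (g j)
      rcases hgap j hj with h | ⟨h, h' | h'⟩
      · have h6 : ‖a‖ * (‖g (j - 1)‖ + ‖g (j + 1)‖) ≤ ‖a‖ * (K + K) :=
          mul_le_mul_of_nonneg_left (add_le_add (hK _) (hK _)) hx0
        have h7 := mul_le_mul_of_nonneg_right h hg0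
        have h8 : 0 ≤ ‖a‖ * K := by positivity
        linarith
      · have h6 : ‖a‖ * (‖g (j - 1)‖ + ‖g (j + 1)‖) ≤ ‖a‖ * (0 + K) :=
          mul_le_mul_of_nonneg_left (add_le_add (by simp [hgP _ h']) (hK _)) hx0
        have h7 := mul_le_mul_of_nonneg_right h hg0
        linarith
      · have h6 : ‖a‖ * (‖g (j - 1)‖ + ‖g (j + 1)‖) ≤ ‖a‖ * (K + 0) :=
          mul_le_mul_of_nonneg_left (add_le_add (hK _) (by simp [hgP _ h'])) hx0
        have h7 := mul_le_mul_of_nonneg_right h hg0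
        linarith
  rw [hg] at hg0
  exact sub_eq_zero.1 hg0

end SimpleMode

/-! ### The even periodic block at the frequencies 0 and ±2 -/

theorem norm_freqSq (τ j : ℤ) : ‖freqSq τ j‖ = ((2 * j + τ : ℤ) : ℝ) ^ 2 := by
  rw [freqSq, norm_pow, Complex.norm_intCast, sq_abs]

theorem sixteen_le_norm_freqSq {j : ℤ} (hj : 2 ≤ |j|) : 16 ≤ ‖freqSq 0 j‖ := by
  rw [norm_freqSq]
  have : (2 : ℝ) ≤ |(j : ℝ)| := by exact_mod_cast hj
  push_cast
  nlinarith [sq_abs (j : ℝ), abs_nonneg (j : ℝ)]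

/-- The even sequence with entries `1` at `±1`. -/
def evenOne (j : ℤ) : ℂ := if |j| = 1 then 1 else 0

/-- The sequence with entry `1` at `0`. -/
def evenZero (j : ℤ) : ℂ := if j = 0 then 1 else 0

theorem norm_evenOne_le {j : ℤ} (hj : 2 ≤ |j|) : ‖evenOne (j - 1) + evenOne (j + 1)‖ ≤ 1 := by
  unfold evenOne
  by_cases h1 : |j - 1| = 1
  · have h2 : ¬|j + 1| = 1 := by grind
    simp [h1, h2]
  · by_cases h2 : |j + 1| = 1 <;> simp [h1, h2]

/-- The pair spans an invariant plane, normalised by the entries at `0` and `1`. Rows `0` and `1`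
give the matrix of the restriction; the rows with `2 ≤ |j|` form a coupled fixed-point problem for
the two tails. -/
theorem exists_even_pair {a : ℂ} (ha : ‖a‖ < 2) :
    ∃ f₀ f₁ : ℤ → ℂ, IsSym 0 1 f₀ ∧ IsSym 0 1 f₁ ∧ f₀ 0 = 1 ∧ f₀ 1 = 0 ∧ f₁ 0 = 0 ∧ f₁ 1 = 1 ∧
      (∀ j, 2 ≤ |j| → ‖f₀ j‖ ≤ 1 / 8) ∧ (∀ j, 2 ≤ |j| → ‖f₁ j‖ ≤ 1 / 3) ∧
      mathieuSeq 0 a f₀ = (a * (1 + f₀ 2)) • f₁ ∧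
      mathieuSeq 0 a f₁ = (2 * a) • f₀ + (4 + a * f₁ 2) • f₁ := by
  classical
  set x := ‖a‖ with hx
  have hx0 : 0 ≤ x := norm_nonneg a
  -- Again a symmetrised entry at `2`, so that uniqueness makes the tails even. The tag `false`
  -- stands for the tail of `f₀`, `true` for that of `f₁`.
  set S : Bool → (Bool × ℤ → ℂ) → ℂ := fun b w => 1 / 2 * (w (b, 2) + w (b, -2)) with hSdef
  have hS : ∀ (b : Bool) (w : Bool × ℤ → ℂ) (K : ℝ), (∀ j, ‖w (b, j)‖ ≤ K) → ‖S b w‖ ≤ K := by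
    intro b w K hK
    have h := norm_mul_le_of_le_of_le (le_of_eq (show ‖(1 / 2 : ℂ)‖ = 1 / 2 by norm_num))
      (norm_add_le_of_le_of_le (hK 2) (hK (-2)))
    exact h.trans (by linarith)
  set N : Bool × ℤ → (Bool × ℤ → ℂ) → ℂ := fun i w =>
    if i.1 then 2 * a * w (false, i.2) + (4 + a * S true w) * w (true, i.2)
      - a * (w (true, i.2 - 1) + w (true, i.2 + 1))
      - a * (evenOne (i.2 - 1) + evenOne (i.2 + 1))
    else a * (1 + S false w) * w (true, i.2) - a * (w (false, i.2 - 1) + w (false, i.2 + 1))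
    with hN
  set T : (Bool × ℤ → ℂ) → Bool × ℤ → ℂ := fun w i =>
    if 2 ≤ |i.2| then N i w / freqSq 0 i.2 else 0 with hT
  set r : Bool × ℤ → ℝ := fun i => if 2 ≤ |i.2| then (if i.1 then 1 / 3 else 1 / 8) else 0
    with hrdef
  have hr0 : ∀ i, 0 ≤ r i := fun i => by simp only [hrdef]; split_ifs <;> norm_num
  have hrt : ∀ j, r (true, j) ≤ 1 / 3 := fun i => by
    simp only [hrdef]; split_ifs <;> norm_num at *
  have hrf : ∀ j, r (false, j) ≤ 1 / 8 := fun i => by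
    simp only [hrdef]; split_ifs <;> norm_num at *
  have hfr : ∀ j : ℤ, 2 ≤ |j| → 0 < ‖freqSq 0 j‖ := fun j hj =>
    lt_of_lt_of_le (by norm_num) (sixteen_le_norm_freqSq hj)
  have h4 : ‖(4 : ℂ)‖ = 4 := by norm_num
  have h2a : ‖2 * a‖ ≤ 2 * x := by rw [norm_mul]; norm_num [hx]
  -- The decisive Lipschitz bound is that of the second component,
  -- $4K+\frac{14}3|a|K<\frac{40}3K\le14K=\frac78\cdot16K$.
  obtain ⟨w, hwbox, hwfix, hwuniq⟩ := exists_unique_fixedPoint_box T r (R := 1 / 3) (θ := 7 / 8)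
    hr0 (by rintro ⟨⟨⟩, j⟩; exacts [(hrf j).trans (by norm_num), hrt j])
    (by norm_num) (by norm_num) (by
      intro w hw i
      by_cases hi : 2 ≤ |i.2|
      swap
      · simp [hT, hi, hrdef]
      have hwt : ∀ j, ‖w (true, j)‖ ≤ 1 / 3 := fun j => (hw _).trans (hrt j)
      have hwf : ∀ j, ‖w (false, j)‖ ≤ 1 / 8 := fun j => (hw _).trans (hrf j)
      have hd := sixteen_le_norm_freqSq hi
      simp only [hT, hi, if_true]
      rw [norm_div, div_le_iff₀ (hfr _ hi)]
      obtain ⟨b, j⟩ := i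
      simp only at hi hd
      cases b
      · have hrj : r (false, j) = 1 / 8 := by simp [hrdef, hi]
        simp only [hN, Bool.false_eq_true, if_false, hrj]
        have h1 : ‖a * (1 + S false w) * w (true, j)‖ ≤ x * (1 + 1 / 8) * (1 / 3) :=
          norm_mul_le_of_le_of_le (norm_mul_le_of_le_of_le le_rfl
            (norm_add_le_of_le_of_le norm_one.le (hS _ _ _ hwf))) (hwt j)
        have h2 : ‖a * (w (false, j - 1) + w (false, j + 1))‖ ≤ x * (1 / 8 + 1 / 8) :=
          norm_mul_le_of_le_of_le le_rfl (norm_add_le_of_le_of_le (hwf _) (hwf _))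
        refine (norm_sub_le _ _).trans ((add_le_add h1 h2).trans ?_)
        linarith
      · have hrj : r (true, j) = 1 / 3 := by simp [hrdef, hi]
        simp only [hN, if_true, hrj]
        have h1 : ‖2 * a * w (false, j)‖ ≤ 2 * x * (1 / 8) := norm_mul_le_of_le_of_le h2a (hwf j)
        have h2 : ‖(4 + a * S true w) * w (true, j)‖ ≤ (4 + x * (1 / 3)) * (1 / 3) :=
          norm_mul_le_of_le_of_le (norm_add_le_of_le_of_le h4.le
            (norm_mul_le_of_le_of_le le_rfl (hS _ _ _ hwt))) (hwt j)
        have h3 : ‖a * (w (true, j - 1) + w (true, j + 1))‖ ≤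
            x * (r (true, j - 1) + r (true, j + 1)) :=
          norm_mul_le_of_le_of_le le_rfl (norm_add_le_of_le_of_le (hw _) (hw _))
        have h5 : ‖a * (evenOne (j - 1) + evenOne (j + 1))‖ ≤ x * 1 :=
          norm_mul_le_of_le_of_le le_rfl (norm_evenOne_le hi)
        have h6 : x * (r (true, j - 1) + r (true, j + 1)) ≤ x * (1 / 3 + 1 / 3) :=
          mul_le_mul_of_nonneg_left (add_le_add (hrt _) (hrt _)) hx0
        refine (norm_sub_le _ _).trans ?_
        refine (add_le_add (norm_sub_le _ _) le_rfl).trans ?_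
        refine (add_le_add (add_le_add (norm_add_le _ _) le_rfl) le_rfl).trans ?_
        -- The crude bound $4/3+73|a|/36$ can exceed $16/3$ when $|a|$ is close to $2$. For
        -- $|j|\ge3$ the diagonal is at least $36$; for $|j|=2$ one neighbour has no tail entry,
        -- which saves $|a|/3$.
        by_cases hj3 : 3 ≤ |j|
        · have hd' : 36 ≤ ‖freqSq 0 j‖ := by
            rw [norm_freqSq]
            have : (3 : ℝ) ≤ |(j : ℝ)| := by exact_mod_cast hj3
            push_cast
            nlinarith [sq_abs (j : ℝ), abs_nonneg (j : ℝ)]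
          linarith
        · have h7 : r (true, j - 1) + r (true, j + 1) ≤ 1 / 3 := by
            rcases abs_cases j with ⟨h, h'⟩ | ⟨h, h'⟩
            · have : ¬ 2 ≤ |j - 1| := by grind
              have h0 : r (true, j - 1) = 0 := by simp only [hrdef, this, if_false]
              rw [h0]; linarith [hrt (j + 1)]
            · have : ¬ 2 ≤ |j + 1| := by grind
              have h0 : r (true, j + 1) = 0 := by simp only [hrdef, this, if_false]
              rw [h0]; linarith [hrt (j - 1)]
          have h8 := mul_le_mul_of_nonneg_left h7 hx0
          linarith)
    (by
      intro w w' K hw hw' hK i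
      have hK0 : 0 ≤ K := (norm_nonneg _).trans (hK i)
      by_cases hi : 2 ≤ |i.2|
      swap
      · simp only [hT, hi, if_false, sub_self, norm_zero]; positivity
      have hwt : ∀ j, ‖w (true, j)‖ ≤ 1 / 3 := fun j => (hw _).trans (hrt j)
      have hwf : ∀ j, ‖w (false, j)‖ ≤ 1 / 8 := fun j => (hw _).trans (hrf j)
      have hwt' : ∀ j, ‖w' (true, j)‖ ≤ 1 / 3 := fun j => (hw' _).trans (hrt j)
      have hd := sixteen_le_norm_freqSq hi
      have hxK : x * K ≤ 2 * K := mul_le_mul_of_nonneg_right ha.le hK0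
      have hSd : ∀ b, ‖S b (w - w')‖ ≤ K := fun b => hS b (w - w') K fun j => hK (b, j)
      simp only [hT, hi, if_true]
      rw [← sub_div, norm_div, div_le_iff₀ (hfr _ hi)]
      refine le_trans ?_ (mul_le_mul_of_nonneg_left hd (by positivity))
      obtain ⟨b, j⟩ := i
      cases b
      · have e : N (false, j) w - N (false, j) w' =
            a * (1 + S false w) * (w (true, j) - w' (true, j))
            + a * S false (w - w') * w' (true, j)
            - a * ((w (false, j - 1) - w' (false, j - 1))
              + (w (false, j + 1) - w' (false, j + 1))) := by
          simp only [hN, hSdef, Bool.false_eq_true, if_false, Pi.sub_apply]; ring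
        rw [e]
        have h1 : ‖a * (1 + S false w) * (w (true, j) - w' (true, j))‖ ≤ x * (1 + 1 / 8) * K :=
          norm_mul_le_of_le_of_le (norm_mul_le_of_le_of_le le_rfl
            (norm_add_le_of_le_of_le norm_one.le (hS _ _ _ hwf))) (hK _)
        have h2 : ‖a * S false (w - w') * w' (true, j)‖ ≤ x * K * (1 / 3) :=
          norm_mul_le_of_le_of_le (norm_mul_le_of_le_of_le le_rfl (hSd _)) (hwt' _)
        have h3 : ‖a * ((w (false, j - 1) - w' (false, j - 1))
              + (w (false, j + 1) - w' (false, j + 1)))‖ ≤ x * (K + K) :=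
          norm_mul_le_of_le_of_le le_rfl (norm_add_le_of_le_of_le (hK _) (hK _))
        refine (norm_sub_le _ _).trans ((add_le_add (norm_add_le _ _) le_rfl).trans ?_)
        linarith
      · have e : N (true, j) w - N (true, j) w' =
            2 * a * (w (false, j) - w' (false, j))
            + (4 + a * S true w) * (w (true, j) - w' (true, j))
            + a * S true (w - w') * w' (true, j)
            - a * ((w (true, j - 1) - w' (true, j - 1))
              + (w (true, j + 1) - w' (true, j + 1))) := by
          simp only [hN, hSdef, if_true, Pi.sub_apply]; ring
        rw [e]
        have h0 : ‖2 * a * (w (false, j) - w' (false, j))‖ ≤ 2 * x * K :=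
          norm_mul_le_of_le_of_le h2a (hK _)
        have h1 : ‖(4 + a * S true w) * (w (true, j) - w' (true, j))‖ ≤ (4 + x * (1 / 3)) * K :=
          norm_mul_le_of_le_of_le (norm_add_le_of_le_of_le h4.le
            (norm_mul_le_of_le_of_le le_rfl (hS _ _ _ hwt))) (hK _)
        have h2 : ‖a * S true (w - w') * w' (true, j)‖ ≤ x * K * (1 / 3) :=
          norm_mul_le_of_le_of_le (norm_mul_le_of_le_of_le le_rfl (hSd _)) (hwt' _)
        have h3 : ‖a * ((w (true, j - 1) - w' (true, j - 1))
              + (w (true, j + 1) - w' (true, j + 1)))‖ ≤ x * (K + K) :=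
          norm_mul_le_of_le_of_le le_rfl (norm_add_le_of_le_of_le (hK _) (hK _))
        refine (norm_sub_le _ _).trans ((add_le_add (norm_add_le _ _) le_rfl).trans ?_)
        refine (add_le_add (add_le_add (norm_add_le _ _) le_rfl) le_rfl).trans ?_
        linarith)
  have hw0 : ∀ b (j : ℤ), ¬ 2 ≤ |j| → w (b, j) = 0 := fun b j hj => by
    have := hwbox (b, j)
    simp only [hrdef, hj, if_false] at this
    exact norm_le_zero_iff.1 this
  have hrow : ∀ b (j : ℤ), 2 ≤ |j| → freqSq 0 j * w (b, j) = N (b, j) w := fun b j hj => by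
    have h := congrFun hwfix (b, j)
    simp only [hT, hj, if_true] at h
    rw [← h, mul_div_cancel₀ _ (norm_pos_iff.1 (hfr j hj))]
  have hE : ∀ j, evenOne (-j) = evenOne j := fun j => by simp [evenOne]
  have hfrn : ∀ j, freqSq 0 (-j) = freqSq 0 j := fun j => by simpa using freqSq_reflect 0 j
  have hsym : (fun i : Bool × ℤ => w (i.1, -i.2)) = w := by
    refine hwuniq _ (fun i => ?_) ?_
    · refine (hwbox _).trans (le_of_eq ?_)
      simp only [hrdef, abs_neg]
    · funext i
      obtain ⟨b, j⟩ := i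
      by_cases hj : 2 ≤ |j|
      · have hj' : 2 ≤ |-j| := by rwa [abs_neg]
        have h := hrow b (-j) hj'
        rw [hfrn] at h
        simp only [hT, hj, if_true]
        rw [div_eq_iff (norm_pos_iff.1 (hfr j hj)), mul_comm _ (freqSq 0 j), h]
        have e1 : -(j - 1) = -j + 1 := by ring
        have e2 : -(j + 1) = -j - 1 := by ring
        have e3 := hE (j - 1)
        have e4 := hE (j + 1)
        rw [e1] at e3
        rw [e2] at e4
        simp only [hN, hSdef, e1, e2, e3, e4, neg_neg]
        cases b <;> simp <;> ring
      · have hj' : ¬ 2 ≤ |-j| := by rwa [abs_neg]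
        simp only [hT, hj, if_false]
        exact (hw0 b _ hj').symm
  have hsymm : ∀ b j, w (b, -j) = w (b, j) := fun b j => congrFun hsym (b, j)
  have hSw : ∀ b, S b w = w (b, 2) := fun b => by
    simp only [hSdef, hsymm b 2]; ring
  have h2nd : ∀ j : ℤ, ¬ 2 ≤ |j| → j = -1 ∨ j = 0 ∨ j = 1 := fun j hj => by
    rw [not_le, abs_lt] at hj; omega
  have f0 : freqSq 0 0 = 0 := by simp [freqSq]
  have f1 : freqSq 0 1 = 4 := by norm_num [freqSq]
  have fn1 : freqSq 0 (-1) = 4 := by norm_num [freqSq]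
  refine ⟨fun j => evenZero j + w (false, j), fun j => evenOne j + w (true, j), ?_, ?_, ?_, ?_,
    ?_, ?_, ?_, ?_, ?_, ?_⟩
  · intro j; simp [hsymm, evenZero]
  · intro j; simp [hsymm, hE]
  · simp [evenZero, hw0]
  · simp [evenZero, hw0]
  · simp [evenOne, hw0]
  · simp [evenOne, hw0]
  · intro j hj
    have h0 : j ≠ 0 := by rintro rfl; simp at hj
    simpa [evenZero, h0] using (hwbox (false, j)).trans (hrf j)
  · intro j hj
    have h0 : ¬ |j| = 1 := by omega
    simpa [evenOne, h0] using (hwbox (true, j)).trans (hrt j)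
  · funext j
    rw [mathieuSeq_apply]
    simp only [Pi.smul_apply, smul_eq_mul]
    by_cases hj : 2 ≤ |j|
    · have h := hrow false j hj
      have z0 : evenZero j = 0 := by simp [evenZero]; grind
      have z1 : evenZero (j - 1) = 0 := by simp [evenZero]; grind
      have z2 : evenZero (j + 1) = 0 := by simp [evenZero]; grind
      have z3 : evenOne j = 0 := by simp [evenOne]; omega
      have z4 : evenZero 2 = 0 := by simp [evenZero]
      simp only [hN, Bool.false_eq_true, if_false, hSw] at h
      rw [z0, z1, z2, z3, z4]
      linear_combination h
    · rcases h2nd j hj with rfl | rfl | rfl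
      · have := hsymm false 2
        simp [evenZero, evenOne, hw0, fn1, this]; left; ring
      · simp [evenZero, evenOne, hw0, f0]
      · simp [evenZero, evenOne, hw0, f1]
  · funext j
    rw [mathieuSeq_apply]
    simp only [Pi.smul_apply, smul_eq_mul, Pi.add_apply]
    by_cases hj : 2 ≤ |j|
    · have h := hrow true j hj
      have z0 : evenZero j = 0 := by simp [evenZero]; grind
      have z3 : evenOne j = 0 := by simp [evenOne]; omega
      have z4 : evenOne 2 = 0 := by simp [evenOne]
      simp only [hN, if_true, hSw] at h
      rw [z0, z3, z4]
      linear_combination h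
    · rcases h2nd j hj with rfl | rfl | rfl
      · have := hsymm true 2
        simp [evenZero, evenOne, hw0, fn1, this]
      · simp [evenZero, evenOne, hw0, f0]; ring
      · simp [evenZero, evenOne, hw0, f1]

/-- The analogue of `eq_smul_mode` for the plane: the rest `g` vanishes at `0` and `±1`, rows `0`
and `1` eliminate the two scalars, and the tail satisfies a bound with factor
$\frac73|a|/7=|a|/3<1$. -/
theorem eq_even_pair_combination {a : ℂ} (ha : ‖a‖ < 2) {f₀ f₁ : ℤ → ℂ} (h₀ : IsSym 0 1 f₀)
    (h₁ : IsSym 0 1 f₁) (h₀₀ : f₀ 0 = 1) (h₀₁ : f₀ 1 = 0) (h₁₀ : f₁ 0 = 0) (h₁₁ : f₁ 1 = 1)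
    (hb₀ : ∀ j, 2 ≤ |j| → ‖f₀ j‖ ≤ 1 / 8) (hb₁ : ∀ j, 2 ≤ |j| → ‖f₁ j‖ ≤ 1 / 3)
    (hL₀ : mathieuSeq 0 a f₀ = (a * (1 + f₀ 2)) • f₁)
    (hL₁ : mathieuSeq 0 a f₁ = (2 * a) • f₀ + (4 + a * f₁ 2) • f₁) {z : ℂ}
    (hgap : ∀ j : ℤ, 2 ≤ |j| → 7 ≤ ‖freqSq 0 j - z‖) {f : ℤ → ℂ} {C : ℝ}
    (hfC : ∀ j, ‖f j‖ ≤ C) (hfs : IsSym 0 1 f) {c₀ c₁ : ℂ}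
    (hf : mathieuSeq 0 a f - z • f = c₀ • f₀ + c₁ • f₁) : f = f 0 • f₀ + f 1 • f₁ := by
  set g : ℤ → ℂ := f - (f 0 • f₀ + f 1 • f₁) with hg
  have hgs : IsSym 0 1 g := hfs.sub ((h₀.smul _).add (h₁.smul _))
  have hg0 : g 0 = 0 := by simp [hg, h₀₀, h₁₀]
  have hg1 : g 1 = 0 := by simp [hg, h₀₁, h₁₁]
  have hgn1 : g (-1) = 0 := by have := hgs 1; simp only [sub_zero, hg1, mul_zero] at this; exact this
  have h2nd : ∀ j : ℤ, ¬ 2 ≤ |j| → j = -1 ∨ j = 0 ∨ j = 1 := fun j hj => by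
    rw [not_le, abs_lt] at hj; omega
  have hgP : ∀ j : ℤ, ¬ 2 ≤ |j| → g j = 0 := fun j hj => by
    rcases h2nd j hj with rfl | rfl | rfl <;> assumption
  set b₀ : ℂ := c₀ - (f 1 * (2 * a) - z * f 0) with hb₀'
  set b₁ : ℂ := c₁ - (f 0 * (a * (1 + f₀ 2)) + f 1 * (4 + a * f₁ 2) - z * f 1) with hb₁'
  have hgrow : ∀ j, (freqSq 0 j - z) * g j =
      b₀ * f₀ j + b₁ * f₁ j - a * (g (j - 1) + g (j + 1)) := by
    intro j
    have e1 := congrFun hf j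
    have e2 := congrFun hL₀ j
    have e3 := congrFun hL₁ j
    simp only [Pi.sub_apply, Pi.add_apply, Pi.smul_apply, smul_eq_mul, mathieuSeq_apply] at e1 e2 e3
    simp only [hg, hb₀', hb₁', Pi.sub_apply, Pi.add_apply, Pi.smul_apply, smul_eq_mul]
    linear_combination e1 - f 0 * e2 - f 1 * e3
  have hbz : b₀ = 0 := by
    have := hgrow 0
    simp only [hg0, h₀₀, h₁₀, zero_sub, zero_add, hg1, hgn1] at this
    linear_combination -this
  have hbo : b₁ = a * g 2 := by
    have := hgrow 1
    simp only [hg1, h₀₁, h₁₁, sub_self, hg0] at this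
    norm_num at this
    linear_combination -this
  have hbound : ∀ (u : ℤ → ℂ) (B : ℝ), IsSym 0 1 u → (∀ j, 2 ≤ |j| → ‖u j‖ ≤ B) →
      ∀ j, ‖u j‖ ≤ |B| + ‖u 0‖ + ‖u 1‖ := by
    intro u B hu hB j
    by_cases hj : 2 ≤ |j|
    · linarith [hB j hj, le_abs_self B, norm_nonneg (u 0), norm_nonneg (u 1)]
    · have := hu 1
      simp only [sub_zero, one_mul] at this
      rcases h2nd j hj with rfl | rfl | rfl
      · rw [this]; linarith [abs_nonneg B, norm_nonneg (u 0)]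
      · linarith [abs_nonneg B, norm_nonneg (u 1)]
      · linarith [abs_nonneg B, norm_nonneg (u 0)]
  have hB0 := hbound f₀ _ h₀ hb₀
  have hB1 := hbound f₁ _ h₁ hb₁
  have hgz : g = 0 := by
    refine eq_zero_of_contracting (θ := ‖a‖ / 3) (by positivity) (by linarith)
      (C := C + (‖f 0‖ * (|1 / 8| + ‖f₀ 0‖ + ‖f₀ 1‖) + ‖f 1‖ * (|1 / 3| + ‖f₁ 0‖ + ‖f₁ 1‖)))
      (fun j => ?_) fun K hK j => ?_
    · refine (norm_sub_le _ _).trans (add_le_add (hfC j) ?_)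
      exact norm_add_le_of_le_of_le (norm_mul_le_of_le_of_le le_rfl (hB0 j))
        (norm_mul_le_of_le_of_le le_rfl (hB1 j))
    · have hK0 : 0 ≤ K := (norm_nonneg _).trans (hK 0)
      by_cases hj : 2 ≤ |j|
      swap
      · rw [hgP j hj, norm_zero]; positivity
      have e1 := congrArg norm (hgrow j)
      rw [hbz, zero_mul, zero_add, hbo, norm_mul] at e1
      have e2 := norm_sub_le (a * g 2 * f₁ j) (a * (g (j - 1) + g (j + 1)))
      have e3 : ‖a * g 2 * f₁ j‖ ≤ ‖a‖ * K * (1 / 3) :=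
        norm_mul_le_of_le_of_le (norm_mul_le_of_le_of_le le_rfl (hK _)) (hb₁ j hj)
      have e4 : ‖a * (g (j - 1) + g (j + 1))‖ ≤ ‖a‖ * (K + K) :=
        norm_mul_le_of_le_of_le le_rfl (norm_add_le_of_le_of_le (hK _) (hK _))
      have e5 := mul_le_mul_of_nonneg_right (hgap j hj) (norm_nonneg (g j))
      linarith
  exact sub_eq_zero.1 hgz

/-! ### Absence of coexistence -/

/-- The row equation bounds `(freqSq τ j - z) * v j`, while the first factor tends to infinity. -/
theorem tendsto_zero_of_eigen {τ : ℤ} {a z : ℂ} {v : ℤ → ℂ} {C : ℝ} (hC : ∀ j, ‖v j‖ ≤ C)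
    (hv : mathieuSeq τ a v = z • v) :
    Filter.Tendsto v Filter.atTop (nhds 0) := by
  have hd : Filter.Tendsto (fun j : ℤ => ‖freqSq τ j - z‖) Filter.atTop Filter.atTop := by
    have h1 : Filter.Tendsto (fun j : ℤ => ((2 * j + τ : ℤ) : ℝ) ^ 2 - ‖z‖) Filter.atTop
        Filter.atTop := by
      have h2 : Filter.Tendsto (fun j : ℤ => ((2 * j + τ : ℤ) : ℝ)) Filter.atTop Filter.atTop := by
        refine tendsto_intCast_atTop_atTop.comp ?_
        refine Filter.tendsto_atTop_add_const_right _ _ ?_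
        exact Filter.Tendsto.const_mul_atTop' (by norm_num) Filter.tendsto_id
      exact Filter.tendsto_atTop_add_const_right _ _
        ((Filter.tendsto_pow_atTop two_ne_zero).comp h2)
    refine Filter.tendsto_atTop_mono (fun j => ?_) h1
    rw [← norm_freqSq]
    exact norm_sub_norm_le _ _
  have hb : ∀ j, ‖freqSq τ j - z‖ * ‖v j‖ ≤ ‖a‖ * (C + C) := fun j => by
    have h1 := congrFun hv j
    simp only [Pi.smul_apply, smul_eq_mul, mathieuSeq_apply] at h1
    have h2 : (freqSq τ j - z) * v j = -(a * (v (j - 1) + v (j + 1))) := by linear_combination h1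
    rw [← norm_mul, h2, norm_neg]
    exact norm_mul_le_of_le_of_le le_rfl (norm_add_le_of_le_of_le (hC _) (hC _))
  rw [tendsto_zero_iff_norm_tendsto_zero]
  have h0 : Filter.Tendsto (fun j : ℤ => (‖a‖ * (C + C)) / ‖freqSq τ j - z‖) Filter.atTop (nhds 0) :=
    hd.const_div_atTop _
  refine squeeze_zero' (Filter.Eventually.of_forall fun _ => norm_nonneg _) ?_ h0
  filter_upwards [hd.eventually_gt_atTop 0] with j hj
  rw [le_div_iff₀ hj, mul_comm]
  exact hb j

theorem eq_zero_of_consecutive {τ : ℤ} {a z : ℂ} (ha : a ≠ 0) {v : ℤ → ℂ}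
    (hv : mathieuSeq τ a v = z • v) {m : ℤ} (h₀ : v m = 0) (h₁ : v (m + 1) = 0) : v = 0 := by
  have hrow : ∀ j, a * (v (j - 1) + v (j + 1)) = (z - freqSq τ j) * v j := fun j => by
    have h1 := congrFun hv j
    simp only [Pi.smul_apply, smul_eq_mul, mathieuSeq_apply] at h1
    linear_combination h1
  have hup : ∀ k : ℕ, v (m + k) = 0 ∧ v (m + k + 1) = 0 := by
    intro k
    induction k with
    | zero => simpa using ⟨h₀, h₁⟩
    | succ k ih =>
      have h := hrow (m + k + 1)
      rw [show m + (k : ℤ) + 1 - 1 = m + k by ring, ih.1, ih.2, mul_zero, zero_add] at h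
      push_cast
      rw [← add_assoc]
      exact ⟨ih.2, (mul_eq_zero.1 h).resolve_left ha⟩
  have hdown : ∀ k : ℕ, v (m - k) = 0 ∧ v (m - k + 1) = 0 := by
    intro k
    induction k with
    | zero => simpa using ⟨h₀, h₁⟩
    | succ k ih =>
      have h := hrow (m - k)
      rw [ih.1, ih.2, mul_zero, add_zero] at h
      push_cast
      rw [show m - ((k : ℤ) + 1) = m - k - 1 by ring, sub_add_cancel]
      exact ⟨(mul_eq_zero.1 h).resolve_left ha, ih.1⟩
  funext j
  rcases le_total m j with h | h
  · obtain ⟨k, hk⟩ := Int.eq_ofNat_of_zero_le (sub_nonneg.2 h)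
    rw [show j = m + k by omega]; exact (hup k).1
  · obtain ⟨k, hk⟩ := Int.eq_ofNat_of_zero_le (sub_nonneg.2 h)
    rw [show j = m - k by omega]; exact (hdown k).1

/-- The discrete Wronskian of two solutions of the same recursion is constant in `j`, and it tends
to zero because both solutions do. Evaluated at the centre of the reflection, where the parities are
known, it yields two consecutive zeros of one of the sequences. -/
theorem no_coexistence {τ : ℤ} (hτ : τ = 0 ∨ τ = 1) {a z : ℂ} (ha : a ≠ 0) {e o : ℤ → ℂ}
    {C C' : ℝ} (heC : ∀ j, ‖e j‖ ≤ C) (hoC : ∀ j, ‖o j‖ ≤ C') (hes : IsSym τ 1 e)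
    (hos : IsSym τ (-1) o) (he : mathieuSeq τ a e = z • e) (ho : mathieuSeq τ a o = z • o) :
    e = 0 ∨ o = 0 := by
  have rowe : ∀ j, a * (e (j - 1) + e (j + 1)) = (z - freqSq τ j) * e j := fun j => by
    have h1 := congrFun he j
    simp only [Pi.smul_apply, smul_eq_mul, mathieuSeq_apply] at h1
    linear_combination h1
  have rowo : ∀ j, a * (o (j - 1) + o (j + 1)) = (z - freqSq τ j) * o j := fun j => by
    have h1 := congrFun ho j
    simp only [Pi.smul_apply, smul_eq_mul, mathieuSeq_apply] at h1
    linear_combination h1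
  set W : ℤ → ℂ := fun j => e j * o (j + 1) - e (j + 1) * o j with hW
  have hstep : ∀ j, W (j - 1) = W j := fun j => by
    refine mul_left_cancel₀ ha ?_
    simp only [hW, sub_add_cancel]
    linear_combination o j * rowe j - e j * rowo j
  have hstep' : ∀ j, W (j + 1) = W j := fun j => by
    have := hstep (j + 1); rw [add_sub_cancel_right] at this; exact this.symm
  have hWc : ∀ (k : ℕ) j, W (j + k) = W j := by
    intro k
    induction k with
    | zero => simp
    | succ k ih => intro j; push_cast; rw [← add_assoc, hstep', ih]
  have hlim : Filter.Tendsto W Filter.atTop (nhds 0) := by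
    have h1 := tendsto_zero_of_eigen heC he
    have h2 := tendsto_zero_of_eigen hoC ho
    have hs := Filter.tendsto_atTop_add_const_right Filter.atTop (1 : ℤ) Filter.tendsto_id
    simpa using (h1.mul (h2.comp hs)).sub ((h1.comp hs).mul h2)
  have hW0 : ∀ j, W j = 0 := fun j => by
    have h1 : Filter.Tendsto (fun k : ℕ => W (j + k)) Filter.atTop (nhds 0) :=
      hlim.comp (Filter.tendsto_atTop_add_const_left _ _ tendsto_natCast_atTop_atTop)
    simp only [hWc] at h1
    exact tendsto_nhds_unique tendsto_const_nhds h1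
  rcases hτ with rfl | rfl
  · have o0 : o 0 = 0 := by have := hos 0; norm_num at this; linear_combination this / 2
    have h := hW0 0
    simp only [hW, o0, mul_zero, sub_zero, zero_add, mul_eq_zero] at h
    rcases h with h | h
    · left
      have e1 : e (-1) = e 1 := by have := hes 1; norm_num at this; exact this
      have := rowe 0
      norm_num [h, e1] at this
      exact eq_zero_of_consecutive ha he h (m := 0) (by simpa using this.resolve_left ha)
    · right
      exact eq_zero_of_consecutive ha ho o0 (by simpa using h)
  · have o0 : o (-1) = -o 0 := by have := hos 0; norm_num at this; exact this
    have e0 : e (-1) = e 0 := by have := hes 0; norm_num at this; exact this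
    have h := hW0 (-1)
    simp only [hW, neg_add_cancel, o0, e0] at h
    have h' : e 0 = 0 ∨ o 0 = 0 := by
      rw [← mul_eq_zero]; linear_combination h / 2
    rcases h' with h' | h'
    · left
      exact eq_zero_of_consecutive ha he (m := -1) (by rw [e0, h']) (by simpa using h')
    · right
      exact eq_zero_of_consecutive ha ho (m := -1) (by rw [o0, h', neg_zero]) (by simpa using h')

/-! ### Decay -/

theorem one_add_sq_shift (j : ℝ) : 1 + j ^ 2 ≤ 3 * (1 + (j - 1) ^ 2) ∧
    1 + j ^ 2 ≤ 3 * (1 + (j + 1) ^ 2) :=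
  ⟨by nlinarith [sq_nonneg (2 * j - 3)], by nlinarith [sq_nonneg (2 * j + 3)]⟩

theorem one_add_sq_le_freqSq {τ : ℤ} (hτ : τ = 0 ∨ τ = 1) (j : ℤ) :
    1 + (j : ℝ) ^ 2 ≤ 1 + ‖freqSq τ j‖ := by
  rw [norm_freqSq]
  have : j ^ 2 ≤ (2 * j + τ) ^ 2 := by
    rcases hτ with rfl | rfl
    · nlinarith [sq_nonneg j]
    · rcases le_or_gt 0 j with h | h
      · nlinarith
      · nlinarith
  have h2 : ((j : ℝ)) ^ 2 ≤ ((2 * j + τ : ℤ) : ℝ) ^ 2 := by exact_mod_cast this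
  linarith

/-- One use of the row equation gains a factor $j^{-2}$. The second use, in `decay_sq_of_decay`,
gives $j^{-4}$, enough to sum two derivatives of the Fourier series. -/
theorem decay_of_bounded {τ : ℤ} (hτ : τ = 0 ∨ τ = 1) {a : ℂ} {v : ℤ → ℂ} {C C' : ℝ}
    (hv : ∀ j, ‖v j‖ ≤ C) (hL : ∀ j, ‖mathieuSeq τ a v j‖ ≤ C') :
    ∀ j : ℤ, (1 + (j : ℝ) ^ 2) * ‖v j‖ ≤ C + (C' + ‖a‖ * (C + C)) := by
  intro j
  have h1 : freqSq τ j * v j = mathieuSeq τ a v j - a * (v (j - 1) + v (j + 1)) := by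
    rw [mathieuSeq_apply]; ring
  have h2 : ‖freqSq τ j‖ * ‖v j‖ ≤ C' + ‖a‖ * (C + C) := by
    rw [← norm_mul, h1]
    exact (norm_sub_le _ _).trans (add_le_add (hL j)
      (norm_mul_le_of_le_of_le le_rfl (norm_add_le_of_le_of_le (hv _) (hv _))))
  have h3 := mul_le_mul_of_nonneg_right (one_add_sq_le_freqSq hτ j) (norm_nonneg (v j))
  linarith [hv j]

theorem decay_sq_of_decay {τ : ℤ} (hτ : τ = 0 ∨ τ = 1) {a : ℂ} {v : ℤ → ℂ} {C C' : ℝ}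
    (hv : ∀ j : ℤ, (1 + (j : ℝ) ^ 2) * ‖v j‖ ≤ C)
    (hL : ∀ j : ℤ, (1 + (j : ℝ) ^ 2) * ‖mathieuSeq τ a v j‖ ≤ C') :
    ∀ j : ℤ, (1 + (j : ℝ) ^ 2) ^ 2 * ‖v j‖ ≤ C + (C' + ‖a‖ * (3 * C + 3 * C)) := by
  intro j
  have hpos : 0 < 1 + (j : ℝ) ^ 2 := by positivity
  have h1 : freqSq τ j * v j = mathieuSeq τ a v j - a * (v (j - 1) + v (j + 1)) := by
    rw [mathieuSeq_apply]; ring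
  have hm : (1 + (j : ℝ) ^ 2) * ‖v (j - 1)‖ ≤ 3 * C := by
    have e1 := mul_le_mul_of_nonneg_right (one_add_sq_shift j).1 (norm_nonneg (v (j - 1)))
    have e2 := hv (j - 1)
    push_cast at e2
    linarith
  have hp : (1 + (j : ℝ) ^ 2) * ‖v (j + 1)‖ ≤ 3 * C := by
    have e1 := mul_le_mul_of_nonneg_right (one_add_sq_shift j).2 (norm_nonneg (v (j + 1)))
    have e2 := hv (j + 1)
    push_cast at e2
    linarith
  have h2 : ‖freqSq τ j‖ * ‖v j‖ ≤ ‖mathieuSeq τ a v j‖ + ‖a‖ * (‖v (j - 1)‖ + ‖v (j + 1)‖) := by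
    rw [← norm_mul, h1]
    exact (norm_sub_le _ _).trans (add_le_add le_rfl
      (norm_mul_le_of_le_of_le le_rfl (norm_add_le _ _)))
  have h3 := mul_le_mul_of_nonneg_right (one_add_sq_le_freqSq hτ j) (norm_nonneg (v j))
  have h4 : (1 + (j : ℝ) ^ 2) * ‖v j‖ ≤
      ‖v j‖ + (‖mathieuSeq τ a v j‖ + ‖a‖ * (‖v (j - 1)‖ + ‖v (j + 1)‖)) := by linarith
  have h5 := mul_le_mul_of_nonneg_left h4 hpos.le
  have h6 := mul_le_mul_of_nonneg_left (add_le_add hm hp) (norm_nonneg a)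
  have h7 := hv j
  have h8 := hL j
  nlinarith

theorem summable_of_decay_sq {v : ℤ → ℂ} {C : ℝ}
    (hv : ∀ j : ℤ, (1 + (j : ℝ) ^ 2) ^ 2 * ‖v j‖ ≤ C) :
    Summable fun j : ℤ => (1 + (j : ℝ) ^ 2) * ‖v j‖ := by
  have hs : Summable fun j : ℤ => C * (1 / (1 + (j : ℝ) ^ 2)) := by
    refine Summable.mul_left _ ?_
    have h0 : Summable fun j : ℤ => 1 / (j : ℝ) ^ 2 :=
      Real.summable_one_div_int_pow.2 one_lt_two
    have h1 : Summable fun j : ℤ => (1 / (j : ℝ) ^ 2 + if j = 0 then 1 else 0) :=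
      h0.add (summable_of_ne_finset_zero (s := {0}) (fun j hj => by simpa using hj))
    refine Summable.of_nonneg_of_le (fun j => by positivity) (fun j => ?_) h1
    by_cases hj : j = 0
    · simp [hj]
    · have : (0 : ℝ) < (j : ℝ) ^ 2 := by positivity
      simp only [hj, if_false, add_zero]
      exact one_div_le_one_div_of_le this (by linarith)
  refine Summable.of_nonneg_of_le (fun j => by positivity) (fun j => ?_) hs
  have hpos : 0 < 1 + (j : ℝ) ^ 2 := by positivity
  rw [mul_one_div, le_div_iff₀ hpos]
  linarith [hv j]

/-! ### Integration by parts for primitives of integrable functions -/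

theorem absolutelyContinuousOnInterval_primitive {f : ℝ → ℂ} {a b : ℝ}
    (hf : IntervalIntegrable f volume a b) :
    AbsolutelyContinuousOnInterval (fun x => ∫ t in a..x, f t) a b := by
  have hn := hf.norm.absolutelyContinuousOnInterval_intervalIntegral (c := a) Set.left_mem_uIcc
  rw [absolutelyContinuousOnInterval_iff] at hn ⊢
  intro ε hε
  obtain ⟨δ, hδ, h⟩ := hn ε hε
  refine ⟨δ, hδ, fun E hE hE' => lt_of_le_of_lt (Finset.sum_le_sum fun i hi => ?_) (h E hE hE')⟩
  have hi := hE.1 i hi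
  have i1 : IntervalIntegrable f volume a (E.2 i).1 :=
    hf.mono_set (Set.uIcc_subset_uIcc Set.left_mem_uIcc hi.1)
  have i2 : IntervalIntegrable f volume a (E.2 i).2 :=
    hf.mono_set (Set.uIcc_subset_uIcc Set.left_mem_uIcc hi.2)
  rw [dist_eq_norm, dist_eq_norm, intervalIntegral.integral_interval_sub_left i1 i2,
    intervalIntegral.integral_interval_sub_left i1.norm i2.norm]
  exact intervalIntegral.norm_integral_le_abs_integral_norm

/-- Here `g` is only integrable, so the product rule holds almost everywhere. The product minus the
primitive of its derivative is absolutely continuous with derivative zero almost everywhere, hence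
constant. -/
theorem integral_mul_eq_sub_of_primitive {g G φ φ' : ℝ → ℂ} {a b : ℝ} (hab : a ≤ b)
    (hg : IntervalIntegrable g volume a b)
    (hG : ∀ x ∈ Set.Icc a b, G x = G a + ∫ s in a..x, g s)
    (hφ : ∀ x, HasDerivAt φ (φ' x) x) (hφ' : Continuous φ') :
    ∫ x in a..b, g x * φ x = G b * φ b - G a * φ a - ∫ x in a..b, G x * φ' x := by
  set P : ℝ → ℂ := fun x => ∫ s in a..x, g s with hP
  have hPac : AbsolutelyContinuousOnInterval P a b := absolutelyContinuousOnInterval_primitive hg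
  have hφc : Continuous φ := continuous_iff_continuousAt.2 fun x => (hφ x).continuousAt
  have hφac : AbsolutelyContinuousOnInterval φ a b := by
    refine ContDiffOn.absolutelyContinuousOnInterval (ContDiff.contDiffOn ?_)
    rw [contDiff_one_iff_deriv]
    refine ⟨fun x => (hφ x).differentiableAt, ?_⟩
    rwa [show deriv φ = φ' from funext fun x => (hφ x).deriv]
  have hint' : IntervalIntegrable (fun x => P x * φ' x) volume a b :=
    (hPac.continuousOn.mul hφ'.continuousOn).intervalIntegrable
  have hint : IntervalIntegrable (fun x => g x * φ x + P x * φ' x) volume a b :=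
    (hg.mul_continuousOn hφc.continuousOn).add hint'
  have hac : AbsolutelyContinuousOnInterval
      (P • φ - fun x => ∫ s in a..x, (g s * φ s + P s * φ' s)) a b :=
    (hPac.smul hφac).sub (absolutelyContinuousOnInterval_primitive hint)
  obtain ⟨c, hc⟩ := hac.const_of_ae_hasDerivAt_zero (by
    filter_upwards [hg.ae_hasDerivAt_integral, hint.ae_hasDerivAt_integral] with x h1 h2 hx
    have d1 := h1 hx a Set.left_mem_uIcc
    have d2 := h2 hx a Set.left_mem_uIcc
    have := (d1.mul (hφ x)).sub d2
    simp only [hP] at this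
    rw [sub_self] at this
    exact this)
  have ha := hc a Set.left_mem_uIcc
  have hb := hc b Set.right_mem_uIcc
  have hsm : ∀ x, (P • φ) x = P x * φ x := fun _ => rfl
  simp only [Pi.sub_apply, hsm] at ha hb
  rw [intervalIntegral.integral_same, show P a = 0 from intervalIntegral.integral_same] at ha
  rw [intervalIntegral.integral_add (hg.mul_continuousOn hφc.continuousOn) hint'] at hb
  have hGint : ∫ x in a..b, G x * φ' x = G a * (φ b - φ a) + ∫ x in a..b, P x * φ' x := by
    have e1 : ∫ x in a..b, G x * φ' x = ∫ x in a..b, (G a * φ' x + P x * φ' x) := by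
      refine intervalIntegral.integral_congr fun x hx => ?_
      rw [Set.uIcc_of_le hab] at hx
      rw [hG x hx]; ring
    rw [e1, intervalIntegral.integral_add ((hφ'.const_mul _ |>.continuousOn).intervalIntegrable) hint',
      intervalIntegral.integral_const_mul,
      intervalIntegral.integral_eq_sub_of_hasDerivAt (fun x _ => hφ x)
        (hφ'.continuousOn.intervalIntegrable)]
  have hGb : G b = G a + P b := hG b ⟨hab, le_rfl⟩
  rw [hGint, hGb]
  linear_combination ha - hb

/-! ### Fourier coefficients -/

/-- The function `e^{-i(2j+τ)x}`. -/
def modeExp (τ j : ℤ) (x : ℝ) : ℂ := exp (-(I * (2 * j + τ) * x))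

theorem continuous_modeExp (τ j : ℤ) : Continuous (modeExp τ j) := by
  unfold modeExp; fun_prop

theorem norm_modeExp (τ j : ℤ) (x : ℝ) : ‖modeExp τ j x‖ = 1 := by
  rw [modeExp, show -(I * (2 * (j : ℂ) + τ) * x) = ((-((2 * j + τ) * x) : ℝ) : ℂ) * I by
    push_cast; ring, norm_exp_ofReal_mul_I]

theorem modeExp_zero (τ j : ℤ) : modeExp τ j 0 = 1 := by simp [modeExp]

theorem hasDerivAt_modeExp (τ j : ℤ) (x : ℝ) :
    HasDerivAt (modeExp τ j) (-(I * (2 * j + τ)) * modeExp τ j x) x := by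
  have h1 : HasDerivAt (fun x : ℝ => -(I * (2 * j + τ) * x)) (-(I * (2 * j + τ))) x := by
    have := ((hasDerivAt_id x).ofReal_comp.const_mul (-(I * (2 * (j : ℂ) + τ))))
    simpa [neg_mul] using this
  have h2 := h1.cexp
  rw [mul_comm (exp _)] at h2
  exact h2

theorem modeExp_pi (τ j : ℤ) : modeExp τ j Real.pi * exp (I * ((Real.pi * τ : ℝ) : ℂ)) = 1 := by
  rw [modeExp, ← exp_add, show -(I * (2 * (j : ℂ) + τ) * (Real.pi : ℂ)) +
    I * ((Real.pi * τ : ℝ) : ℂ) = ((-j : ℤ) : ℂ) * (2 * Real.pi * I) by push_cast; ring]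
  exact exp_int_mul_two_pi_mul_I _

/-- The Fourier coefficients `∫₀^π f(x) e^{-i(2j+τ)x} dx`. -/
def coeff (τ : ℤ) (f : ℝ → ℂ) (j : ℤ) : ℂ := ∫ x in (0 : ℝ)..Real.pi, f x * modeExp τ j x

theorem coeff_congr_ae {τ : ℤ} {f g : ℝ → ℂ}
    (h : f =ᵐ[volume.restrict (Set.Icc (0 : ℝ) Real.pi)] g) : coeff τ f = coeff τ g := by
  funext j
  refine intervalIntegral.integral_congr_ae_restrict ?_
  rw [Set.uIoc_of_le Real.pi_pos.le, restrict_Ioc_eq_restrict_Icc]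
  filter_upwards [h] with x hx
  rw [hx]

theorem memLp_intervalIntegrable {f : ℝ → ℂ}
    (hf : MemLp f 2 (volume.restrict (Set.Icc (0 : ℝ) Real.pi))) :
    IntervalIntegrable f volume 0 Real.pi := by
  rw [intervalIntegrable_iff_integrableOn_Icc_of_le Real.pi_pos.le]
  exact hf.integrable (by norm_num)

theorem coeff_add {τ : ℤ} {f g : ℝ → ℂ} (hf : IntervalIntegrable f volume 0 Real.pi)
    (hg : IntervalIntegrable g volume 0 Real.pi) : coeff τ (f + g) = coeff τ f + coeff τ g := by
  funext j
  simp only [coeff, Pi.add_apply, add_mul]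
  exact intervalIntegral.integral_add
    (hf.mul_continuousOn (continuous_modeExp τ j).continuousOn)
    (hg.mul_continuousOn (continuous_modeExp τ j).continuousOn)

theorem coeff_smul {τ : ℤ} (c : ℂ) (f : ℝ → ℂ) : coeff τ (c • f) = c • coeff τ f := by
  funext j
  simp only [coeff, Pi.smul_apply, smul_eq_mul, mul_assoc]
  exact intervalIntegral.integral_const_mul _ _

/-- The Fourier coefficients as a linear map on `L₂[0, π]`. -/
def coeffL (τ : ℤ) : L2 →ₗ[ℂ] (ℤ → ℂ) where
  toFun f := coeff τ f
  map_add' f g := by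
    rw [coeff_congr_ae (Lp.coeFn_add f g), coeff_add (memLp_intervalIntegrable (Lp.memLp f))
      (memLp_intervalIntegrable (Lp.memLp g))]
  map_smul' c f := by
    rw [coeff_congr_ae (Lp.coeFn_smul c f), coeff_smul, RingHom.id_apply]

theorem coeffL_apply (τ : ℤ) (f : L2) : coeffL τ f = coeff τ f := rfl

theorem coeffL_bounded (τ : ℤ) (f : L2) : ∃ C, ∀ j, ‖coeffL τ f j‖ ≤ C := by
  refine ⟨∫ x in (0 : ℝ)..Real.pi, ‖f x‖, fun j => ?_⟩
  rw [coeffL_apply, coeff]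
  refine (intervalIntegral.norm_integral_le_integral_norm Real.pi_pos.le).trans (le_of_eq ?_)
  simp only [norm_mul, norm_modeExp, mul_one]

theorem coeff_potential_mul {τ : ℤ} {a : ℂ} {y : ℝ → ℂ}
    (hy : IntervalIntegrable y volume 0 Real.pi) (j : ℤ) :
    coeff τ (fun x => mathieuPotential a x * y x) j
      = a * (coeff τ y (j - 1) + coeff τ y (j + 1)) := by
  have e : ∀ x : ℝ, mathieuPotential a x * y x * modeExp τ j x
      = a * (y x * modeExp τ (j - 1) x + y x * modeExp τ (j + 1) x) := by
    intro x
    have h1 : exp (-(I * 2 * x)) * modeExp τ j x = modeExp τ (j + 1) x := by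
      simp only [modeExp]; rw [← exp_add]; congr 1; push_cast; ring
    have h2 : exp (I * 2 * x) * modeExp τ j x = modeExp τ (j - 1) x := by
      simp only [modeExp]; rw [← exp_add]; congr 1; push_cast; ring
    rw [← h1, ← h2]
    show potential a x * y x * modeExp τ j x = _
    unfold potential
    ring
  simp only [coeff, e, intervalIntegral.integral_const_mul]
  rw [intervalIntegral.integral_add
    (hy.mul_continuousOn (continuous_modeExp τ _).continuousOn)
    (hy.mul_continuousOn (continuous_modeExp τ _).continuousOn)]

/-- Two integrations by parts; the boundary terms cancel because the exponential at $\pi$ is inverse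
to the quasi-periodicity factor. -/
theorem coeff_second_deriv {τ : ℤ} {y y₁ g : ℝ → ℂ} (h : IsH2 y y₁ g)
    (hB : (y 0, y₁ 0, y Real.pi, y₁ Real.pi) ∈ quasiPeriodic (Real.pi * τ)) (j : ℤ) :
    coeff τ g j = -(freqSq τ j * coeff τ y j) := by
  have hB1 : y Real.pi = exp (I * ((Real.pi * τ : ℝ) : ℂ)) * y 0 := hB.1
  have hB2 : y₁ Real.pi = exp (I * ((Real.pi * τ : ℝ) : ℂ)) * y₁ 0 := hB.2
  have hm := modeExp_pi τ j
  generalize exp (I * ((Real.pi * τ : ℝ) : ℂ)) = E at hB1 hB2 hm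
  have hc : Continuous fun x => -(I * (2 * (j : ℂ) + τ)) * modeExp τ j x :=
    (continuous_modeExp τ j).const_mul _
  have hy₁ : IntervalIntegrable y₁ volume 0 Real.pi :=
    h.continuousOn_deriv.intervalIntegrable_of_Icc Real.pi_pos.le
  have e1 := integral_mul_eq_sub_of_primitive Real.pi_pos.le h.intervalIntegrable h.deriv_eq
    (hasDerivAt_modeExp τ j) hc
  have e2 := integral_mul_eq_sub_of_primitive Real.pi_pos.le hy₁ h.fun_eq
    (hasDerivAt_modeExp τ j) hc
  have e3 : ∀ u : ℝ → ℂ, ∫ x in (0 : ℝ)..Real.pi, u x * (-(I * (2 * j + τ)) * modeExp τ j x)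
      = -(I * (2 * j + τ)) * ∫ x in (0 : ℝ)..Real.pi, u x * modeExp τ j x := fun u => by
    rw [← intervalIntegral.integral_const_mul]
    congr 1; funext x; ring
  rw [e3] at e1 e2
  simp only [coeff, freqSq]
  rw [e1, e2, hB1, hB2, modeExp_zero]
  push_cast
  linear_combination (y₁ 0 + I * (2 * j + τ) * y 0) * hm +
    (2 * (j : ℂ) + τ) ^ 2 * (∫ x in (0 : ℝ)..Real.pi, y x * modeExp τ j x) * I_sq

theorem coeffL_hill {τ : ℤ} {a : ℂ} {p : L2 × L2}
    (hp : p ∈ hillGraph (mathieuPotential a) (quasiPeriodic (Real.pi * τ))) :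
    coeffL τ p.2 = mathieuSeq τ a (coeffL τ p.1) := by
  obtain ⟨y, y₁, g, h, hB, e₁, e₂⟩ := hp
  rw [coeffL_apply, coeffL_apply, coeff_congr_ae e₁, coeff_congr_ae e₂]
  have hy : IntervalIntegrable y volume 0 Real.pi :=
    h.continuousOn.intervalIntegrable_of_Icc Real.pi_pos.le
  have hq : IntervalIntegrable (fun x => mathieuPotential a x * y x) volume 0 Real.pi :=
    (hy.continuousOn_mul (mathieuPotential a).continuous.continuousOn)
  funext j
  have e : (fun x => -g x + mathieuPotential a x * y x)
      = (-1 : ℂ) • g + fun x => mathieuPotential a x * y x := by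
    funext x; simp
  rw [e, coeff_add (show IntervalIntegrable ((-1 : ℂ) • g) volume 0 Real.pi from
    h.intervalIntegrable.const_mul _) hq, coeff_smul, Pi.add_apply,
    coeff_potential_mul hy, Pi.smul_apply, coeff_second_deriv h hB, mathieuSeq_apply, smul_eq_mul]
  ring

theorem ae_eq_zero_of_coeff_eq_zero {τ : ℤ} {f : ℝ → ℂ}
    (hf : MemLp f 2 (volume.restrict (Set.Icc (0 : ℝ) Real.pi))) (h : coeff τ f = 0) :
    f =ᵐ[volume.restrict (Set.Icc (0 : ℝ) Real.pi)] 0 := by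
  -- Removing the phase $e^{i\tau x}$ turns `coeff` into multiples of the ordinary Fourier
  -- coefficients on an interval of length $\pi$, so that Parseval applies.
  set g : ℝ → ℂ := fun x => f x * exp (-(I * τ * x)) with hg
  have hgn : ∀ x, ‖g x‖ = ‖f x‖ := fun x => by
    have := norm_modeExp τ 0 x
    rw [modeExp] at this
    rw [hg, norm_mul, show -(I * (τ : ℂ) * x) = -(I * (2 * ((0 : ℤ) : ℂ) + τ) * x) by
      push_cast; ring, this, mul_one]
  have hgL : MemLp g 2 (volume.restrict (Set.Ioc (0 : ℝ) Real.pi)) := by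
    rw [restrict_Ioc_eq_restrict_Icc]
    refine hf.of_le (hf.aestronglyMeasurable.mul (Continuous.aestronglyMeasurable (by fun_prop)))
      (Filter.Eventually.of_forall fun x => (hgn x).le)
  have hcoef : ∀ n, fourierCoeffOn Real.pi_pos g n = 0 := by
    intro n
    rw [fourierCoeffOn_eq_integral]
    have : ∀ x : ℝ, (fourier (-n) (x : AddCircle (Real.pi - 0)) : ℂ) • g x
        = f x * modeExp τ n x := fun x => by
      rw [fourier_coe_apply, hg, modeExp, smul_eq_mul, ← mul_assoc, mul_comm _ (f x), mul_assoc,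
        ← exp_add]
      congr 2
      have : (Real.pi : ℂ) ≠ 0 := by exact_mod_cast Real.pi_ne_zero
      push_cast
      field_simp
      ring
    simp only [this]
    have h2 := congrFun h n
    simp only [coeff, Pi.zero_apply] at h2
    rw [h2, smul_zero]
  have hsum := hasSum_sq_fourierCoeffOn Real.pi_pos hgL
  simp only [hcoef, norm_zero, ne_eq, OfNat.ofNat_ne_zero, not_false_eq_true, zero_pow] at hsum
  have h0 := hsum.unique hasSum_zero
  have hint : ∫ x in (0 : ℝ)..Real.pi, ‖g x‖ ^ 2 = 0 := by
    have hpi : (Real.pi - 0)⁻¹ ≠ 0 := by simp [Real.pi_ne_zero]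
    exact (smul_eq_zero.1 h0).resolve_left hpi
  rw [intervalIntegral.integral_of_le Real.pi_pos.le, integral_eq_zero_iff_of_nonneg
    (fun x => by positivity) (by simpa using hgL.integrable_norm_pow two_ne_zero)] at hint
  rw [← restrict_Ioc_eq_restrict_Icc]
  filter_upwards [hint] with x hx
  have : ‖g x‖ = 0 := by simpa using hx
  rw [hgn] at this
  simpa using this

theorem coeffL_injective (τ : ℤ) : Function.Injective (coeffL τ) := by
  rw [← LinearMap.ker_eq_bot, LinearMap.ker_eq_bot']
  intro f hf
  exact (Lp.eq_zero_iff_ae_eq_zero).2 (ae_eq_zero_of_coeff_eq_zero (Lp.memLp f) hf)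

/-! ### Synthesis of functions from their Fourier coefficients -/

theorem freq_sq_le {τ : ℤ} (hτ : τ = 0 ∨ τ = 1) (j : ℤ) :
    ((2 * j + τ : ℤ) : ℝ) ^ 2 ≤ 9 * (1 + (j : ℝ) ^ 2) := by
  have : (2 * j + τ) ^ 2 ≤ 9 * (1 + j ^ 2) := by
    rcases hτ with rfl | rfl
    · nlinarith [sq_nonneg j]
    · nlinarith [sq_nonneg (2 * j - 1)]
  exact_mod_cast this

/-- The function `∑ b_j e^{i(2j+τ)x}`. -/
def synth (τ : ℤ) (b : ℤ → ℂ) (x : ℝ) : ℂ := ∑' j, b j * modeExp (-τ) (-j) x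

theorem continuous_synth {τ : ℤ} {b : ℤ → ℂ} (hb : Summable fun j => ‖b j‖) :
    Continuous (synth τ b) := by
  refine continuous_tsum (fun j => (continuous_modeExp _ _).const_mul _) hb fun j x => ?_
  rw [norm_mul, norm_modeExp, mul_one]

theorem hasDerivAt_synth {τ : ℤ} {b : ℤ → ℂ} (hb : Summable fun j => ‖b j‖)
    (hb' : Summable fun j => ‖I * (2 * j + τ) * b j‖) (x : ℝ) :
    HasDerivAt (synth τ b) (synth τ (fun j => I * (2 * j + τ) * b j) x) x := by
  refine hasDerivAt_tsum (u := fun j => ‖I * (2 * j + τ) * b j‖)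
    (g := fun j x => b j * modeExp (-τ) (-j) x)
    (g' := fun j x => I * (2 * j + τ) * b j * modeExp (-τ) (-j) x) (y₀ := 0)
    hb' (fun j y => ?_) (fun j y => ?_) ?_ x
  · have := (hasDerivAt_modeExp (-τ) (-j) y).const_mul (b j)
    convert! this using 1
    push_cast; ring
  · rw [norm_mul, norm_modeExp, mul_one]
  · simp only [modeExp_zero, mul_one]
    exact hb.of_norm

theorem coeff_synth {τ : ℤ} {b : ℤ → ℂ} (hb : Summable fun j => ‖b j‖) (k : ℤ) :
    coeff τ (synth τ b) k = Real.pi * b k := by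
  have hterm : ∀ j, ∫ x in (0 : ℝ)..Real.pi, b j * modeExp (-τ) (-j) x * modeExp τ k x
      = if j = k then Real.pi * b k else 0 := by
    intro j
    have e : ∀ x : ℝ, b j * modeExp (-τ) (-j) x * modeExp τ k x
        = b j * exp (2 * I * (j - k) * x) := fun x => by
      rw [mul_assoc]
      congr 1
      simp only [modeExp]; rw [← exp_add]; congr 1; push_cast; ring
    simp only [e, intervalIntegral.integral_const_mul]
    split_ifs with h
    · subst h; simp [mul_comm]
    · have hc : 2 * I * ((j : ℂ) - k) ≠ 0 := by
        have : (j : ℂ) - k ≠ 0 := sub_ne_zero.2 (by exact_mod_cast h)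
        simp [this]
      rw [integral_exp_mul_complex hc]
      rw [show 2 * I * ((j : ℂ) - k) * (Real.pi : ℂ) = ((j - k : ℤ) : ℂ) * (2 * Real.pi * I) by
        push_cast; ring, exp_int_mul_two_pi_mul_I]
      simp
  have hs : HasSum (fun j => ∫ x in (0 : ℝ)..Real.pi, b j * modeExp (-τ) (-j) x * modeExp τ k x)
      (∫ x in (0 : ℝ)..Real.pi, synth τ b x * modeExp τ k x) := by
    refine intervalIntegral.hasSum_integral_of_dominated_convergence (fun j _ => ‖b j‖)
      (fun j => Continuous.aestronglyMeasurable
        (((continuous_modeExp _ _).const_mul _).mul (continuous_modeExp _ _)))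
      (fun j => Filter.Eventually.of_forall fun x _ => ?_)
      (Filter.Eventually.of_forall fun x _ => hb) (by simp)
      (Filter.Eventually.of_forall fun x _ => ?_)
    · rw [norm_mul, norm_mul, norm_modeExp, norm_modeExp, mul_one, mul_one]
    · refine HasSum.mul_right _ (Summable.hasSum (Summable.of_norm ?_))
      simpa only [norm_mul, norm_modeExp, mul_one] using hb
  simp only [hterm] at hs
  have h2 := hs.unique (hasSum_ite_eq k ((Real.pi : ℂ) * b k))
  exact h2

theorem modeExp_neg_pi (τ j : ℤ) :
    modeExp (-τ) (-j) Real.pi = exp (I * ((Real.pi * τ : ℝ) : ℂ)) := by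
  rw [modeExp, show -(I * (2 * ((-j : ℤ) : ℂ) + ((-τ : ℤ) : ℂ)) * (Real.pi : ℂ)) =
    I * ((Real.pi * τ : ℝ) : ℂ) + (j : ℂ) * (2 * Real.pi * I) by push_cast; ring, exp_add,
    exp_int_mul_two_pi_mul_I, mul_one]

theorem synth_pi {τ : ℤ} (b : ℤ → ℂ) :
    synth τ b Real.pi = exp (I * ((Real.pi * τ : ℝ) : ℂ)) * synth τ b 0 := by
  simp only [synth, modeExp_neg_pi, modeExp_zero, mul_one]
  rw [tsum_mul_right, mul_comm]

/-- The weight $1+j^2$ makes the series and its first two termwise derivatives converge uniformly.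
The factor $\pi^{-1}$ in `b` compensates for `coeff` being unnormalised. -/
theorem exists_isH2_of_summable {τ : ℤ} (hτ : τ = 0 ∨ τ = 1) {c : ℤ → ℂ}
    (hc : Summable fun j : ℤ => (1 + (j : ℝ) ^ 2) * ‖c j‖) :
    ∃ y y₁ g : ℝ → ℂ, IsH2 y y₁ g ∧
      (y 0, y₁ 0, y Real.pi, y₁ Real.pi) ∈ quasiPeriodic (Real.pi * τ) ∧ coeff τ y = c := by
  have hnf : ∀ j : ℤ, ‖I * (2 * (j : ℂ) + τ)‖ = |((2 * j + τ : ℤ) : ℝ)| := fun j => by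
    rw [norm_mul, norm_I, one_mul, ← Complex.norm_intCast]; push_cast; rfl
  have hpi : (Real.pi : ℂ) ≠ 0 := by exact_mod_cast Real.pi_ne_zero
  set b : ℤ → ℂ := fun j => (Real.pi : ℂ)⁻¹ * c j with hbdef
  have hb : Summable fun j : ℤ => (1 + (j : ℝ) ^ 2) * ‖b j‖ := by
    refine (hc.mul_left ‖(Real.pi : ℂ)⁻¹‖).congr fun j => ?_
    rw [hbdef, norm_mul]; ring
  have hb0 : Summable fun j => ‖b j‖ := by
    refine Summable.of_nonneg_of_le (fun j => norm_nonneg _) (fun j => ?_) hb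
    nlinarith [norm_nonneg (b j), mul_nonneg (sq_nonneg (j : ℝ)) (norm_nonneg (b j))]
  have hb1 : Summable fun j : ℤ => ‖I * (2 * j + τ) * b j‖ := by
    refine Summable.of_nonneg_of_le (fun j => norm_nonneg _) (fun j => ?_) (hb.mul_left 10)
    rw [norm_mul, hnf, ← mul_assoc]
    refine mul_le_mul_of_nonneg_right ?_ (norm_nonneg _)
    have h1 := freq_sq_le hτ j
    nlinarith [sq_abs ((2 * j + τ : ℤ) : ℝ), sq_nonneg (|((2 * j + τ : ℤ) : ℝ)| - 1),
      sq_nonneg (j : ℝ)]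
  have hb2 : Summable fun j : ℤ => ‖I * (2 * j + τ) * (I * (2 * j + τ) * b j)‖ := by
    refine Summable.of_nonneg_of_le (fun j => norm_nonneg _) (fun j => ?_) (hb.mul_left 9)
    rw [norm_mul (I * (2 * (j : ℂ) + τ)), norm_mul (I * (2 * (j : ℂ) + τ)), hnf, ← mul_assoc,
      ← mul_assoc]
    refine mul_le_mul_of_nonneg_right ?_ (norm_nonneg _)
    rw [← pow_two, sq_abs]
    exact freq_sq_le hτ j
  set b₁ : ℤ → ℂ := fun j => I * (2 * j + τ) * b j with hb₁
  set b₂ : ℤ → ℂ := fun j => I * (2 * j + τ) * b₁ j with hb₂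
  have hd0 := hasDerivAt_synth hb0 hb1
  have hd1 := hasDerivAt_synth hb1 hb2
  have hc1 : Continuous (synth τ b₁) := continuous_synth hb1
  have hc2 : Continuous (synth τ b₂) := continuous_synth hb2
  refine ⟨synth τ b, synth τ b₁, synth τ b₂, ⟨?_, fun x _ => ?_, fun x _ => ?_⟩,
    ⟨synth_pi b, synth_pi b₁⟩, ?_⟩
  · have hcpt : IsCompact (Set.Icc (0 : ℝ) Real.pi) := isCompact_Icc
    obtain ⟨M, hM⟩ := hcpt.exists_bound_of_continuousOn hc2.continuousOn
    refine MemLp.of_bound hc2.aestronglyMeasurable M ?_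
    exact (ae_restrict_iff' measurableSet_Icc).2 (Filter.Eventually.of_forall hM)
  · rw [intervalIntegral.integral_eq_sub_of_hasDerivAt (fun x _ => hd1 x)
      (hc2.intervalIntegrable _ _)]
    ring
  · rw [intervalIntegral.integral_eq_sub_of_hasDerivAt (fun x _ => hd0 x)
      (hc1.intervalIntegrable _ _)]
    ring
  · funext j
    rw [coeff_synth hb0, hbdef]
    simp only
    rw [mul_inv_cancel_left₀ hpi]

theorem memLp_of_continuousOn {y : ℝ → ℂ} (hy : ContinuousOn y (Set.Icc 0 Real.pi)) :
    MemLp y 2 (volume.restrict (Set.Icc (0 : ℝ) Real.pi)) := by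
  obtain ⟨M, hM⟩ := isCompact_Icc.exists_bound_of_continuousOn hy
  exact MemLp.of_bound (hy.aestronglyMeasurable measurableSet_Icc) M
    ((ae_restrict_iff' measurableSet_Icc).2 (Filter.Eventually.of_forall hM))

theorem mem_domain_iff {q : C(ℝ, ℂ)} {B : BoundaryCondition} {f h : L2} :
    (f, h) ∈ hillGraph q B ↔ ∃ hf : f ∈ (hillOperator q B).domain, hillOperator q B ⟨f, hf⟩ = h := by
  rw [← hillOperator_graph, LinearPMap.mem_graph_iff]
  constructor
  · rintro ⟨y, rfl, rfl⟩
    exact ⟨y.2, rfl⟩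
  · rintro ⟨hf, rfl⟩
    exact ⟨⟨f, hf⟩, rfl, rfl⟩

/-- Periodic (`τ = 0`) or antiperiodic (`τ = 1`) operator. -/
abbrev Hτ (τ : ℤ) (a : ℂ) : L2 →ₗ.[ℂ] L2 := H (Real.pi * τ) a

theorem coeffL_Hτ {τ : ℤ} {a : ℂ} (f : (Hτ τ a).domain) :
    coeffL τ (Hτ τ a f) = mathieuSeq τ a (coeffL τ f) :=
  coeffL_hill (p := (f, Hτ τ a f)) (mem_domain_iff.2 ⟨f.2, rfl⟩)

theorem exists_mem_domain {τ : ℤ} (hτ : τ = 0 ∨ τ = 1) (a : ℂ) {c : ℤ → ℂ}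
    (hc : Summable fun j : ℤ => (1 + (j : ℝ) ^ 2) * ‖c j‖) :
    ∃ f : L2, f ∈ (Hτ τ a).domain ∧ coeffL τ f = c := by
  obtain ⟨y, y₁, g, h, hB, hcy⟩ := exists_isH2_of_summable hτ hc
  have hy := memLp_of_continuousOn h.continuousOn
  have hgq : MemLp (fun x => -g x + mathieuPotential a x * y x) 2
      (volume.restrict (Set.Icc (0 : ℝ) Real.pi)) := by
    refine h.memLp.neg.add (memLp_of_continuousOn ?_)
    exact (mathieuPotential a).continuous.continuousOn.mul h.continuousOn
  refine ⟨hy.toLp, ?_, ?_⟩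
  · exact (mem_domain_iff.1 (show (hy.toLp, hgq.toLp) ∈ hillGraph (mathieuPotential a) _ from
      ⟨y, y₁, g, h, hB, hy.coeFn_toLp, hgq.coeFn_toLp⟩)).1
  · rw [coeffL_apply, coeff_congr_ae hy.coeFn_toLp, hcy]

/-! ### Classical solutions -/

/-- `y` solves `-y'' + q y = z y` on `[0, π]`, and `y' = y₁`. -/
structure IsSol (q : C(ℝ, ℂ)) (z : ℂ) (y y₁ : ℝ → ℂ) : Prop where
  deriv_fun : ∀ x ∈ Set.Icc 0 Real.pi, HasDerivWithinAt y (y₁ x) (Set.Icc 0 Real.pi) x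
  deriv_deriv : ∀ x ∈ Set.Icc 0 Real.pi,
    HasDerivWithinAt y₁ ((q x - z) * y x) (Set.Icc 0 Real.pi) x

theorem exists_isSol_of_eigenvector {q : C(ℝ, ℂ)} {B : BoundaryCondition} {z : ℂ} {f : L2}
    (hf : (f, z • f) ∈ hillGraph q B) :
    ∃ y y₁, IsSol q z y y₁ ∧ (y 0, y₁ 0, y Real.pi, y₁ Real.pi) ∈ B ∧
      f =ᵐ[volume.restrict (Set.Icc (0 : ℝ) Real.pi)] y := by
  obtain ⟨y, y₁, g, h, hB, e₁, e₂⟩ := hf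
  refine ⟨y, y₁, ⟨fun x hx => h.hasDerivWithinAt hx, fun x hx => ?_⟩, hB, e₁⟩
  have hg : g =ᵐ[volume.restrict (Set.Icc (0 : ℝ) Real.pi)] fun x => (q x - z) * y x := by
    filter_upwards [e₁, e₂, Lp.coeFn_smul z f] with x h1 h2 h3
    rw [h3, Pi.smul_apply, h1, smul_eq_mul] at h2
    linear_combination h2
  have hc : ContinuousOn (fun x => (q x - z) * y x) (Set.Icc 0 Real.pi) :=
    (q.continuous.continuousOn.sub continuousOn_const).mul h.continuousOn
  have hy₁ : ∀ x ∈ Set.Icc 0 Real.pi, y₁ x = y₁ 0 + ∫ s in (0 : ℝ)..x, (q s - z) * y s := by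
    intro x hx
    rw [h.deriv_eq x hx]
    congr 1
    refine intervalIntegral.integral_congr_ae_restrict ?_
    rw [Set.uIoc_of_le hx.1, restrict_Ioc_eq_restrict_Icc]
    exact ae_restrict_of_ae_restrict_of_subset (Set.Icc_subset_Icc_right hx.2) hg
  have hi : IntervalIntegrable (fun x => (q x - z) * y x) volume 0 x :=
    (hc.mono (Set.Icc_subset_Icc_right hx.2)).intervalIntegrable_of_Icc hx.1
  have : Fact (x ∈ Set.Icc 0 Real.pi) := ⟨hx⟩
  have h1 := intervalIntegral.integral_hasDerivWithinAt_right hi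
    (s := Set.Icc 0 Real.pi) (t := Set.Icc 0 Real.pi)
    (hc.stronglyMeasurableAtFilter_nhdsWithin measurableSet_Icc x) (hc x hx)
  exact (h1.const_add (y₁ 0)).congr hy₁ (hy₁ x hx)

theorem IsSol.continuousOn {q : C(ℝ, ℂ)} {z : ℂ} {y y₁ : ℝ → ℂ} (h : IsSol q z y y₁) :
    ContinuousOn y (Set.Icc 0 Real.pi) := fun x hx => (h.deriv_fun x hx).continuousWithinAt

theorem IsSol.continuousOn_deriv {q : C(ℝ, ℂ)} {z : ℂ} {y y₁ : ℝ → ℂ} (h : IsSol q z y y₁) :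
    ContinuousOn y₁ (Set.Icc 0 Real.pi) := fun x hx => (h.deriv_deriv x hx).continuousWithinAt

theorem eq_add_integral_of_hasDerivWithinAt {u u' : ℝ → ℂ}
    (hu : ∀ x ∈ Set.Icc 0 Real.pi, HasDerivWithinAt u (u' x) (Set.Icc 0 Real.pi) x)
    (hc : ContinuousOn u' (Set.Icc 0 Real.pi)) :
    ∀ x ∈ Set.Icc 0 Real.pi, u x = u 0 + ∫ s in (0 : ℝ)..x, u' s := by
  intro x hx
  have hss := Set.Icc_subset_Icc_right (b := (0 : ℝ)) hx.2
  rw [intervalIntegral.integral_eq_sub_of_hasDerivAt_of_le hx.1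
    (fun s hs => ((hu s (hss hs)).continuousWithinAt).mono hss)
    (fun s hs => (hu s (hss (Set.Ioo_subset_Icc_self hs))).hasDerivAt
      (Icc_mem_nhds hs.1 (hs.2.trans_le hx.2)))
    ((hc.mono hss).intervalIntegrable_of_Icc hx.1)]
  ring

theorem IsSol.isH2 {q : C(ℝ, ℂ)} {z : ℂ} {y y₁ : ℝ → ℂ} (h : IsSol q z y y₁) :
    IsH2 y y₁ (fun x => (q x - z) * y x) := by
  have hc : ContinuousOn (fun x => (q x - z) * y x) (Set.Icc 0 Real.pi) :=
    (q.continuous.continuousOn.sub continuousOn_const).mul h.continuousOn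
  exact ⟨memLp_of_continuousOn hc, eq_add_integral_of_hasDerivWithinAt h.deriv_deriv hc,
    eq_add_integral_of_hasDerivWithinAt h.deriv_fun h.continuousOn_deriv⟩

theorem isEigenvalue_iff_exists_isSol {q : C(ℝ, ℂ)} {B : BoundaryCondition} {z : ℂ} :
    IsEigenvalue (hillOperator q B) z ↔ ∃ y y₁, IsSol q z y y₁ ∧
      (y 0, y₁ 0, y Real.pi, y₁ Real.pi) ∈ B ∧ ∃ x ∈ Set.Icc 0 Real.pi, y x ≠ 0 := by
  constructor
  · rintro ⟨f, hf0, hf⟩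
    obtain ⟨y, y₁, hs, hB, he⟩ := exists_isSol_of_eigenvector (mem_domain_iff.2 ⟨f.2, hf⟩)
    refine ⟨y, y₁, hs, hB, ?_⟩
    by_contra! hcon
    refine hf0 (Subtype.ext ((Lp.eq_zero_iff_ae_eq_zero).2 ?_))
    filter_upwards [he, ae_restrict_mem measurableSet_Icc] with x h1 h2
    rw [h1, hcon x h2]; rfl
  · rintro ⟨y, y₁, hs, hB, x, hx, hyx⟩
    have hy := memLp_of_continuousOn hs.continuousOn
    have hm : (hy.toLp, z • hy.toLp) ∈ hillGraph q B := by
      refine ⟨y, y₁, _, hs.isH2, hB, hy.coeFn_toLp, ?_⟩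
      filter_upwards [Lp.coeFn_smul z hy.toLp, hy.coeFn_toLp] with x h1 h2
      rw [h1, Pi.smul_apply, h2, smul_eq_mul]; ring
    obtain ⟨hd, hA⟩ := mem_domain_iff.1 hm
    refine ⟨⟨_, hd⟩, fun h0 => hyx ?_, hA⟩
    have h1 : hy.toLp = 0 := congrArg Subtype.val h0
    have h2 : y =ᵐ[volume.restrict (Set.Icc (0 : ℝ) Real.pi)] fun _ => 0 := by
      have := hy.coeFn_toLp
      rw [h1] at this
      exact this.symm.trans (Lp.coeFn_zero _ _ _)
    exact Measure.eqOn_Icc_of_ae_eq volume Real.pi_pos.ne h2 hs.continuousOn continuousOn_const hx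

theorem IsSol.eq_zero {q : C(ℝ, ℂ)} {z : ℂ} {y y₁ : ℝ → ℂ} (h : IsSol q z y y₁) (h0 : y 0 = 0)
    (h1 : y₁ 0 = 0) : ∀ x ∈ Set.Icc 0 Real.pi, y x = 0 := by
  have hc : ContinuousOn (fun x => q x - z) (Set.Icc 0 Real.pi) :=
    q.continuous.continuousOn.sub continuousOn_const
  obtain ⟨M, hM⟩ := isCompact_Icc.exists_bound_of_continuousOn hc
  have hM0 : 0 ≤ M := (norm_nonneg _).trans (hM 0 ⟨le_rfl, Real.pi_pos.le⟩)
  set v : ℝ → ℂ × ℂ → ℂ × ℂ := fun t p => (p.2, (q t - z) * p.1) with hv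
  set K : NNReal := ⟨1 + M, by positivity⟩ with hK
  have hlip : ∀ t ∈ Set.Ico 0 Real.pi, LipschitzOnWith K (v t) Set.univ := by
    intro t ht
    refine LipschitzWith.lipschitzOnWith (LipschitzWith.of_dist_le_mul fun p p' => ?_)
    have hKr : (K : ℝ) = 1 + M := rfl
    have e1 : dist p.1 p'.1 ≤ dist p p' := le_max_left _ _
    have e2 : dist p.2 p'.2 ≤ dist p p' := le_max_right _ _
    rw [hKr]
    refine max_le ?_ ?_
    · nlinarith [dist_nonneg (x := p) (y := p')]
    · rw [dist_eq_norm, ← mul_sub, norm_mul, ← dist_eq_norm p.1]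
      have := mul_le_mul (hM t (Set.Ico_subset_Icc_self ht)) e1 dist_nonneg hM0
      nlinarith [dist_nonneg (x := p) (y := p')]
  have hmem : ∀ t ∈ Set.Ico 0 Real.pi, Set.Icc 0 Real.pi ∈ nhdsWithin t (Set.Ici t) := by
    intro t ht
    exact Filter.mem_of_superset (Icc_mem_nhdsGE ht.2) (Set.Icc_subset_Icc_left ht.1)
  have := ODE_solution_unique_of_mem_Icc_right (f := fun t => (y t, y₁ t)) (g := fun _ => (0, 0))
    (a := 0) (b := Real.pi) (s := fun _ => Set.univ) hlip
    (h.continuousOn.prodMk h.continuousOn_deriv)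
    (fun t ht => by
      have hm := hmem t ht
      exact ((h.deriv_fun t (Set.Ico_subset_Icc_self ht)).mono_of_mem_nhdsWithin hm).prodMk
        ((h.deriv_deriv t (Set.Ico_subset_Icc_self ht)).mono_of_mem_nhdsWithin hm))
    (fun _ _ => Set.mem_univ _) continuousOn_const
    (fun t _ => by
      have : v t (0, 0) = 0 := by simp [hv]
      rw [this]; exact hasDerivWithinAt_const _ _ _)
    (fun _ _ => Set.mem_univ _) (by simp [h0, h1])
  exact fun x hx => congrArg Prod.fst (this hx)

theorem IsSol.wronskian {q : C(ℝ, ℂ)} {z : ℂ} {y y₁ w w₁ : ℝ → ℂ} (h : IsSol q z y y₁)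
    (h' : IsSol q z w w₁) :
    y Real.pi * w₁ Real.pi - y₁ Real.pi * w Real.pi = y 0 * w₁ 0 - y₁ 0 * w 0 := by
  have := eq_add_integral_of_hasDerivWithinAt (u := fun x => y x * w₁ x - y₁ x * w x)
    (u' := fun _ => 0) (fun x hx => by
      have := ((h.deriv_fun x hx).mul (h'.deriv_deriv x hx)).sub
        ((h.deriv_deriv x hx).mul (h'.deriv_fun x hx))
      convert! this using 1
      ring) continuousOn_const Real.pi ⟨Real.pi_pos.le, le_rfl⟩
  simpa using this

/-- `z` is an eigenvalue of the sequence operator with a bounded eigenvector of parity `ε`. -/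
def HasMode (τ : ℤ) (ε a z : ℂ) : Prop :=
  ∃ v : ℤ → ℂ, v ≠ 0 ∧ (∃ C, ∀ j, ‖v j‖ ≤ C) ∧ IsSym τ ε v ∧ mathieuSeq τ a v = z • v

theorem HasMode.not_both {τ : ℤ} (hτ : τ = 0 ∨ τ = 1) {a z : ℂ} (ha : a ≠ 0)
    (h : HasMode τ 1 a z) (h' : HasMode τ (-1) a z) : False := by
  obtain ⟨v, hv, ⟨C, hC⟩, hs, hL⟩ := h
  obtain ⟨w, hw, ⟨C', hC'⟩, hs', hL'⟩ := h'
  rcases no_coexistence hτ ha hC hC' hs hs' hL hL' with h | h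
  exacts [hv h, hw h]

/-- Decay bootstraps for two sequences whose span is invariant, without either being an eigenvector;
the pair `f₀`, `f₁` needs this generality. -/
theorem summable_of_finite_system {τ : ℤ} (hτ : τ = 0 ∨ τ = 1) {a : ℂ} {v w : ℤ → ℂ}
    {C C' : ℝ} {α β γ δ : ℂ} (hv : ∀ j, ‖v j‖ ≤ C) (hw : ∀ j, ‖w j‖ ≤ C')
    (hLv : mathieuSeq τ a v = α • v + β • w) (hLw : mathieuSeq τ a w = γ • v + δ • w) :
    (Summable fun j : ℤ => (1 + (j : ℝ) ^ 2) * ‖v j‖) ∧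
      Summable fun j : ℤ => (1 + (j : ℝ) ^ 2) * ‖w j‖ := by
  have hcomb : ∀ (s t : ℂ) (j : ℤ), ‖(s • v + t • w) j‖ ≤ ‖s‖ * ‖v j‖ + ‖t‖ * ‖w j‖ := by
    intro s t j
    refine (norm_add_le _ _).trans (le_of_eq ?_)
    simp only [Pi.smul_apply, smul_eq_mul, norm_mul]
  have bound : ∀ (s t : ℂ) (j : ℤ), ‖(s • v + t • w) j‖ ≤ ‖s‖ * C + ‖t‖ * C' := fun s t j =>
    (hcomb s t j).trans (add_le_add (mul_le_mul_of_nonneg_left (hv j) (norm_nonneg _))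
      (mul_le_mul_of_nonneg_left (hw j) (norm_nonneg _)))
  have dv := decay_of_bounded hτ (a := a) hv (fun j => by rw [hLv]; exact bound α β j)
  have dw := decay_of_bounded hτ (a := a) hw (fun j => by rw [hLw]; exact bound γ δ j)
  have bound2 : ∀ (s t : ℂ) (j : ℤ), (1 + (j : ℝ) ^ 2) * ‖(s • v + t • w) j‖ ≤
      ‖s‖ * (C + (‖α‖ * C + ‖β‖ * C' + ‖a‖ * (C + C)))
        + ‖t‖ * (C' + (‖γ‖ * C + ‖δ‖ * C' + ‖a‖ * (C' + C'))) := fun s t j => by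
    have h1 := mul_le_mul_of_nonneg_left (hcomb s t j) (show 0 ≤ 1 + (j : ℝ) ^ 2 by positivity)
    have h2 := mul_le_mul_of_nonneg_left (dv j) (norm_nonneg s)
    have h3 := mul_le_mul_of_nonneg_left (dw j) (norm_nonneg t)
    linarith
  exact ⟨summable_of_decay_sq (decay_sq_of_decay hτ (a := a) dv
      fun j => by rw [hLv]; exact bound2 α β j),
    summable_of_decay_sq (decay_sq_of_decay hτ (a := a) dw
      fun j => by rw [hLw]; exact bound2 γ δ j)⟩

theorem summable_of_eigen {τ : ℤ} (hτ : τ = 0 ∨ τ = 1) {a z : ℂ} {v : ℤ → ℂ} {C : ℝ}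
    (hv : ∀ j, ‖v j‖ ≤ C) (hL : mathieuSeq τ a v = z • v) :
    Summable fun j : ℤ => (1 + (j : ℝ) ^ 2) * ‖v j‖ :=
  (summable_of_finite_system hτ hv hv (α := z) (β := 0) (γ := z) (δ := 0)
    (by simpa using hL) (by simpa using hL)).1

/-! ### The reflection $x\mapsto\pi-x$ and the parity of eigenfunctions -/

theorem exp_pi_mul_self (τ : ℤ) :
    exp (I * ((Real.pi * τ : ℝ) : ℂ)) * exp (I * ((Real.pi * τ : ℝ) : ℂ)) = 1 := by
  rw [← exp_add, show I * ((Real.pi * τ : ℝ) : ℂ) + I * ((Real.pi * τ : ℝ) : ℂ)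
    = (τ : ℂ) * (2 * Real.pi * I) by push_cast; ring]
  exact exp_int_mul_two_pi_mul_I τ

theorem coeff_comp_pi_sub {τ : ℤ} (y : ℝ → ℂ) :
    coeff τ (fun x => y (Real.pi - x)) =
      exp (I * ((Real.pi * τ : ℝ) : ℂ)) • reflect τ (coeff τ y) := by
  funext j
  have h1 := intervalIntegral.integral_comp_sub_left (a := 0) (b := Real.pi)
    (fun u => y u * modeExp τ j (Real.pi - u)) Real.pi
  simp only [sub_sub_cancel, sub_self, sub_zero] at h1
  simp only [coeff, reflect, Pi.smul_apply, smul_eq_mul]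
  rw [h1, ← intervalIntegral.integral_const_mul]
  congr 1
  funext u
  have h2 : modeExp τ j (Real.pi - u)
      = exp (I * ((Real.pi * τ : ℝ) : ℂ)) * modeExp τ (-j - τ) u := by
    have e := exp_int_mul_two_pi_mul_I (-j - τ)
    simp only [modeExp]
    rw [← mul_one (exp _ * exp _), ← e, ← exp_add, ← exp_add]
    congr 1
    push_cast
    ring
  rw [h2]; ring

theorem eqOn_of_coeff_eq {τ : ℤ} {y w : ℝ → ℂ} (hy : ContinuousOn y (Set.Icc 0 Real.pi))
    (hw : ContinuousOn w (Set.Icc 0 Real.pi)) (h : coeff τ y = coeff τ w) :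
    Set.EqOn y w (Set.Icc 0 Real.pi) := by
  have hsub : coeff τ (y + (-1 : ℂ) • w) = 0 := by
    rw [coeff_add (hy.intervalIntegrable_of_Icc Real.pi_pos.le)
      (show IntervalIntegrable ((-1 : ℂ) • w) volume 0 Real.pi from
        (hw.intervalIntegrable_of_Icc Real.pi_pos.le).const_mul _), coeff_smul, h]
    simp
  have hc : ContinuousOn (y + (-1 : ℂ) • w) (Set.Icc 0 Real.pi) := hy.add (hw.const_smul _)
  have h0 := ae_eq_zero_of_coeff_eq_zero (memLp_of_continuousOn hc) hsub
  have := Measure.eqOn_Icc_of_ae_eq volume Real.pi_pos.ne h0 hc continuousOn_const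
  intro x hx
  have h2 := this hx
  simp only [Pi.add_apply, Pi.smul_apply, smul_eq_mul, Pi.zero_apply] at h2
  linear_combination h2

theorem continuousOn_comp_pi_sub {y : ℝ → ℂ} (hy : ContinuousOn y (Set.Icc 0 Real.pi)) :
    ContinuousOn (fun x => y (Real.pi - x)) (Set.Icc 0 Real.pi) :=
  hy.comp (by fun_prop) fun x hx => ⟨by linarith [hx.2], by linarith [hx.1]⟩

section Reflection

variable {τ : ℤ} {a z : ℂ} {y y₁ : ℝ → ℂ}

/-- Oddness of the coefficients means $y(\pi-x)=-Ey(x)$ with $E^2=1$. At $x=\pi$, with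
$y(\pi)=Ey(0)$, this reads $y(0)=-y(0)$. The even case uses the derivative of the analogous
identity. -/
theorem IsSol.eq_zero_of_odd (h : IsSol (mathieuPotential a) z y y₁)
    (hB : (y 0, y₁ 0, y Real.pi, y₁ Real.pi) ∈ quasiPeriodic (Real.pi * τ))
    (hs : IsSym τ (-1) (coeff τ y)) : y 0 = 0 := by
  have hr : reflect τ (coeff τ y) = (-1 : ℂ) • coeff τ y := funext hs
  have h1 : Set.EqOn (fun x => y (Real.pi - x))
      ((exp (I * ((Real.pi * τ : ℝ) : ℂ)) * -1) • y) (Set.Icc 0 Real.pi) := by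
    refine eqOn_of_coeff_eq (τ := τ) (continuousOn_comp_pi_sub h.continuousOn)
      (h.continuousOn.const_smul _) ?_
    rw [coeff_comp_pi_sub, hr, coeff_smul, smul_smul]
  have h2 := h1 (x := Real.pi) ⟨Real.pi_pos.le, le_rfl⟩
  have hB1 : y Real.pi = exp (I * ((Real.pi * τ : ℝ) : ℂ)) * y 0 := hB.1
  simp only [sub_self, Pi.smul_apply, smul_eq_mul, hB1] at h2
  linear_combination h2 / 2 - y 0 / 2 * exp_pi_mul_self τ

theorem IsSol.deriv_eq_zero_of_even (h : IsSol (mathieuPotential a) z y y₁)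
    (hB : (y 0, y₁ 0, y Real.pi, y₁ Real.pi) ∈ quasiPeriodic (Real.pi * τ))
    (hs : IsSym τ 1 (coeff τ y)) : y₁ 0 = 0 := by
  have hr : reflect τ (coeff τ y) = (1 : ℂ) • coeff τ y := funext hs
  have h1 : Set.EqOn (fun x => y (Real.pi - x))
      ((exp (I * ((Real.pi * τ : ℝ) : ℂ))) • y) (Set.Icc 0 Real.pi) := by
    refine eqOn_of_coeff_eq (τ := τ) (continuousOn_comp_pi_sub h.continuousOn)
      (h.continuousOn.const_smul _) ?_
    rw [coeff_comp_pi_sub, hr, one_smul, coeff_smul]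
  have hπ : Real.pi ∈ Set.Icc 0 Real.pi := ⟨Real.pi_pos.le, le_rfl⟩
  have d1 : HasDerivWithinAt (fun x => y (Real.pi - x)) (-y₁ 0) (Set.Icc 0 Real.pi) Real.pi := by
    have h0 : HasDerivWithinAt y (y₁ 0) (Set.Icc 0 Real.pi) (Real.pi - Real.pi) := by
      rw [sub_self]; exact h.deriv_fun 0 ⟨le_rfl, Real.pi_pos.le⟩
    have hsub : HasDerivWithinAt (fun x : ℝ => Real.pi - x) (-1) (Set.Icc 0 Real.pi) Real.pi :=
      ((hasDerivAt_id Real.pi).const_sub Real.pi).hasDerivWithinAt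
    have := HasDerivWithinAt.scomp (t' := Set.Icc 0 Real.pi) Real.pi h0 hsub
      (fun x hx => ⟨by linarith [hx.2], by linarith [hx.1]⟩)
    simpa using! this
  have d2 : HasDerivWithinAt ((exp (I * ((Real.pi * τ : ℝ) : ℂ))) • y)
      ((exp (I * ((Real.pi * τ : ℝ) : ℂ))) • y₁ Real.pi) (Set.Icc 0 Real.pi) Real.pi :=
    (h.deriv_fun _ hπ).const_smul _
  have h2 := (uniqueDiffOn_Icc Real.pi_pos _ hπ).eq_deriv _ d1 (d2.congr h1 (h1 hπ))
  have hB2 : y₁ Real.pi = exp (I * ((Real.pi * τ : ℝ) : ℂ)) * y₁ 0 := hB.2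
  simp only [smul_eq_mul, hB2] at h2
  linear_combination -h2 / 2 - y₁ 0 / 2 * exp_pi_mul_self τ

theorem coeff_isSol (h : IsSol (mathieuPotential a) z y y₁)
    (hB : (y 0, y₁ 0, y Real.pi, y₁ Real.pi) ∈ quasiPeriodic (Real.pi * τ)) :
    mathieuSeq τ a (coeff τ y) = z • coeff τ y := by
  have hy := memLp_of_continuousOn h.continuousOn
  have hm : (hy.toLp, z • hy.toLp) ∈
      hillGraph (mathieuPotential a) (quasiPeriodic (Real.pi * τ)) := by
    refine ⟨y, y₁, _, h.isH2, hB, hy.coeFn_toLp, ?_⟩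
    filter_upwards [Lp.coeFn_smul z hy.toLp, hy.coeFn_toLp] with x h1 h2
    rw [h1, Pi.smul_apply, h2, smul_eq_mul]; ring
  have := coeffL_hill hm
  simp only [map_smul] at this
  rw [coeffL_apply, coeff_congr_ae hy.coeFn_toLp] at this
  exact this.symm

theorem coeff_bounded (h : IsSol (mathieuPotential a) z y y₁) : ∃ C, ∀ j, ‖coeff τ y j‖ ≤ C := by
  have hy := memLp_of_continuousOn h.continuousOn
  have := coeffL_bounded τ hy.toLp
  rwa [coeffL_apply, coeff_congr_ae hy.coeFn_toLp] at this

theorem coeff_ne_zero (h : IsSol (mathieuPotential a) z y y₁) {x : ℝ}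
    (hx : x ∈ Set.Icc 0 Real.pi) (hyx : y x ≠ 0) : coeff τ y ≠ 0 := by
  intro h0
  have := ae_eq_zero_of_coeff_eq_zero (memLp_of_continuousOn h.continuousOn) h0
  exact hyx (Measure.eqOn_Icc_of_ae_eq volume Real.pi_pos.ne this h.continuousOn
    continuousOn_const hx)

/-- The even and odd parts of the coefficients solve the same eigenvalue equation, so
`no_coexistence` kills one of them. -/
theorem isSym_of_isSol (hτ : τ = 0 ∨ τ = 1) (ha : a ≠ 0) (h : IsSol (mathieuPotential a) z y y₁)
    (hB : (y 0, y₁ 0, y Real.pi, y₁ Real.pi) ∈ quasiPeriodic (Real.pi * τ)) :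
    IsSym τ 1 (coeff τ y) ∨ IsSym τ (-1) (coeff τ y) := by
  obtain ⟨C, hC⟩ := coeff_bounded (τ := τ) h
  set c := coeff τ y with hc
  have hL := coeff_isSol h hB
  rw [← hc] at hL
  have hLr : mathieuSeq τ a (reflect τ c) = z • reflect τ c := by
    rw [mathieuSeq_reflect, hL]; rfl
  have hrr : ∀ j, reflect τ c (-j - τ) = c j := fun j => by
    show c (-(-j - τ) - τ) = c j
    congr 1; ring
  have hrC : ∀ j, ‖reflect τ c j‖ ≤ C := fun j => hC _
  rcases no_coexistence hτ ha (e := c + reflect τ c) (o := c - reflect τ c) (z := z)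
    (fun j => norm_add_le_of_le_of_le (hC j) (hrC j))
    (fun j => (norm_sub_le _ _).trans (add_le_add (hC j) (hrC j)))
    (fun j => by
      rw [Pi.add_apply, Pi.add_apply, hrr]
      show reflect τ c j + c j = _
      ring)
    (fun j => by
      rw [Pi.sub_apply, Pi.sub_apply, hrr]
      show reflect τ c j - c j = _
      ring)
    (by rw [map_add, hL, hLr, smul_add]) (by rw [map_sub, hL, hLr, smul_sub]) with h0 | h0
  · right
    intro j
    have := congrFun h0 j
    simp only [Pi.add_apply, Pi.zero_apply] at this
    show reflect τ c j = _
    linear_combination this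
  · left
    intro j
    have := congrFun h0 j
    simp only [Pi.sub_apply, Pi.zero_apply] at this
    show reflect τ c j = _
    linear_combination -this

theorem exists_isSol_of_hasMode {ε : ℂ} (hτ : τ = 0 ∨ τ = 1) (h : HasMode τ ε a z) :
    ∃ y y₁, IsSol (mathieuPotential a) z y y₁ ∧
      (y 0, y₁ 0, y Real.pi, y₁ Real.pi) ∈ quasiPeriodic (Real.pi * τ) ∧
      IsSym τ ε (coeff τ y) ∧ ∃ x ∈ Set.Icc 0 Real.pi, y x ≠ 0 := by
  obtain ⟨v, hv, ⟨C, hC⟩, hs, hL⟩ := h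
  obtain ⟨f, hf, hfv⟩ := exists_mem_domain hτ a (summable_of_eigen hτ hC hL)
  have hA : Hτ τ a ⟨f, hf⟩ = z • f := by
    refine coeffL_injective τ ?_
    rw [coeffL_Hτ, map_smul, hfv, hL]
  obtain ⟨y, y₁, hsol, hB, he⟩ := exists_isSol_of_eigenvector (mem_domain_iff.2 ⟨hf, hA⟩)
  have hcy : coeff τ y = v := by rw [← coeff_congr_ae he, ← coeffL_apply, hfv]
  refine ⟨y, y₁, hsol, hB, hcy ▸ hs, ?_⟩
  by_contra! hcon
  refine hv ?_
  have : coeff τ y = coeff τ (0 : ℝ → ℂ) := coeff_congr_ae (by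
    filter_upwards [ae_restrict_mem measurableSet_Icc] with x hx using hcon x hx)
  rw [← hcy, this]
  funext j
  simp [coeff]

theorem hasMode_of_isSol {ε : ℂ} (h : IsSol (mathieuPotential a) z y y₁)
    (hB : (y 0, y₁ 0, y Real.pi, y₁ Real.pi) ∈ quasiPeriodic (Real.pi * τ))
    (hs : IsSym τ ε (coeff τ y)) {x : ℝ} (hx : x ∈ Set.Icc 0 Real.pi) (hyx : y x ≠ 0) :
    HasMode τ ε a z :=
  ⟨coeff τ y, coeff_ne_zero h hx hyx, coeff_bounded h, hs, coeff_isSol h hB⟩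

end Reflection

/-! ### Dirichlet and Neumann eigenvalues as odd and even modes -/

theorem isEigenvalue_Hτ_iff {τ : ℤ} (hτ : τ = 0 ∨ τ = 1) {a : ℂ} (ha : a ≠ 0) (z : ℂ) :
    IsEigenvalue (Hτ τ a) z ↔ HasMode τ 1 a z ∨ HasMode τ (-1) a z := by
  constructor
  · intro h
    obtain ⟨y, y₁, hs, hB, x, hx, hyx⟩ := isEigenvalue_iff_exists_isSol.1 h
    exact (isSym_of_isSol hτ ha hs hB).imp (hasMode_of_isSol hs hB · hx hyx)
      (hasMode_of_isSol hs hB · hx hyx)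
  · rintro (h | h) <;> obtain ⟨y, y₁, hs, hB, -, x⟩ := exists_isSol_of_hasMode hτ h <;>
      exact isEigenvalue_iff_exists_isSol.2 ⟨y, y₁, hs, hB, x⟩

/-- The two operators may a priori have different eigenfunctions `u` and `w` for `z`. If `u 0 = 0`,
then `u` cannot be even, since Cauchy uniqueness would make it zero. Otherwise constancy of the
Wronskian of `u` and `w` shows that `w` itself satisfies the quasi-periodic conditions, and the same
argument applies to `w`. -/
theorem dirichlet_iff_hasMode {τ : ℤ} (hτ : τ = 0 ∨ τ = 1) {a : ℂ} (ha : a ≠ 0) (z : ℂ) :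
    (IsEigenvalue (Hτ τ a) z ∧ IsEigenvalue (D a) z) ↔ HasMode τ (-1) a z := by
  have hE := exp_pi_mul_self τ
  constructor
  · rintro ⟨h, h'⟩
    obtain ⟨u, u₁, hu, hB, x, hx, hux⟩ := isEigenvalue_iff_exists_isSol.1 h
    obtain ⟨w, w₁, hw, hBw, x', hx', hwx⟩ := isEigenvalue_iff_exists_isSol.1 h'
    have hW := hu.wronskian hw
    have hB1 : u Real.pi = exp (I * ((Real.pi * τ : ℝ) : ℂ)) * u 0 := hB.1
    have hw0 : w 0 = 0 := hBw.1
    have hwπ : w Real.pi = 0 := hBw.2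
    have key : ∀ y y₁ : ℝ → ℂ, IsSol (mathieuPotential a) z y y₁ →
        (y 0, y₁ 0, y Real.pi, y₁ Real.pi) ∈ quasiPeriodic (Real.pi * τ) → y 0 = 0 →
        (∃ x ∈ Set.Icc 0 Real.pi, y x ≠ 0) → HasMode τ (-1) a z := by
      rintro y y₁ hy hBy hy0 ⟨x, hx, hyx⟩
      rcases isSym_of_isSol hτ ha hy hBy with hs | hs
      · exact absurd (hy.eq_zero hy0 (hy.deriv_eq_zero_of_even hBy hs) x hx) hyx
      · exact hasMode_of_isSol hy hBy hs hx hyx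
    by_cases hu0 : u 0 = 0
    · exact key u u₁ hu hB hu0 ⟨x, hx, hux⟩
    · refine key w w₁ hw ⟨?_, ?_⟩ hw0 ⟨x', hx', hwx⟩
      · show w Real.pi = _ * w 0
        rw [hw0, hwπ, mul_zero]
      · show w₁ Real.pi = exp (I * ((Real.pi * τ : ℝ) : ℂ)) * w₁ 0
        rw [hB1, hw0, hwπ] at hW
        refine mul_left_cancel₀ hu0 ?_
        linear_combination exp (I * ((Real.pi * τ : ℝ) : ℂ)) * hW - u 0 * w₁ Real.pi * hE
  · intro h
    refine ⟨(isEigenvalue_Hτ_iff hτ ha z).2 (Or.inr h), ?_⟩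
    obtain ⟨y, y₁, hs, hB, hsym, x⟩ := exists_isSol_of_hasMode hτ h
    have h0 := hs.eq_zero_of_odd hB hsym
    refine isEigenvalue_iff_exists_isSol.2 ⟨y, y₁, hs, ⟨h0, ?_⟩, x⟩
    have hB1 : y Real.pi = exp (I * ((Real.pi * τ : ℝ) : ℂ)) * y 0 := hB.1
    show y Real.pi = 0
    rw [hB1, h0, mul_zero]

theorem neumann_iff_hasMode {τ : ℤ} (hτ : τ = 0 ∨ τ = 1) {a : ℂ} (ha : a ≠ 0) (z : ℂ) :
    (IsEigenvalue (Hτ τ a) z ∧ IsEigenvalue (N a) z) ↔ HasMode τ 1 a z := by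
  have hE := exp_pi_mul_self τ
  constructor
  · rintro ⟨h, h'⟩
    obtain ⟨u, u₁, hu, hB, x, hx, hux⟩ := isEigenvalue_iff_exists_isSol.1 h
    obtain ⟨w, w₁, hw, hBw, x', hx', hwx⟩ := isEigenvalue_iff_exists_isSol.1 h'
    have hW := hu.wronskian hw
    have hB2 : u₁ Real.pi = exp (I * ((Real.pi * τ : ℝ) : ℂ)) * u₁ 0 := hB.2
    have hw0 : w₁ 0 = 0 := hBw.1
    have hwπ : w₁ Real.pi = 0 := hBw.2
    have key : ∀ y y₁ : ℝ → ℂ, IsSol (mathieuPotential a) z y y₁ →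
        (y 0, y₁ 0, y Real.pi, y₁ Real.pi) ∈ quasiPeriodic (Real.pi * τ) → y₁ 0 = 0 →
        (∃ x ∈ Set.Icc 0 Real.pi, y x ≠ 0) → HasMode τ 1 a z := by
      rintro y y₁ hy hBy hy0 ⟨x, hx, hyx⟩
      rcases isSym_of_isSol hτ ha hy hBy with hs | hs
      · exact hasMode_of_isSol hy hBy hs hx hyx
      · exact absurd (hy.eq_zero (hy.eq_zero_of_odd hBy hs) hy0 x hx) hyx
    by_cases hu0 : u₁ 0 = 0
    · exact key u u₁ hu hB hu0 ⟨x, hx, hux⟩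
    · refine key w w₁ hw ⟨?_, ?_⟩ hw0 ⟨x', hx', hwx⟩
      · show w Real.pi = exp (I * ((Real.pi * τ : ℝ) : ℂ)) * w 0
        rw [hB2, hw0, hwπ] at hW
        refine mul_left_cancel₀ hu0 ?_
        linear_combination -exp (I * ((Real.pi * τ : ℝ) : ℂ)) * hW - u₁ 0 * w Real.pi * hE
      · show w₁ Real.pi = _ * w₁ 0
        rw [hw0, hwπ, mul_zero]
  · intro h
    refine ⟨(isEigenvalue_Hτ_iff hτ ha z).2 (Or.inl h), ?_⟩
    obtain ⟨y, y₁, hs, hB, hsym, x⟩ := exists_isSol_of_hasMode hτ h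
    have h0 := hs.deriv_eq_zero_of_even hB hsym
    refine isEigenvalue_iff_exists_isSol.2 ⟨y, y₁, hs, ⟨h0, ?_⟩, x⟩
    have hB2 : y₁ Real.pi = exp (I * ((Real.pi * τ : ℝ) : ℂ)) * y₁ 0 := hB.2
    show y₁ Real.pi = 0
    rw [hB2, h0, mul_zero]

/-! ### Algebraic multiplicities -/

section Multiplicity

variable {E : Type*} [AddCommGroup E] [Module ℂ E] {A : E →ₗ.[ℂ] E} {z : ℂ}

theorem mem_kerPow_succ {k : ℕ} {x : E} :
    x ∈ kerPow A z (k + 1) ↔ ∃ f : A.domain, A f - z • (f : E) ∈ kerPow A z k ∧ (f : E) = x :=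
  Iff.rfl

/-- The criterion behind all multiplicity counts: a space `V` that absorbs preimages under `A - z`
contains the whole root subspace. -/
theorem kerPow_le {V : Submodule ℂ E}
    (hz : ∀ f : A.domain, A f - z • (f : E) ∈ V → (f : E) ∈ V) (k : ℕ) : kerPow A z k ≤ V := by
  induction k with
  | zero => exact bot_le
  | succ k ih =>
    rintro x ⟨f, hf, rfl⟩
    exact hz f (ih hf)

theorem multiplicity_eq_zero (h : ¬ IsEigenvalue A z) : multiplicity A z = 0 := by
  have hz : ∀ f : A.domain, A f - z • (f : E) ∈ (⊥ : Submodule ℂ E) → (f : E) ∈ (⊥ : Submodule ℂ E) := by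
    intro f hf
    by_contra hf0
    exact h ⟨f, fun h0 => hf0 (by simp [h0]), sub_eq_zero.1 ((Submodule.mem_bot ℂ).1 hf)⟩
  have : (⨆ k, kerPow A z k : Submodule ℂ E) = ⊥ := by
    rw [eq_bot_iff]
    exact iSup_le (kerPow_le hz)
  rw [multiplicity, this]
  simp

theorem multiplicity_ne_zero (h : IsEigenvalue A z) : multiplicity A z ≠ 0 := by
  obtain ⟨f, hf0, hf⟩ := h
  have hmem : (f : E) ∈ (⨆ k, kerPow A z k : Submodule ℂ E) := by
    refine (le_iSup (fun k => kerPow A z k) 1) ?_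
    exact mem_kerPow_succ.2 ⟨f, by rw [hf, sub_self]; exact Submodule.zero_mem _, rfl⟩
  intro h0
  rw [multiplicity, Cardinal.toENat_eq_zero, rank_zero_iff] at h0
  have h1 := congrArg Subtype.val (Subsingleton.elim
    (⟨f, hmem⟩ : (⨆ k, kerPow A z k : Submodule ℂ E)) 0)
  exact hf0 (Subtype.ext h1)

theorem multiplicity_eq_one {f : A.domain} (hf0 : f ≠ 0) (hf : A f = z • (f : E))
    (hz : ∀ g : A.domain, A g - z • (g : E) ∈ Submodule.span ℂ {(f : E)} →
      (g : E) ∈ Submodule.span ℂ {(f : E)}) : multiplicity A z = 1 := by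
  have : (⨆ k, kerPow A z k : Submodule ℂ E) = Submodule.span ℂ {(f : E)} := by
    refine le_antisymm (iSup_le (kerPow_le hz)) ?_
    refine le_trans ?_ (le_iSup (fun k => kerPow A z k) 1)
    rw [Submodule.span_singleton_le_iff_mem]
    exact mem_kerPow_succ.2 ⟨f, by rw [hf, sub_self]; exact Submodule.zero_mem _, rfl⟩
  have hne : (f : E) ≠ 0 := fun h => hf0 (Subtype.ext h)
  rw [multiplicity, this, ← Module.finrank_eq_rank, finrank_span_singleton hne]
  simp

/-- Since `V` is invariant and absorbs preimages, the root subspace of `A` is that of the matrix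
`φ`, whose dimension is the multiplicity of the characteristic root. -/
theorem multiplicity_eq_rootMultiplicity {V : Submodule ℂ E} [FiniteDimensional ℂ V]
    (φ : Module.End ℂ V) (hV : ∀ v : V, ∃ h : (v : E) ∈ A.domain, A ⟨v, h⟩ = φ v)
    (hz : ∀ f : A.domain, A f - z • (f : E) ∈ V → (f : E) ∈ V) :
    multiplicity A z = φ.charpoly.rootMultiplicity z := by
  have hk : ∀ (k : ℕ) (v : V), (v : E) ∈ kerPow A z k ↔ ((φ - z • 1) ^ k) v = 0 := by
    intro k
    induction k with
    | zero =>
      intro v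
      rw [pow_zero, Module.End.one_apply]
      exact (Submodule.mem_bot ℂ).trans (Submodule.coe_eq_zero)
    | succ k ih =>
      intro v
      rw [pow_succ, Module.End.mul_apply, ← ih, mem_kerPow_succ]
      obtain ⟨h, hA⟩ := hV v
      have e : ((φ - z • 1) v : V) = A ⟨v, h⟩ - z • (v : E) := by
        rw [hA]; simp
      rw [e]
      constructor
      · rintro ⟨f, hf, hfv⟩
        have : f = ⟨v, h⟩ := Subtype.ext hfv
        rw [this] at hf; exact hf
      · intro hf
        exact ⟨⟨v, h⟩, hf, rfl⟩
  have hsup : (⨆ k, kerPow A z k : Submodule ℂ E) = (φ.maxGenEigenspace z).map V.subtype := by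
    refine le_antisymm (iSup_le fun k x hx => ?_) ?_
    · have hxV := kerPow_le hz k hx
      exact ⟨⟨x, hxV⟩, (Module.End.mem_maxGenEigenspace _ _ _).2 ⟨k, (hk k ⟨x, hxV⟩).1 hx⟩, rfl⟩
    · rintro _ ⟨v, hv, rfl⟩
      obtain ⟨k, hv⟩ := (Module.End.mem_maxGenEigenspace _ _ _).1 hv
      exact (le_iSup (fun k => kerPow A z k) k) ((hk k v).2 hv)
  rw [multiplicity, hsup, ← (Submodule.equivMapOfInjective V.subtype
    V.injective_subtype (φ.maxGenEigenspace z)).rank_eq, ← Module.finrank_eq_rank,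
    LinearMap.finrank_maxGenEigenspace_eq]
  simp

theorem numEigenvalues_eq_sum {S : Set ℂ} (T : Finset ℂ) (hT : ∀ w ∈ T, w ∈ S)
    (h : ∀ w ∈ S, IsEigenvalue A w → w ∈ T) :
    numEigenvalues A S = ∑ w ∈ T, multiplicity A w := by
  refine le_antisymm (iSup₂_le fun s hs => ?_) ?_
  · have h1 : ∑ w ∈ s, multiplicity A w = ∑ w ∈ s ∩ T, multiplicity A w := by
      symm
      refine Finset.sum_subset Finset.inter_subset_left fun w hw hw' => ?_
      refine multiplicity_eq_zero fun hE => hw' ?_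
      exact Finset.mem_inter.2 ⟨hw, h w (hs hw) hE⟩
    rw [h1]
    exact Finset.sum_le_sum_of_subset Finset.inter_subset_right
  · exact le_iSup₂ (f := fun (s : Finset ℂ) (_ : (s : Set ℂ) ⊆ S) => ∑ w ∈ s, multiplicity A w)
      T hT

theorem exists_eigenvalue_pair {f₀ f₁ : E} (hli : LinearIndependent ℂ ![f₀, f₁])
    {α β γ δ : ℂ} (h₀ : f₀ ∈ A.domain) (h₁ : f₁ ∈ A.domain)
    (hA₀ : A ⟨f₀, h₀⟩ = α • f₀ + γ • f₁) (hA₁ : A ⟨f₁, h₁⟩ = β • f₀ + δ • f₁) :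
    ∃ l₁ l₂ : ℂ, l₁ + l₂ = α + δ ∧ l₁ * l₂ = α * δ - β * γ ∧
      ∀ z : ℂ, (∀ f : A.domain, A f - z • (f : E) ∈ Submodule.span ℂ {f₀, f₁} →
        (f : E) ∈ Submodule.span ℂ {f₀, f₁}) →
        multiplicity A z = Multiset.count z {l₁, l₂} := by
  classical
  -- A square root of the discriminant of the characteristic polynomial; `l₁ = l₂` is allowed, so
  -- the roots are counted as a multiset.
  obtain ⟨r, hr⟩ := IsAlgClosed.exists_pow_nat_eq ((α + δ) ^ 2 - 4 * (α * δ - β * γ))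
    (show 0 < 2 by norm_num)
  refine ⟨(α + δ + r) / 2, (α + δ - r) / 2, by ring, by linear_combination -hr / 4, ?_⟩
  set l₁ := (α + δ + r) / 2 with hl₁
  set l₂ := (α + δ - r) / 2 with hl₂
  have hrange : Set.range ![f₀, f₁] = {f₀, f₁} := by
    simp [Set.pair_comm]
  rw [← hrange]
  set b := Module.Basis.span hli with hb
  set Λ : Matrix (Fin 2) (Fin 2) ℂ := !![α, β; γ, δ] with hΛ
  set φ := Matrix.toLin b b Λ with hφ
  have : FiniteDimensional ℂ (Submodule.span ℂ (Set.range ![f₀, f₁])) := b.finiteDimensional_of_finite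
  have hb0 : (b 0 : E) = f₀ := by rw [hb, Module.Basis.span_apply]; rfl
  have hb1 : (b 1 : E) = f₁ := by rw [hb, Module.Basis.span_apply]; rfl
  have hφ0 : φ (b 0) = α • b 0 + γ • b 1 := by
    rw [hφ, Matrix.toLin_self, Fin.sum_univ_two]; simp [hΛ]
  have hφ1 : φ (b 1) = β • b 0 + δ • b 1 := by
    rw [hφ, Matrix.toLin_self, Fin.sum_univ_two]; simp [hΛ]
  have hV : ∀ v : Submodule.span ℂ (Set.range ![f₀, f₁]),
      ∃ h : (v : E) ∈ A.domain, A ⟨v, h⟩ = φ v := by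
    intro v
    have hv : v = b.repr v 0 • b 0 + b.repr v 1 • b 1 := by
      conv_lhs => rw [← b.sum_repr v, Fin.sum_univ_two]
    have hvE : (v : E) = b.repr v 0 • f₀ + b.repr v 1 • f₁ := by
      conv_lhs => rw [hv]
      simp [hb0, hb1]
    have hd : (v : E) ∈ A.domain := by
      rw [hvE]
      exact A.domain.add_mem (A.domain.smul_mem _ h₀) (A.domain.smul_mem _ h₁)
    refine ⟨hd, ?_⟩
    have hs : (⟨v, hd⟩ : A.domain) = b.repr v 0 • ⟨f₀, h₀⟩ + b.repr v 1 • ⟨f₁, h₁⟩ :=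
      Subtype.ext hvE
    rw [hs, LinearPMap.map_add, LinearPMap.map_smul, LinearPMap.map_smul, hA₀, hA₁]
    conv_rhs => rw [hv]
    rw [map_add, map_smul, map_smul, hφ0, hφ1]
    simp [hb0, hb1]
  have hchar : φ.charpoly = (Polynomial.X - Polynomial.C l₁) * (Polynomial.X - Polynomial.C l₂) := by
    rw [← LinearMap.charpoly_toMatrix φ b, hφ, LinearMap.toMatrix_toLin, Matrix.charpoly_fin_two]
    have e1 : Λ.trace = l₁ + l₂ := by
      rw [Matrix.trace_fin_two, hΛ, hl₁, hl₂]; simp; ring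
    have e2 : Λ.det = l₁ * l₂ := by
      rw [Matrix.det_fin_two, hΛ, hl₁, hl₂]; simp; linear_combination hr / 4
    rw [e1, e2, Polynomial.C_add, Polynomial.C_mul]
    ring
  intro z hz
  rw [multiplicity_eq_rootMultiplicity φ hV hz, hchar]
  have hne : (Polynomial.X - Polynomial.C l₁) * (Polynomial.X - Polynomial.C l₂) ≠ 0 :=
    mul_ne_zero (Polynomial.X_sub_C_ne_zero _) (Polynomial.X_sub_C_ne_zero _)
  rw [← Polynomial.count_roots, Polynomial.roots_mul hne, Polynomial.roots_X_sub_C,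
    Polynomial.roots_X_sub_C]
  rfl

end Multiplicity

/-! ### Spectral consequences of the sequence analysis -/

/-- The part of `c` of the opposite parity solves the homogeneous equation, hence vanishes.
Generalised eigenvectors therefore inherit the parity of the eigenvector. -/
theorem isSym_of_resolvent {τ : ℤ} {a z ε : ℂ} (hε : ε * ε = 1) {c w : ℤ → ℂ}
    (hcC : ∃ C, ∀ j, ‖c j‖ ≤ C) (hw : IsSym τ ε w) (h : mathieuSeq τ a c - z • c = w)
    (hz : ¬ HasMode τ (-ε) a z) : IsSym τ ε c := by
  obtain ⟨C, hC⟩ := hcC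
  set o : ℤ → ℂ := c - ε • reflect τ c with ho
  have hrr : ∀ j, reflect τ c (-j - τ) = c j := fun j => by
    show c (-(-j - τ) - τ) = c j
    congr 1; ring
  have hrw : reflect τ w = ε • w := funext hw
  have hr : mathieuSeq τ a (reflect τ c) - z • reflect τ c = ε • w := by
    rw [mathieuSeq_reflect, ← hrw, ← h]; rfl
  have hLo : mathieuSeq τ a o = z • o := by
    rw [ho, map_sub, map_smul]
    have e1 : mathieuSeq τ a c = w + z • c := by rw [← h]; simp
    have e2 : mathieuSeq τ a (reflect τ c) = ε • w + z • reflect τ c := by rw [← hr]; simp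
    rw [e1, e2]
    funext j
    simp only [Pi.sub_apply, Pi.add_apply, Pi.smul_apply, smul_eq_mul]
    linear_combination -(w j) * hε
  have ho0 : o = 0 := by
    by_contra hne
    refine hz ⟨o, hne, ⟨C + ‖ε‖ * C, fun j => ?_⟩, fun j => ?_, hLo⟩
    · exact (norm_sub_le _ _).trans (add_le_add (hC j) (norm_mul_le_of_le_of_le le_rfl (hC _)))
    · simp only [ho, Pi.sub_apply, Pi.smul_apply, smul_eq_mul, hrr]
      show reflect τ c j - ε * c j = -ε * (c j - ε * reflect τ c j)
      linear_combination -(reflect τ c j) * hε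
  intro j
  have h1 := congrFun ho0 j
  simp only [ho, Pi.sub_apply, Pi.smul_apply, smul_eq_mul, Pi.zero_apply] at h1
  show reflect τ c j = ε * c j
  linear_combination -ε * h1 - (reflect τ c j) * hε

/-- The witness is $(-1)^j\overline{v_j}$: conjugation changes $a$ into $-a$, and the alternating
sign, opposite at the two neighbours, changes it back. The reflection changes this sign by
$(-1)^\tau$. -/
theorem HasMode.conj {τ : ℤ} {ε a z : ℂ} (ha : conj a = -a) (hε : conj ε = ε)
    (h : HasMode τ ε a z) : HasMode τ ((-1) ^ τ * ε) a (conj z) := by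
  obtain ⟨v, hv, ⟨C, hC⟩, hs, hL⟩ := h
  have hone : (-1 : ℂ) ≠ 0 := by norm_num
  have hnorm : ∀ j : ℤ, ‖(-1 : ℂ) ^ j‖ = 1 := fun j => by rw [norm_zpow]; simp
  refine ⟨fun j => (-1) ^ j * conj (v j), fun h0 => hv ?_, ⟨C, fun j => ?_⟩, fun j => ?_, ?_⟩
  · funext j
    have := congrFun h0 j
    simp only [Pi.zero_apply, mul_eq_zero, map_eq_zero] at this
    exact this.resolve_left (zpow_ne_zero _ hone)
  · rw [norm_mul, hnorm, one_mul, RCLike.norm_conj]; exact hC j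
  · have e : (-1 : ℂ) ^ (-j - τ) = (-1) ^ j * (-1) ^ τ := by
      rw [← zpow_add₀ hone, show -j - τ = (j + τ) + 2 * (-(j + τ)) by ring, zpow_add₀ hone,
        zpow_mul]
      norm_num
    simp only
    rw [hs j, map_mul, hε, e]; ring
  · funext j
    have h1 := congrArg conj (congrFun hL j)
    have hd : conj (freqSq τ j) = freqSq τ j := by
      rw [freqSq, map_pow, map_intCast]
    simp only [mathieuSeq_apply, Pi.smul_apply, smul_eq_mul, map_add, map_mul, ha, hd] at h1
    simp only [mathieuSeq_apply, Pi.smul_apply, smul_eq_mul]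
    rw [zpow_sub_one₀ hone, zpow_add_one₀ hone]
    norm_num
    linear_combination (-1 : ℂ) ^ j * h1

theorem exists_simple_eigenvalue {τ : ℤ} (hτ : τ = 0 ∨ τ = 1) {a ε : ℂ} (ha : ‖a‖ < 2)
    (ha0 : a ≠ 0) (hε : ε = 1 ∨ ε = -1) {n : ℤ} {p : ℤ → ℂ} {P : Set ℤ}
    (hp0 : ∀ j ∉ P, p j = 0) (hpn : p n = 1) (hnP : n ∈ P) (hpsym : IsSym τ ε p)
    (hpb : ∃ C, ∀ j, ‖p j‖ ≤ C)
    (hP : ∀ j ∈ P, j = n ∨ j = -n - τ ∨ (ε = -1 ∧ -j - τ = j))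
    (hp1 : ∀ j ∉ P, ‖p (j - 1) + p (j + 1)‖ ≤ 1)
    (hgap : ∀ j ∉ P, 16 ≤ ‖freqSq τ j - freqSq τ n - a * (p (n - 1) + p (n + 1))‖ ∨
      (8 ≤ ‖freqSq τ j - freqSq τ n - a * (p (n - 1) + p (n + 1))‖ ∧ (j - 1 ∈ P ∨ j + 1 ∈ P)))
    {S : Set ℂ} (hS : ∀ z ∈ S, ∀ j ∉ P, 12 ≤ ‖freqSq τ j - z‖ ∨
      (4 ≤ ‖freqSq τ j - z‖ ∧ (j - 1 ∈ P ∨ j + 1 ∈ P))) :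
    ∃ l : ℂ, HasMode τ ε a l ∧ ‖l - freqSq τ n - a * (p (n - 1) + p (n + 1))‖ ≤ ‖a‖ ∧
      (∀ z ∈ S, HasMode τ ε a z → z = l) ∧ (l ∈ S → multiplicity (Hτ τ a) l = 1) := by
  have hε2 : ε * ε = 1 := by rcases hε with rfl | rfl <;> norm_num
  obtain ⟨l, v, hvs, hv, hl, hvP, hvp⟩ := exists_mode ha hε2 hp0 hpn hnP hpsym hP hp1 hgap
  obtain ⟨C, hC⟩ := hpb
  have hvC : ∀ j, ‖v j‖ ≤ max C (1 / 2) := fun j => by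
    by_cases hj : j ∈ P
    · rw [hvp j hj]; exact le_max_of_le_left (hC j)
    · exact le_max_of_le_right (hvP j hj)
  have hvn : v n = 1 := (hvp n hnP).trans hpn
  have hv0 : v ≠ 0 := fun h => by rw [h] at hvn; simp at hvn
  have hmode : HasMode τ ε a l := ⟨v, hv0, ⟨_, hvC⟩, hvs, hv⟩
  have hother : ¬ HasMode τ (-ε) a l := fun h => by
    rcases hε with rfl | rfl
    · exact HasMode.not_both hτ ha0 hmode h
    · rw [neg_neg] at h; exact HasMode.not_both hτ ha0 h hmode
  refine ⟨l, hmode, hl, fun z hz hm => ?_, fun hlS => ?_⟩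
  · obtain ⟨f, hf0, ⟨B, hB⟩, hfs, hfL⟩ := hm
    have h1 := eq_smul_mode ha hpn hnP hP hvs hv hvP hvp (hS z hz) hB hfs (c := 0)
      (by rw [hfL, sub_self, zero_smul])
    have hfn : f n ≠ 0 := fun h => hf0 (by rw [h1, h, zero_smul])
    rw [h1, map_smul, hv] at hfL
    have h2 := congrFun hfL n
    simp only [Pi.smul_apply, smul_eq_mul, hvn, mul_one] at h2
    exact (mul_right_cancel₀ hfn (by linear_combination h2)).symm
  · obtain ⟨F, hF, hFv⟩ := exists_mem_domain hτ a (summable_of_eigen hτ hvC hv)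
    refine multiplicity_eq_one (f := ⟨F, hF⟩) (fun h => hv0 ?_) ?_ fun g hg => ?_
    · rw [← hFv, show F = 0 from congrArg Subtype.val h, map_zero]
    · refine coeffL_injective τ ?_
      rw [coeffL_Hτ, map_smul, hFv, hv]
    · obtain ⟨c, hc⟩ := Submodule.mem_span_singleton.1 hg
      have h1 := congrArg (coeffL τ) hc
      rw [map_smul, map_sub, map_smul, coeffL_Hτ] at h1
      simp only [hFv] at h1
      obtain ⟨B, hB⟩ := coeffL_bounded τ (g : L2)
      have hsym := isSym_of_resolvent hε2 ⟨B, hB⟩ (hvs.smul c) h1.symm hother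
      have h2 := eq_smul_mode ha hpn hnP hP hvs hv hvP hvp (hS l hlS) hB hsym h1.symm
      refine Submodule.mem_span_singleton.2 ⟨coeffL τ (g : L2) n, coeffL_injective τ ?_⟩
      rw [map_smul, hFv]
      exact h2.symm

theorem seven_le_norm_freqSq_sub {z : ℂ} (hz : z ∈ Metric.closedBall (3 : ℂ) 6) {j : ℤ}
    (hj : 2 ≤ |j|) : 7 ≤ ‖freqSq 0 j - z‖ := by
  rw [Metric.mem_closedBall, dist_eq_norm] at hz
  have h1 := sixteen_le_norm_freqSq hj
  have h2 : ‖z‖ ≤ 9 := by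
    have := norm_add_le (z - 3) 3
    rw [sub_add_cancel] at this
    have h3 : ‖(3 : ℂ)‖ = 3 := by norm_num
    linarith
  linarith [norm_sub_norm_le (freqSq 0 j) z]

theorem exists_even_eigenvalue_pair {a : ℂ} (ha : ‖a‖ < 2) (ha0 : a ≠ 0) :
    ∃ l₁ l₂ u v w : ℂ, ‖u‖ ≤ 1 / 8 ∧ ‖v‖ ≤ 1 / 3 ∧ ‖w‖ ≤ 1 / 3 ∧
      16 * v + a * (1 + w) = 2 * a * u + (4 + a * v) * v ∧
      l₁ + l₂ = 4 + a * v ∧ l₁ * l₂ = -2 * a ^ 2 * (1 + u) ∧ HasMode 0 1 a l₁ ∧ HasMode 0 1 a l₂ ∧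
      ∀ z ∈ Metric.closedBall (3 : ℂ) 6, HasMode 0 1 a z →
        multiplicity (Hτ 0 a) z = Multiset.count z {l₁, l₂} ∧ (z = l₁ ∨ z = l₂) := by
  classical
  obtain ⟨f₀, f₁, h₀, h₁, h₀₀, h₀₁, h₁₀, h₁₁, hb₀, hb₁, hL₀, hL₁⟩ := exists_even_pair ha
  have hτ : (0 : ℤ) = 0 ∨ (0 : ℤ) = 1 := Or.inl rfl
  have hbd : ∀ (u : ℤ → ℂ) (B : ℝ), IsSym 0 1 u → (∀ j, 2 ≤ |j| → ‖u j‖ ≤ B) →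
      ∀ j, ‖u j‖ ≤ |B| + ‖u 0‖ + ‖u 1‖ := by
    intro u B hu hB j
    by_cases hj : 2 ≤ |j|
    · linarith [hB j hj, le_abs_self B, norm_nonneg (u 0), norm_nonneg (u 1)]
    · have h := hu 1
      simp only [sub_zero, one_mul] at h
      rw [not_le, abs_lt] at hj
      obtain rfl | rfl | rfl : j = -1 ∨ j = 0 ∨ j = 1 := by omega
      · rw [h]; linarith [abs_nonneg B, norm_nonneg (u 0)]
      · linarith [abs_nonneg B, norm_nonneg (u 1)]
      · linarith [abs_nonneg B, norm_nonneg (u 0)]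
  have hB₀ := hbd f₀ _ h₀ hb₀
  have hB₁ := hbd f₁ _ h₁ hb₁
  obtain ⟨hs₀, hs₁⟩ := summable_of_finite_system hτ hB₀ hB₁ (α := 0) (β := a * (1 + f₀ 2))
    (γ := 2 * a) (δ := 4 + a * f₁ 2) (by rw [hL₀]; simp) hL₁
  obtain ⟨F₀, hF₀, hFc₀⟩ := exists_mem_domain hτ a hs₀
  obtain ⟨F₁, hF₁, hFc₁⟩ := exists_mem_domain hτ a hs₁
  have hli : LinearIndependent ℂ ![F₀, F₁] := by
    rw [LinearIndependent.pair_iff]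
    intro s t hst
    have h := congrArg (coeffL 0) hst
    rw [map_add, map_smul, map_smul, hFc₀, hFc₁, map_zero] at h
    have e0 := congrFun h 0
    have e1 := congrFun h 1
    simp [h₀₀, h₁₀] at e0
    simp [h₀₁, h₁₁] at e1
    exact ⟨e0, e1⟩
  obtain ⟨l₁, l₂, hs, hp, hm⟩ := exists_eigenvalue_pair (A := Hτ 0 a) hli (α := 0)
    (γ := a * (1 + f₀ 2)) (β := 2 * a) (δ := 4 + a * f₁ 2) hF₀ hF₁
    (coeffL_injective 0 (by rw [coeffL_Hτ, map_add, map_smul, map_smul, hFc₀, hFc₁, hL₀]; simp))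
    (coeffL_injective 0 (by rw [coeffL_Hτ, map_add, map_smul, map_smul, hFc₀, hFc₁, hL₁]))
  have hroot : ∀ l, l * l - (4 + a * f₁ 2) * l - 2 * a * (a * (1 + f₀ 2)) = 0 →
      HasMode 0 1 a l := by
    intro l hl
    -- The eigenvector of the $2\times2$ matrix for the root `l`; its entry at `0` is `2 * a`, hence
    -- it is nonzero.
    refine ⟨(2 * a) • f₀ + l • f₁, fun h => ?_, ⟨_, fun j => norm_add_le_of_le_of_le
      (norm_mul_le_of_le_of_le le_rfl (hB₀ j)) (norm_mul_le_of_le_of_le le_rfl (hB₁ j))⟩,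
      (h₀.smul _).add (h₁.smul _), ?_⟩
    · have := congrFun h 0
      simp [h₀₀, h₁₀, ha0] at this
    · rw [map_add, map_smul, map_smul, hL₀, hL₁]
      funext j
      simp only [Pi.add_apply, Pi.smul_apply, smul_eq_mul]
      linear_combination -(f₁ j) * hl
  refine ⟨l₁, l₂, f₀ 2, f₁ 2, f₁ 3, hb₀ 2 (by norm_num), hb₁ 2 (by norm_num), hb₁ 3 (by norm_num),
    ?_, by rw [hs, zero_add], by rw [hp]; ring, hroot l₁ ?_, hroot l₂ ?_, fun z hz hzm => ?_⟩
  -- Row `2` of the equation for `f₁`. The relation among `u`, `v`, `w` is kept to control the sign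
  -- of the real part of `a * v` later.
  · have := congrFun hL₁ 2
    have hd : freqSq 0 2 = 16 := by norm_num [freqSq]
    simp only [mathieuSeq_apply, Pi.add_apply, Pi.smul_apply, smul_eq_mul, hd] at this
    norm_num [h₁₁] at this
    linear_combination this
  · linear_combination l₁ * hs - hp
  · linear_combination l₂ * hs - hp
  · have hmz := hm z (fun f hf => by
      obtain ⟨c₀, c₁, hc⟩ := Submodule.mem_span_pair.1 hf
      have e := congrArg (coeffL 0) hc
      rw [map_sub, map_smul, coeffL_Hτ, map_add, map_smul, map_smul, hFc₀, hFc₁] at e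
      obtain ⟨B, hB⟩ := coeffL_bounded 0 (f : L2)
      have hsym := isSym_of_resolvent (one_mul 1) ⟨B, hB⟩ ((h₀.smul c₀).add (h₁.smul c₁)) e.symm
        (fun h => HasMode.not_both hτ ha0 hzm h)
      have e2 := eq_even_pair_combination ha h₀ h₁ h₀₀ h₀₁ h₁₀ h₁₁ hb₀ hb₁ hL₀ hL₁
        (fun j hj => seven_le_norm_freqSq_sub hz hj) hB hsym e.symm
      refine Submodule.mem_span_pair.2 ⟨coeffL 0 (f : L2) 0, coeffL 0 (f : L2) 1,
        coeffL_injective 0 ?_⟩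
      rw [map_add, map_smul, map_smul, hFc₀, hFc₁]
      exact e2.symm)
    refine ⟨hmz, ?_⟩
    have hne := multiplicity_ne_zero ((isEigenvalue_Hτ_iff hτ ha0 z).2 (Or.inl hzm))
    rw [hmz] at hne
    have : z ∈ ({l₁, l₂} : Multiset ℂ) := by
      rw [← Multiset.count_ne_zero]; exact_mod_cast hne
    simpa using this

/-! ### Localization of the eigenvalues -/

theorem norm_lt_of_mem_imSegment {a : ℂ} {c : ℝ} (ha : a ∈ imSegment c) :
    ‖a‖ < c ∧ a ≠ 0 ∧ a.re = 0 := by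
  obtain ⟨x, hx, rfl⟩ := ha
  refine ⟨?_, mul_ne_zero I_ne_zero (ofReal_ne_zero.2 hx.1.ne'), by simp⟩
  rw [norm_mul, norm_I, one_mul, norm_real, Real.norm_of_nonneg hx.1.le]
  exact hx.2

theorem conj_of_mem_imSegment {a : ℂ} {c : ℝ} (ha : a ∈ imSegment c) : conj a = -a := by
  obtain ⟨x, -, rfl⟩ := ha
  simp

theorem freqSq_sub_freqSq (τ j n : ℤ) :
    freqSq τ j - freqSq τ n = ((4 * ((j - n) * (j + n + τ)) : ℤ) : ℂ) := by
  simp only [freqSq]; push_cast; ring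

theorem abs_intCast_le_norm_sub {κ : ℂ} (hκ : κ.re = 0) (m : ℤ) : ((|m| : ℤ) : ℝ) ≤ ‖(m : ℂ) - κ‖ := by
  have h := abs_re_le_norm ((m : ℂ) - κ)
  rw [sub_re, hκ, sub_zero, intCast_re] at h
  exact_mod_cast h

/-- The difference of squared frequencies is $4(j-n)(j+n+\tau)$. If both factors have modulus at
least $2$ it is at least $16$; if one has modulus $1$, then `j` is next to `n` or its mirror and the
other has modulus at least $2$. The latter fails for $2n+\tau=2$, the case excluded by `hn`. -/
theorem sixteen_le_abs_or {τ n j : ℤ} (hn : 2 * n + τ = 1 ∨ 3 ≤ 2 * n + τ) (h1 : j ≠ n)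
    (h2 : j ≠ -n - τ) :
    16 ≤ |4 * ((j - n) * (j + n + τ))| ∨ (8 ≤ |4 * ((j - n) * (j + n + τ))| ∧
      ((j - 1 = n ∨ j - 1 = -n - τ) ∨ (j + 1 = n ∨ j + 1 = -n - τ))) := by
  obtain ⟨u, hu⟩ : ∃ u, u = j - n := ⟨_, rfl⟩
  obtain ⟨w, hw⟩ : ∃ w, w = j + n + τ := ⟨_, rfl⟩
  rw [← hu, ← hw, abs_mul, abs_mul, show |(4 : ℤ)| = 4 from rfl]
  have hu0 : 1 ≤ |u| := Int.one_le_abs (by omega)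
  have hw0 : 1 ≤ |w| := Int.one_le_abs (by omega)
  rcases hu0.eq_or_lt with hu1 | hu2
  · right
    have hc : u = 1 ∨ u = -1 := by
      rcases abs_choice u with h | h <;> omega
    have : 2 ≤ |w| := by
      rcases abs_choice w with h | h <;> omega
    exact ⟨by rw [← hu1]; linarith, by omega⟩
  · rcases hw0.eq_or_lt with hw1 | hw2
    · right
      have hc : w = 1 ∨ w = -1 := by
        rcases abs_choice w with h | h <;> omega
      exact ⟨by rw [← hw1]; omega, by omega⟩
    · left; nlinarith

theorem exists_mode_of_separated {τ : ℤ} (hτ : τ = 0 ∨ τ = 1) {a ε : ℂ} (ha : ‖a‖ < 2)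
    (ha0 : a ≠ 0) (hre : a.re = 0) (hε : ε = 1 ∨ ε = -1) {n : ℤ}
    (hn : 2 * n + τ = 1 ∨ 3 ≤ 2 * n + τ) :
    ∃ l ∈ Metric.closedBall (freqSq τ n) 4, HasMode τ ε a l ∧
      (∀ z ∈ Metric.closedBall (freqSq τ n) 4, HasMode τ ε a z → z = l) ∧
      multiplicity (Hτ τ a) l = 1 := by
  have hε2 : ε * ε = 1 := by rcases hε with rfl | rfl <;> norm_num
  have hεn : ‖ε‖ = 1 := by rcases hε with rfl | rfl <;> simp
  have hεi : ε.im = 0 := by rcases hε with rfl | rfl <;> simp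
  set p : ℤ → ℂ := fun j => if j = n then 1 else if j = -n - τ then ε else 0 with hp
  -- The sum is nonzero exactly when `n` and its mirror are adjacent, as for `τ = 1`, `n = 0`. Since
  -- `a` is imaginary, the resulting shift `a * q` is imaginary too and does not reduce the real
  -- gaps $16$ and $8$.
  have hq : p (n - 1) + p (n + 1) = 0 ∨ p (n - 1) + p (n + 1) = ε := by
    simp only [hp]
    split_ifs <;> first | omega | simp
  set q := p (n - 1) + p (n + 1) with hqdef
  have hκ : (a * q).re = 0 := by
    rcases hq with h | h <;> simp [h, mul_re, hre, hεi]
  have hκn : ‖a * q‖ ≤ ‖a‖ := by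
    rcases hq with h | h <;> simp [h, hεn]
  have key : ∀ j ∉ ({n, -n - τ} : Set ℤ), ∀ κ : ℂ, κ.re = 0 →
      16 ≤ ‖freqSq τ j - freqSq τ n - κ‖ ∨ (8 ≤ ‖freqSq τ j - freqSq τ n - κ‖ ∧
        (j - 1 ∈ ({n, -n - τ} : Set ℤ) ∨ j + 1 ∈ ({n, -n - τ} : Set ℤ))) := by
    intro j hj κ hκ
    simp only [Set.mem_insert_iff, Set.mem_singleton_iff, not_or] at hj
    rw [freqSq_sub_freqSq]
    have h := abs_intCast_le_norm_sub hκ (4 * ((j - n) * (j + n + τ)))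
    refine (sixteen_le_abs_or hn hj.1 hj.2).imp (fun h' => le_trans ?_ h)
      fun h' => ⟨le_trans ?_ h, h'.2⟩
    · exact_mod_cast h'
    · exact_mod_cast h'.1
  obtain ⟨l, hm, hl, hu, hmult⟩ := exists_simple_eigenvalue hτ ha ha0 hε (n := n) (p := p)
    (P := {n, -n - τ}) (S := Metric.closedBall (freqSq τ n) 4)
    (fun j hj => by
      simp only [Set.mem_insert_iff, Set.mem_singleton_iff, not_or] at hj
      simp [hp, hj])
    (by simp [hp]) (by simp)
    (fun j => by
      simp only [hp]
      split_ifs <;> first | omega | simp [hε2])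
    ⟨1, fun j => by simp only [hp]; split_ifs <;> simp [hεn]⟩
    (fun j hj => by
      simp only [Set.mem_insert_iff, Set.mem_singleton_iff] at hj
      tauto)
    (fun j hj => by
      simp only [Set.mem_insert_iff, Set.mem_singleton_iff, not_or] at hj
      simp only [hp]
      split_ifs <;> first | omega | simp [hεn])
    (fun j hj => key j hj _ hκ)
    (fun z hz j hj => by
      rw [Metric.mem_closedBall, dist_eq_norm] at hz
      have h1 := norm_sub_norm_le (freqSq τ j - freqSq τ n) (z - freqSq τ n)
      rw [sub_sub_sub_cancel_right] at h1
      have h2 := key j hj 0 rfl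
      rw [sub_zero] at h2
      exact h2.imp (fun h => by linarith) fun h => ⟨by linarith [h.1], h.2⟩)
  have hlS : l ∈ Metric.closedBall (freqSq τ n) 4 := by
    rw [Metric.mem_closedBall, dist_eq_norm]
    have := norm_add_le (l - freqSq τ n - a * q) (a * q)
    rw [sub_add_cancel] at this
    linarith
  exact ⟨l, hlS, hm, hu, hmult hlS⟩

theorem numEigenvalues_eq_sum_modes {τ : ℤ} (hτ : τ = 0 ∨ τ = 1) {a : ℂ} (ha0 : a ≠ 0) {S : Set ℂ}
    {T : Finset ℂ} (hT : ∀ w ∈ T, w ∈ S)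
    (h : ∀ w ∈ S, HasMode τ 1 a w ∨ HasMode τ (-1) a w → w ∈ T) :
    numEigenvalues (Hτ τ a) S = ∑ w ∈ T, multiplicity (Hτ τ a) w :=
  numEigenvalues_eq_sum T hT fun w hw hE => h w hw ((isEigenvalue_Hτ_iff hτ ha0 w).1 hE)

theorem eigenvalues_of_separated {τ : ℤ} (hτ : τ = 0 ∨ τ = 1) {a : ℂ} (ha : a ∈ imSegment 2)
    {n : ℤ} (hn : 2 * n + τ = 1 ∨ 3 ≤ 2 * n + τ) :
    numEigenvalues (Hτ τ a) (disc 4 (freqSq τ n)) = 2 ∧ ∃ l₁ l₂ : ℂ, l₁ ≠ l₂ ∧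
      {z ∈ disc 4 (freqSq τ n) | IsEigenvalue (Hτ τ a) z} = {l₁, l₂} ∧
      multiplicity (Hτ τ a) l₁ = 1 ∧ multiplicity (Hτ τ a) l₂ = 1 ∧
      ((l₁.im = 0 ∧ l₂.im = 0) ∨ (l₁.im ≠ 0 ∧ l₂.im ≠ 0 ∧ l₂ = conj l₁)) ∧
      disc 4 (freqSq τ n) ∩ {z | IsEigenvalue (Hτ τ a) z ∧ IsEigenvalue (D a) z} = {l₁} ∧
      disc 4 (freqSq τ n) ∩ {z | IsEigenvalue (Hτ τ a) z ∧ IsEigenvalue (N a) z} = {l₂} := by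
  obtain ⟨ha2, ha0, hre⟩ := norm_lt_of_mem_imSegment ha
  have hconj := conj_of_mem_imSegment ha
  obtain ⟨l₁, h1S, h1, h1u, h1m⟩ := exists_mode_of_separated hτ ha2 ha0 hre (Or.inr rfl) hn
  obtain ⟨l₂, h2S, h2, h2u, h2m⟩ := exists_mode_of_separated hτ ha2 ha0 hre (Or.inl rfl) hn
  have hne : l₁ ≠ l₂ := fun h => HasMode.not_both hτ ha0 h2 (h ▸ h1)
  have hcS : ∀ z ∈ Metric.closedBall (freqSq τ n) 4, conj z ∈ Metric.closedBall (freqSq τ n) 4 := by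
    intro z hz
    rw [Metric.mem_closedBall, dist_eq_norm] at hz ⊢
    rwa [show conj z - freqSq τ n = conj (z - freqSq τ n) by
      rw [map_sub]; simp only [freqSq, map_pow, map_intCast], RCLike.norm_conj]
  have hc1 := h1.conj hconj (by simp)
  have hc2 := h2.conj hconj (by simp)
  refine ⟨?_, l₁, l₂, hne, ?_, h1m, h2m, ?_, ?_, ?_⟩
  · rw [numEigenvalues_eq_sum_modes hτ ha0 (T := {l₁, l₂}), Finset.sum_pair hne, h1m, h2m]
    · rfl
    · intro w hw
      rcases Finset.mem_insert.1 hw with rfl | hw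
      · exact h1S
      · rw [Finset.mem_singleton.1 hw]; exact h2S
    · rintro w hw (h | h)
      · simp [h2u w hw h]
      · simp [h1u w hw h]
  · ext z
    simp only [Set.mem_ofPred_eq, Set.mem_insert_iff, Set.mem_singleton_iff]
    rw [isEigenvalue_Hτ_iff hτ ha0]
    constructor
    · rintro ⟨hz, h | h⟩
      · exact Or.inr (h2u z hz h)
      · exact Or.inl (h1u z hz h)
    · rintro (rfl | rfl)
      · exact ⟨h1S, Or.inr h1⟩
      · exact ⟨h2S, Or.inl h2⟩
  -- For `τ = 0` conjugation preserves parity, so uniqueness makes each eigenvalue real. For `τ = 1`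
  -- it swaps parities, so the two are conjugate, and a real value would make them equal.
  · rcases hτ with rfl | rfl
    · left
      simp only [zpow_zero, one_mul] at hc1 hc2
      exact ⟨conj_eq_iff_im.1 (h1u _ (hcS _ h1S) hc1), conj_eq_iff_im.1 (h2u _ (hcS _ h2S) hc2)⟩
    · right
      simp only [zpow_one, neg_mul_neg, one_mul] at hc1
      have e := h2u _ (hcS _ h1S) hc1
      have him : l₁.im ≠ 0 := fun h => hne (by rw [← e, conj_eq_iff_im.2 h])
      exact ⟨him, by rw [← e, conj_im]; exact neg_ne_zero.2 him, e.symm⟩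
  · ext z
    simp only [Set.mem_inter_iff, Set.mem_ofPred_eq, Set.mem_singleton_iff]
    rw [dirichlet_iff_hasMode hτ ha0]
    exact ⟨fun h => h1u z h.1 h.2, fun h => h ▸ ⟨h1S, h1⟩⟩
  · ext z
    simp only [Set.mem_inter_iff, Set.mem_ofPred_eq, Set.mem_singleton_iff]
    rw [neumann_iff_hasMode hτ ha0]
    exact ⟨fun h => h2u z h.1 h.2, fun h => h ▸ ⟨h2S, h2⟩⟩

/-! ### The first three periodic eigenvalues -/

/-- Odd periodic sequences vanish at index `0`, so the frequency $0$ drops out and $4$ is isolated: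
`0` joins `P`, and the remaining squared frequencies are $16$ at the neighbours `±2` and at least
$36$ beyond. -/
theorem exists_odd_mode {a : ℂ} (ha : ‖a‖ < 2) (ha0 : a ≠ 0) :
    ∃ l, ‖l - 4‖ ≤ ‖a‖ ∧ l ∈ Metric.closedBall (3 : ℂ) 6 ∧ HasMode 0 (-1) a l ∧
      (∀ z ∈ Metric.closedBall (3 : ℂ) 6, HasMode 0 (-1) a z → z = l) ∧
      multiplicity (Hτ 0 a) l = 1 := by
  set p : ℤ → ℂ := fun j => if j = 1 then 1 else if j = -1 then -1 else 0 with hp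
  have hmem : ∀ j, j ∉ ({-1, 0, 1} : Set ℤ) → 2 ≤ |j| := fun j hj => by
    simp only [Set.mem_insert_iff, Set.mem_singleton_iff, not_or] at hj
    rw [le_abs]; omega
  have hnb : ∀ j, j ∉ ({-1, 0, 1} : Set ℤ) → ¬ 3 ≤ |j| →
      (j - 1 ∈ ({-1, 0, 1} : Set ℤ) ∨ j + 1 ∈ ({-1, 0, 1} : Set ℤ)) := fun j hj h3 => by
    have h2 := hmem j hj
    have : j = 2 ∨ j = -2 := by rcases abs_choice j with h | h <;> omega
    rcases this with rfl | rfl <;> simp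
  have hsq : ∀ j : ℤ, 3 ≤ |j| → 36 ≤ ‖freqSq 0 j‖ := fun j hj => by
    have h1 : freqSq 0 j = ((4 * j ^ 2 : ℤ) : ℂ) := by simp only [freqSq]; push_cast; ring
    rw [h1, norm_intCast]
    have h2 : 36 ≤ 4 * j ^ 2 := by rw [← sq_abs]; nlinarith
    rw [abs_of_nonneg (by positivity)]
    exact_mod_cast h2
  have hd1 : freqSq 0 1 = 4 := by norm_num [freqSq]
  have hn4 : ‖(4 : ℂ)‖ = 4 := by norm_num
  have hκ : p (1 - 1) + p (1 + 1) = 0 := by simp [hp]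
  obtain ⟨l, hm, hl, hu, hmult⟩ := exists_simple_eigenvalue (Or.inl rfl) ha ha0 (Or.inr rfl) (n := 1)
    (p := p) (P := {-1, 0, 1}) (S := Metric.closedBall (3 : ℂ) 6)
    (fun j hj => by
      simp only [Set.mem_insert_iff, Set.mem_singleton_iff, not_or] at hj
      simp [hp, hj])
    (by simp [hp]) (by simp)
    (fun j => by
      simp only [hp]
      split_ifs <;> first | omega | simp)
    ⟨1, fun j => by simp only [hp]; split_ifs <;> simp⟩
    (fun j hj => by
      simp only [Set.mem_insert_iff, Set.mem_singleton_iff] at hj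
      rcases hj with rfl | rfl | rfl <;> simp)
    (fun j hj => by
      simp only [Set.mem_insert_iff, Set.mem_singleton_iff, not_or] at hj
      simp only [hp]
      split_ifs <;> first | omega | simp)
    (fun j hj => by
      rw [hκ, mul_zero, sub_zero, hd1]
      have h1 := norm_sub_norm_le (freqSq 0 j) 4
      rw [hn4] at h1
      by_cases h3 : 3 ≤ |j|
      · left; linarith [hsq j h3]
      · right; exact ⟨by linarith [sixteen_le_norm_freqSq (hmem j hj)], hnb j hj h3⟩)
    (fun z hz j hj => by
      by_cases h3 : 3 ≤ |j|
      · left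
        rw [Metric.mem_closedBall, dist_eq_norm] at hz
        have h1 := norm_sub_norm_le (freqSq 0 j) z
        have h2 := norm_sub_norm_le z 3
        have h4 : ‖(3 : ℂ)‖ = 3 := by norm_num
        linarith [hsq j h3]
      · right; exact ⟨by linarith [seven_le_norm_freqSq_sub hz (hmem j hj)], hnb j hj h3⟩)
  rw [hκ, mul_zero, sub_zero, hd1] at hl
  have hlS : l ∈ Metric.closedBall (3 : ℂ) 6 := by
    rw [Metric.mem_closedBall, dist_eq_norm]
    have h := norm_add_le (l - 4) 1
    rw [show l - 4 + 1 = l - 3 by ring, norm_one] at h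
    linarith
  exact ⟨l, hl, hlS, hm, hu, hmult hlS⟩

/-! ### Location of the roots of the quadratic for the even block, with $a=ix$ -/

section Quadratic

variable {x : ℝ} {l₁ l₂ u v w : ℂ}

theorem mem_closedBall_of_quadratic (hx0 : 0 < x) (hx : x < 2) (hu : ‖u‖ ≤ 1 / 8) (hv : ‖v‖ ≤ 1 / 3)
    (hs : l₁ + l₂ = 4 + I * x * v) (hp : l₁ * l₂ = 2 * x ^ 2 * (1 + u)) :
    l₁ ∈ Metric.closedBall (3 : ℂ) 6 := by
  have e : (l₁ - 2) ^ 2 = ((4 - 2 * x ^ 2 : ℝ) : ℂ) + ((-(2 * x ^ 2) : ℝ) : ℂ) * u +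
      I * x * v * (l₁ - 2 + 2) := by
    push_cast; linear_combination l₁ * hs - hp
  set t := ‖l₁ - 2‖ with ht
  have h1 : ‖((4 - 2 * x ^ 2 : ℝ) : ℂ)‖ ≤ 4 := by
    rw [norm_real, Real.norm_eq_abs, abs_le]; constructor <;> nlinarith
  have h2 : ‖((-(2 * x ^ 2) : ℝ) : ℂ) * u‖ ≤ 1 := by
    rw [norm_mul, norm_real, Real.norm_eq_abs, abs_neg, abs_of_nonneg (by positivity)]
    nlinarith [norm_nonneg u, mul_le_mul_of_nonneg_left hu (by positivity : 0 ≤ 2 * x ^ 2)]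
  have h3 : ‖I * x * v * (l₁ - 2 + 2)‖ ≤ 2 / 3 * (t + 2) := by
    have hn : ‖l₁ - 2 + 2‖ ≤ t + 2 := by
      have h := norm_add_le (l₁ - 2) 2
      rwa [show ‖(2 : ℂ)‖ = 2 by norm_num] at h
    rw [norm_mul, norm_mul, norm_mul, norm_I, one_mul, norm_real, Real.norm_of_nonneg hx0.le]
    exact mul_le_mul (by nlinarith [norm_nonneg v]) hn (norm_nonneg _) (by norm_num)
  have h4 : t ^ 2 ≤ 4 + 1 + 2 / 3 * (t + 2) := by
    rw [ht, ← norm_pow, e]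
    exact (norm_add₃_le).trans (add_le_add (add_le_add h1 h2) h3)
  have h5 : t ≤ 5 := by nlinarith
  rw [Metric.mem_closedBall, dist_eq_norm]
  have h6 := norm_sub_le (l₁ - 2) 1
  rw [show l₁ - 2 - 1 = l₁ - 3 by ring, norm_one] at h6
  linarith

theorem ne_of_quadratic (hx0 : 0 < x) (hx : x < 4 / 3) (hu : ‖u‖ ≤ 1 / 8) (hv : ‖v‖ ≤ 1 / 3)
    (hw : ‖w‖ ≤ 1 / 3)
    (he : 16 * v + I * x * (1 + w) = 2 * (I * x) * u + (4 + I * x * v) * v)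
    (hs : l₁ + l₂ = 4 + I * x * v) (hp : l₁ * l₂ = 2 * x ^ 2 * (1 + u)) : l₁ ≠ l₂ := by
  intro h
  set y := I * x * v with hy
  have hyn : ‖y‖ ≤ x / 3 := by
    rw [hy, norm_mul, norm_mul, norm_I, one_mul, norm_real, Real.norm_of_nonneg hx0.le]
    nlinarith
  -- The relation `he` multiplied by $a=ix$. The bracket has real part at least
  -- $1-\frac13-\frac14=\frac5{12}$, while $|y|^2\le x^2/9$, whence $\operatorname{Re}y\ge0$.
  have e1 : 12 * y = ((x ^ 2 : ℝ) : ℂ) * (1 + w - 2 * u) + y ^ 2 := by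
    push_cast
    rw [hy]
    linear_combination I * x * he - (x ^ 2 * (1 + w - 2 * u)) * I_sq
  have hre : 0 ≤ y.re := by
    have h1 := congrArg re e1
    rw [add_re, re_ofReal_mul] at h1
    simp only [mul_re, sub_re, add_re, one_re, re_ofNat, im_ofNat, zero_mul, sub_zero] at h1
    have h2 := neg_abs_le (y ^ 2).re
    have h3 := abs_re_le_norm (y ^ 2)
    have h4 := neg_abs_le w.re
    have h5 := abs_re_le_norm w
    have h6 := le_abs_self u.re
    have h7 := abs_re_le_norm u
    rw [norm_pow] at h3
    have h8 : ‖y‖ ^ 2 ≤ (x / 3) ^ 2 := by gcongr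
    nlinarith [mul_nonneg (sq_nonneg x) (by linarith : 0 ≤ 1 + w.re - 2 * u.re - 5 / 12)]
  have hs4 : 4 ≤ ‖4 + y‖ := by
    have h1 := re_le_norm (4 + y)
    rw [add_re, re_ofNat] at h1
    linarith
  -- Vanishing discriminant. It would give $16\le|4+y|^2\le8x^2\cdot\frac98=9x^2$, the source of the
  -- threshold $4/3$.
  have e2 : (4 + y) ^ 2 = ((8 * x ^ 2 : ℝ) : ℂ) * (1 + u) := by
    push_cast
    rw [← hs, ← h]; rw [← h] at hp; linear_combination 4 * hp
  have h1 := congrArg norm e2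
  rw [norm_pow, norm_mul, norm_real, Real.norm_of_nonneg (by positivity)] at h1
  have h2 : ‖1 + u‖ ≤ 9 / 8 := by
    have := norm_add_le 1 u
    rw [norm_one] at this; linarith
  nlinarith [mul_le_mul_of_nonneg_left h2 (by positivity : 0 ≤ 8 * x ^ 2)]

/-- If `l₁` avoids both discs, the trace gives $|l_2|\ge(\frac23+\sqrt2)x$. The product of the roots
then exceeds $2x^2+\frac23\sqrt2\,x^2$, whereas its modulus is at most $\frac94x^2$. -/
theorem mem_disc_or_of_quadratic (hx0 : 0 < x) (hu : ‖u‖ ≤ 1 / 8) (hv : ‖v‖ ≤ 1 / 3)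
    (hs : l₁ + l₂ = 4 + I * x * v) (hp : l₁ * l₂ = 2 * x ^ 2 * (1 + u)) :
    ‖l₁‖ ≤ √2 * x ∨ ‖l₁ - 4‖ ≤ (1 + √2) * x := by
  by_contra! h
  have hq : √2 ^ 2 = 2 := Real.sq_sqrt (by norm_num)
  have hq1 : 1 ≤ √2 := Real.one_le_sqrt.2 (by norm_num)
  have hyn : ‖I * x * v‖ ≤ x / 3 := by
    rw [norm_mul, norm_mul, norm_I, one_mul, norm_real, Real.norm_of_nonneg hx0.le]
    nlinarith
  have h2 : (2 / 3 + √2) * x ≤ ‖l₂‖ := by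
    have := norm_sub_norm_le (4 - l₁) (-(I * x * v))
    rw [show 4 - l₁ - -(I * x * v) = l₂ by linear_combination -hs, norm_neg, norm_sub_rev] at this
    linarith [h.2]
  have h3 : ‖l₁ * l₂‖ ≤ 2 * x ^ 2 * (9 / 8) := by
    rw [hp, show (2 * x ^ 2 : ℂ) = ((2 * x ^ 2 : ℝ) : ℂ) by push_cast; rfl, norm_mul, norm_real,
      Real.norm_of_nonneg (by positivity)]
    refine mul_le_mul_of_nonneg_left ?_ (by positivity)
    have := norm_add_le 1 u
    rw [norm_one] at this; linarith
  rw [norm_mul] at h3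
  have h4 : √2 * x * ((2 / 3 + √2) * x) ≤ ‖l₁‖ * ‖l₂‖ :=
    mul_le_mul h.1.le h2 (by positivity) (norm_nonneg _)
  nlinarith [sq_pos_of_pos hx0, mul_le_mul_of_nonneg_right hq1 (sq_nonneg x)]

theorem separated_of_quadratic (hx0 : 0 < x) (hx : (1 + 2 * √2) * x < 4) (hu : ‖u‖ ≤ 1 / 8)
    (hv : ‖v‖ ≤ 1 / 3) (hs : l₁ + l₂ = 4 + I * x * v) (hp : l₁ * l₂ = 2 * x ^ 2 * (1 + u)) :
    (‖l₁‖ ≤ √2 * x ∧ ‖l₂ - 4‖ ≤ (1 + √2) * x) ∨ (‖l₂‖ ≤ √2 * x ∧ ‖l₁ - 4‖ ≤ (1 + √2) * x) := by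
  have hq : √2 ^ 2 = 2 := Real.sq_sqrt (by norm_num)
  have hq1 : 1 ≤ √2 := Real.one_le_sqrt.2 (by norm_num)
  have hyn : ‖I * x * v‖ ≤ x / 3 := by
    rw [norm_mul, norm_mul, norm_I, one_mul, norm_real, Real.norm_of_nonneg hx0.le]
    nlinarith
  have hn4 : ‖(4 : ℂ)‖ = 4 := by norm_num
  have h1 := mem_disc_or_of_quadratic hx0 hu hv hs hp
  have h2 := mem_disc_or_of_quadratic hx0 hu hv ((add_comm _ _).trans hs) ((mul_comm _ _).trans hp)
  have hnot0 : ¬ (‖l₁‖ ≤ √2 * x ∧ ‖l₂‖ ≤ √2 * x) := fun ⟨a1, a2⟩ => by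
    have b1 := norm_add_le l₁ l₂
    have b2 := norm_sub_norm_le 4 (-(I * x * v))
    rw [sub_neg_eq_add, ← hs, norm_neg, hn4] at b2
    linarith
  have hnot4 : ¬ (‖l₁ - 4‖ ≤ (1 + √2) * x ∧ ‖l₂ - 4‖ ≤ (1 + √2) * x) := fun ⟨a1, a2⟩ => by
    have r1 : 4 - (1 + √2) * x ≤ l₁.re := by
      have := (abs_le.1 ((abs_re_le_norm _).trans a1)).1
      rw [sub_re, re_ofNat] at this; linarith
    have r2 : 4 - (1 + √2) * x ≤ l₂.re := by
      have := (abs_le.1 ((abs_re_le_norm _).trans a2)).1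
      rw [sub_re, re_ofNat] at this; linarith
    have s1 : 4 - x / 3 ≤ l₁.re + l₂.re := by
      have h := congrArg re hs
      rw [add_re, add_re, re_ofNat] at h
      linarith [(abs_le.1 ((abs_re_le_norm _).trans hyn)).1]
    have s2 : |l₁.im + l₂.im| ≤ x / 3 := by
      have h := congrArg im hs
      rw [add_im, add_im, im_ofNat, zero_add] at h
      rw [h]; exact (abs_im_le_norm _).trans hyn
    have s3 : l₁.re * l₂.re - l₁.im * l₂.im ≤ 2 * x ^ 2 * (9 / 8) := by
      rw [← mul_re, hp, show (2 * x ^ 2 : ℂ) = ((2 * x ^ 2 : ℝ) : ℂ) by push_cast; rfl,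
        re_ofReal_mul, add_re, one_re]
      refine mul_le_mul_of_nonneg_left ?_ (by positivity)
      linarith [le_abs_self u.re, abs_re_le_norm u]
    have s4 : l₁.im * l₂.im ≤ x ^ 2 / 36 := by
      have := sq_le_sq' (abs_le.1 s2).1 (abs_le.1 s2).2
      nlinarith [sq_nonneg (l₁.im - l₂.im)]
    have hℓ : √2 * x ≤ 4 - (1 + √2) * x := by linarith
    have hℓ0 : 0 ≤ √2 * x := by positivity
    -- With $\ell=4-(1+\sqrt2)x$ both real parts are at least $\ell$ and their sum is at least
    -- $4-x/3$, so $(\operatorname{Re}l_1-\ell)(\operatorname{Re}l_2-\ell)\ge0$ bounds the product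
    -- below by $\ell(4-x/3-\ell)$.
    have s5 : (4 - (1 + √2) * x) * ((2 / 3 + √2) * x) ≤ l₁.re * l₂.re := by
      nlinarith [mul_nonneg (sub_nonneg.2 r1) (sub_nonneg.2 r2),
        mul_le_mul_of_nonneg_left s1 (hℓ0.trans hℓ)]
    have s6 : √2 * x * ((2 / 3 + √2) * x) ≤ (4 - (1 + √2) * x) * ((2 / 3 + √2) * x) :=
      mul_le_mul_of_nonneg_right hℓ (by positivity)
    nlinarith [sq_pos_of_pos hx0, mul_le_mul_of_nonneg_right hq1 (sq_nonneg x)]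
  tauto

end Quadratic

/-! ### Counting the low periodic eigenvalues -/

theorem Hτ_zero (a : ℂ) : Hτ 0 a = H 0 a := by simp [Hτ]

theorem Hτ_one (a : ℂ) : Hτ 1 a = H Real.pi a := by simp [Hτ]

theorem mem_PD_iff {a : ℂ} (ha0 : a ≠ 0) {z : ℂ} : z ∈ PD a ↔ HasMode 0 (-1) a z := by
  rw [← dirichlet_iff_hasMode (Or.inl rfl) ha0, Hτ_zero]; rfl

theorem mem_PN_iff {a : ℂ} (ha0 : a ≠ 0) {z : ℂ} : z ∈ PN a ↔ HasMode 0 1 a z := by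
  rw [← neumann_iff_hasMode (Or.inl rfl) ha0, Hτ_zero]; rfl

theorem isEigenvalue_H_zero_iff {a : ℂ} (ha0 : a ≠ 0) {z : ℂ} :
    IsEigenvalue (H 0 a) z ↔ z ∈ PN a ∨ z ∈ PD a := by
  rw [mem_PN_iff ha0, mem_PD_iff ha0, ← isEigenvalue_Hτ_iff (Or.inl rfl) ha0, Hτ_zero]

theorem notMem_PD_of_mem_PN {a : ℂ} (ha0 : a ≠ 0) {z : ℂ} (h : z ∈ PN a) : z ∉ PD a := fun h' =>
  HasMode.not_both (Or.inl rfl) ha0 ((mem_PN_iff ha0).1 h) ((mem_PD_iff ha0).1 h')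

theorem numEigenvalues_inter_PN {a : ℂ} {S : Set ℂ} {T : Finset ℂ}
    (hT : ∀ z, z ∈ T ↔ z ∈ S ∩ PN a) :
    numEigenvalues (H 0 a) (S ∩ PN a) = ∑ z ∈ T, multiplicity (H 0 a) z :=
  numEigenvalues_eq_sum T (fun z hz => (hT z).1 hz) fun z hz _ => (hT z).2 hz

theorem numEigenvalues_inter_PD {a : ℂ} {S : Set ℂ} {T : Finset ℂ}
    (hT : ∀ z, z ∈ T ↔ z ∈ S ∩ PD a) :
    numEigenvalues (H 0 a) (S ∩ PD a) = ∑ z ∈ T, multiplicity (H 0 a) z :=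
  numEigenvalues_eq_sum T (fun z hz => (hT z).1 hz) fun z hz _ => (hT z).2 hz

theorem numEigenvalues_eq_add {a : ℂ} (ha0 : a ≠ 0) {S : Set ℂ} {T U : Finset ℂ}
    (hT : ∀ z, z ∈ T ↔ z ∈ S ∩ PN a) (hU : ∀ z, z ∈ U ↔ z ∈ S ∩ PD a) :
    numEigenvalues (H 0 a) S = numEigenvalues (H 0 a) (S ∩ PN a) +
      numEigenvalues (H 0 a) (S ∩ PD a) := by
  have hd : Disjoint T U := Finset.disjoint_left.2 fun z hz hz' =>
    notMem_PD_of_mem_PN ha0 ((hT z).1 hz).2 ((hU z).1 hz').2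
  rw [numEigenvalues_inter_PN hT, numEigenvalues_inter_PD hU, ← Finset.sum_disjUnion hd]
  refine numEigenvalues_eq_sum _ (fun z hz => ?_) fun z hz hE => ?_
  · rcases Finset.mem_disjUnion.1 hz with h | h
    · exact ((hT z).1 h).1
    · exact ((hU z).1 h).1
  · rw [Finset.mem_disjUnion, hT, hU]
    exact ((isEigenvalue_H_zero_iff ha0).1 hE).imp (fun h => ⟨hz, h⟩) fun h => ⟨hz, h⟩

/-- Covers the double root `l₁ = l₂` together with the simple case, so the total count needs no
bound on `a` beyond `2`. -/
theorem sum_multiset_count_pair (l₁ l₂ : ℂ) :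
    ∑ z ∈ ({l₁, l₂} : Multiset ℂ).toFinset, ((({l₁, l₂} : Multiset ℂ).count z : ℕ) : ℕ∞) = 2 := by
  rw [← Nat.cast_sum, Multiset.toFinset_sum_count_eq]
  rfl

theorem low_periodic_eigenvalues {a : ℂ} (ha : a ∈ imSegment 2) :
    numEigenvalues (H 0 a) (disc 6 3) = 3 ∧
    numEigenvalues (H 0 a) (disc 6 3 ∩ PN a) = 2 ∧
    numEigenvalues (H 0 a) (disc 6 3 ∩ PD a) = 1 ∧
    (∀ z ∈ disc 6 3, IsEigenvalue (H 0 a) z → Xor (z ∈ PN a) (z ∈ PD a)) ∧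
    (a ∈ imSegment (4 / 3) → ∀ z ∈ disc 6 3 ∩ PN a, multiplicity (H 0 a) z = 1) ∧
    (∀ z ∈ disc 6 3 ∩ PD a, multiplicity (H 0 a) z = 1) ∧
    (a ∈ imSegment (4 / (1 + 2 * √2)) →
      numEigenvalues (H 0 a) (disc (√2 * ‖a‖) 0) = 1 ∧
      numEigenvalues (H 0 a) (disc (√2 * ‖a‖) 0 ∩ PN a) = 1 ∧
      numEigenvalues (H 0 a) (disc ((1 + √2) * ‖a‖) 4) = 2 ∧
      numEigenvalues (H 0 a) (disc ((1 + √2) * ‖a‖) 4 ∩ PN a) = 1 ∧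
      numEigenvalues (H 0 a) (disc ((1 + √2) * ‖a‖) 4 ∩ PD a) = 1) := by
  classical
  obtain ⟨ha2, ha0, -⟩ := norm_lt_of_mem_imSegment ha
  obtain ⟨d, hd4, hdS, hd, hdu, hdm⟩ := exists_odd_mode ha2 ha0
  obtain ⟨l₁, l₂, u, v, w, hu, hv, hw, he, hs, hp, h₁, h₂, hN⟩ := exists_even_eigenvalue_pair ha2 ha0
  simp only [Hτ_zero] at hdm hN
  simp only [← mem_PN_iff ha0] at h₁ h₂ hN
  simp only [← mem_PD_iff ha0] at hd hdu
  obtain ⟨x, ⟨hx0, hx2⟩, hax⟩ := id ha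
  have hna : ‖a‖ = x := by
    rw [hax, norm_mul, norm_I, one_mul, norm_real, Real.norm_of_nonneg hx0.le]
  have hlt : ∀ c : ℝ, a ∈ imSegment c → x < c := fun c h => hna ▸ (norm_lt_of_mem_imSegment h).1
  rw [hax] at he hs hp
  replace hp : l₁ * l₂ = 2 * x ^ 2 * (1 + u) := by
    linear_combination hp - 2 * x ^ 2 * (1 + u) * I_sq
  have h₁S := mem_closedBall_of_quadratic hx0 hx2 hu hv hs hp
  have h₂S := mem_closedBall_of_quadratic hx0 hx2 hu hv ((add_comm _ _).trans hs)
    ((mul_comm _ _).trans hp)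
  have hT : ∀ z, z ∈ ({l₁, l₂} : Multiset ℂ).toFinset ↔ z ∈ disc 6 3 ∩ PN a := fun z => by
    simp only [Multiset.mem_toFinset, Multiset.insert_eq_cons, Multiset.mem_cons,
      Multiset.mem_singleton]
    refine ⟨?_, fun h => (hN z h.1 h.2).2⟩
    rintro (rfl | rfl)
    · exact ⟨h₁S, h₁⟩
    · exact ⟨h₂S, h₂⟩
  have hU : ∀ z, z ∈ ({d} : Finset ℂ) ↔ z ∈ disc 6 3 ∩ PD a := fun z => by
    rw [Finset.mem_singleton]
    exact ⟨fun h => h ▸ ⟨hdS, hd⟩, fun h => hdu z h.1 h.2⟩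
  have hcN : numEigenvalues (H 0 a) (disc 6 3 ∩ PN a) = 2 := by
    rw [numEigenvalues_inter_PN hT, ← sum_multiset_count_pair l₁ l₂]
    refine Finset.sum_congr rfl fun z hz => ?_
    have := (hT z).1 hz
    exact (hN z this.1 this.2).1
  have hcD : numEigenvalues (H 0 a) (disc 6 3 ∩ PD a) = 1 := by
    rw [numEigenvalues_inter_PD hU, Finset.sum_singleton, hdm]
  have hsimple : l₁ ≠ l₂ → ∀ z ∈ disc 6 3 ∩ PN a, multiplicity (H 0 a) z = 1 := by
    rintro hne z ⟨hz, hz'⟩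
    obtain ⟨hm, rfl | rfl⟩ := hN z hz hz'
    · rw [hm]; simp [hne]
    · rw [hm]; simp [hne.symm]
  refine ⟨by rw [numEigenvalues_eq_add ha0 hT hU, hcN, hcD]; rfl, hcN, hcD, fun z hz hE => ?_,
    fun h => hsimple (ne_of_quadratic hx0 (hlt _ h) hu hv hw he hs hp), fun z hz => ?_, fun h => ?_⟩
  · rcases (isEigenvalue_H_zero_iff ha0).1 hE with h | h
    · exact Or.inl ⟨h, notMem_PD_of_mem_PN ha0 h⟩
    · exact Or.inr ⟨h, fun h' => notMem_PD_of_mem_PN ha0 h' h⟩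
  · rw [hdu z hz.1 hz.2, hdm]
  · have hx : (1 + 2 * √2) * x < 4 := by
      have := hlt _ h
      rwa [lt_div_iff₀ (by positivity), mul_comm] at this
    have hq1 : 1 ≤ √2 := Real.one_le_sqrt.2 (by norm_num)
    have hdisj : ∀ z : ℂ, ‖z‖ ≤ √2 * x → ¬ ‖z - 4‖ ≤ (1 + √2) * x := fun z h1 h2 => by
      have := norm_sub_le z (z - 4)
      rw [sub_sub_cancel, show ‖(4 : ℂ)‖ = 4 by norm_num] at this
      linarith
    rw [hna]
    obtain ⟨m₀, m₄, hm₀, hm₄, hm₀S, hm₄S, hm⟩ : ∃ m₀ m₄ : ℂ, ‖m₀‖ ≤ √2 * x ∧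
        ‖m₄ - 4‖ ≤ (1 + √2) * x ∧ m₀ ∈ disc 6 3 ∩ PN a ∧ m₄ ∈ disc 6 3 ∩ PN a ∧
        ∀ z ∈ disc 6 3 ∩ PN a, multiplicity (H 0 a) z = 1 ∧ (z = m₀ ∨ z = m₄) := by
      -- The two roots lie in disjoint discs, hence differ and are simple.
      rcases separated_of_quadratic hx0 hx hu hv hs hp with ⟨h0, h4⟩ | ⟨h0, h4⟩
      · exact ⟨l₁, l₂, h0, h4, ⟨h₁S, h₁⟩, ⟨h₂S, h₂⟩, fun z hz =>
          ⟨hsimple (fun h => hdisj l₁ h0 (h ▸ h4)) z hz, (hN z hz.1 hz.2).2⟩⟩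
      · exact ⟨l₂, l₁, h0, h4, ⟨h₂S, h₂⟩, ⟨h₁S, h₁⟩, fun z hz =>
          ⟨hsimple (fun h => hdisj l₂ h0 (h ▸ h4)) z hz, (hN z hz.1 hz.2).2.symm⟩⟩
    have hn3 : ‖(3 : ℂ)‖ = 3 := by norm_num
    have hsub₀ : ∀ z ∈ disc (√2 * x) 0, z ∈ disc 6 3 := fun z hz => by
      rw [Metric.mem_closedBall, dist_zero_right] at hz
      rw [Metric.mem_closedBall, dist_eq_norm]
      linarith [norm_sub_le z 3]
    have hsub₄ : ∀ z ∈ disc ((1 + √2) * x) 4, z ∈ disc 6 3 := fun z hz => by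
      rw [Metric.mem_closedBall, dist_eq_norm] at hz ⊢
      have := norm_add_le (z - 4) 1
      rw [show z - 4 + 1 = z - 3 by ring, norm_one] at this
      have : 0 ≤ √2 * x := by positivity
      linarith
    have hT₀ : ∀ z, z ∈ ({m₀} : Finset ℂ) ↔ z ∈ disc (√2 * x) 0 ∩ PN a := fun z => by
      rw [Finset.mem_singleton]
      constructor
      · rintro rfl
        exact ⟨by rwa [Metric.mem_closedBall, dist_zero_right], hm₀S.2⟩
      · rintro ⟨hz, hz'⟩
        refine (hm z ⟨hsub₀ z hz, hz'⟩).2.resolve_right fun h => ?_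
        rw [Metric.mem_closedBall, dist_zero_right] at hz
        exact hdisj z hz (h ▸ hm₄)
    have hT₄ : ∀ z, z ∈ ({m₄} : Finset ℂ) ↔ z ∈ disc ((1 + √2) * x) 4 ∩ PN a := fun z => by
      rw [Finset.mem_singleton]
      constructor
      · rintro rfl
        exact ⟨by rwa [Metric.mem_closedBall, dist_eq_norm], hm₄S.2⟩
      · rintro ⟨hz, hz'⟩
        refine (hm z ⟨hsub₄ z hz, hz'⟩).2.resolve_left fun h => ?_
        rw [Metric.mem_closedBall, dist_eq_norm] at hz
        exact hdisj z (h ▸ hm₀) hz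
    have hd' : ‖d - 4‖ ≤ (1 + √2) * x := by
      rw [hna] at hd4
      have : 0 ≤ √2 * x := by positivity
      linarith
    have hU₀ : ∀ z, z ∈ (∅ : Finset ℂ) ↔ z ∈ disc (√2 * x) 0 ∩ PD a := fun z => by
      refine ⟨fun h => absurd h (Finset.notMem_empty z), fun ⟨hz, hz'⟩ => ?_⟩
      have h := hdu z (hsub₀ z hz) hz'
      rw [Metric.mem_closedBall, dist_zero_right] at hz
      exact absurd (h ▸ hd') (hdisj z hz)
    have hU₄ : ∀ z, z ∈ ({d} : Finset ℂ) ↔ z ∈ disc ((1 + √2) * x) 4 ∩ PD a := fun z => by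
      rw [Finset.mem_singleton]
      refine ⟨?_, fun h => hdu z (hsub₄ z h.1) h.2⟩
      rintro rfl
      exact ⟨by rwa [Metric.mem_closedBall, dist_eq_norm], hd⟩
    have c0 : numEigenvalues (H 0 a) (disc (√2 * x) 0 ∩ PN a) = 1 := by
      rw [numEigenvalues_inter_PN hT₀, Finset.sum_singleton, (hm _ hm₀S).1]
    have c4 : numEigenvalues (H 0 a) (disc ((1 + √2) * x) 4 ∩ PN a) = 1 := by
      rw [numEigenvalues_inter_PN hT₄, Finset.sum_singleton, (hm _ hm₄S).1]
    have d4 : numEigenvalues (H 0 a) (disc ((1 + √2) * x) 4 ∩ PD a) = 1 := by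
      rw [numEigenvalues_inter_PD hU₄, Finset.sum_singleton, hdm]
    refine ⟨?_, c0, ?_, c4, d4⟩
    · rw [numEigenvalues_eq_add ha0 hT₀ hU₀, c0, numEigenvalues_inter_PD hU₀, Finset.sum_empty,
        add_zero]
    · rw [numEigenvalues_eq_add ha0 hT₄ hU₄, c4, d4]; rfl

end Mathieu

end

theorem theorem1 :
    -- (a) antiperiodic eigenvalues
    (∀ a ∈ Mathieu.imSegment 2, ∀ n : ℕ, 1 ≤ n →
      Mathieu.numEigenvalues (Mathieu.H Real.pi a) (Mathieu.disc 4 ((2 * (n : ℂ) - 1) ^ 2)) = 2 ∧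
      ∃ l₁ l₂ : ℂ, l₁ ≠ l₂ ∧
        {z ∈ Mathieu.disc 4 ((2 * (n : ℂ) - 1) ^ 2) |
          Mathieu.IsEigenvalue (Mathieu.H Real.pi a) z} = {l₁, l₂} ∧
        Mathieu.multiplicity (Mathieu.H Real.pi a) l₁ = 1 ∧
        Mathieu.multiplicity (Mathieu.H Real.pi a) l₂ = 1 ∧
        ((l₁.im = 0 ∧ l₂.im = 0) ∨
          (l₁.im ≠ 0 ∧ l₂.im ≠ 0 ∧ l₂ = (starRingEnd ℂ) l₁)) ∧
        Mathieu.disc 4 ((2 * (n : ℂ) - 1) ^ 2) ∩ Mathieu.AD a = {l₁} ∧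
        Mathieu.disc 4 ((2 * (n : ℂ) - 1) ^ 2) ∩ Mathieu.AN a = {l₂}) ∧
    -- (b) periodic eigenvalues away from the first three
    (∀ a ∈ Mathieu.imSegment 2, ∀ n : ℕ, 2 ≤ n →
      Mathieu.numEigenvalues (Mathieu.H 0 a) (Mathieu.disc 4 ((2 * (n : ℂ)) ^ 2)) = 2 ∧
      ∃ l₁ l₂ : ℂ, l₁ ≠ l₂ ∧
        {z ∈ Mathieu.disc 4 ((2 * (n : ℂ)) ^ 2) |
          Mathieu.IsEigenvalue (Mathieu.H 0 a) z} = {l₁, l₂} ∧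
        Mathieu.multiplicity (Mathieu.H 0 a) l₁ = 1 ∧
        Mathieu.multiplicity (Mathieu.H 0 a) l₂ = 1 ∧
        ((l₁.im = 0 ∧ l₂.im = 0) ∨
          (l₁.im ≠ 0 ∧ l₂.im ≠ 0 ∧ l₂ = (starRingEnd ℂ) l₁)) ∧
        Mathieu.disc 4 ((2 * (n : ℂ)) ^ 2) ∩ Mathieu.PD a = {l₁} ∧
        Mathieu.disc 4 ((2 * (n : ℂ)) ^ 2) ∩ Mathieu.PN a = {l₂}) ∧
    -- (c) the first three periodic eigenvalues
    (∀ a ∈ Mathieu.imSegment 2,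
      Mathieu.numEigenvalues (Mathieu.H 0 a) (Mathieu.disc 6 3) = 3 ∧
      Mathieu.numEigenvalues (Mathieu.H 0 a) (Mathieu.disc 6 3 ∩ Mathieu.PN a) = 2 ∧
      Mathieu.numEigenvalues (Mathieu.H 0 a) (Mathieu.disc 6 3 ∩ Mathieu.PD a) = 1 ∧
      (∀ z ∈ Mathieu.disc 6 3, Mathieu.IsEigenvalue (Mathieu.H 0 a) z →
        Xor (z ∈ Mathieu.PN a) (z ∈ Mathieu.PD a)) ∧
      (a ∈ Mathieu.imSegment (4 / 3) →
        ∀ z ∈ Mathieu.disc 6 3 ∩ Mathieu.PN a, Mathieu.multiplicity (Mathieu.H 0 a) z = 1) ∧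
      (∀ z ∈ Mathieu.disc 6 3 ∩ Mathieu.PD a, Mathieu.multiplicity (Mathieu.H 0 a) z = 1) ∧
      (a ∈ Mathieu.imSegment (4 / (1 + 2 * √2)) →
        Mathieu.numEigenvalues (Mathieu.H 0 a) (Mathieu.disc (√2 * ‖a‖) 0) = 1 ∧
        Mathieu.numEigenvalues (Mathieu.H 0 a)
          (Mathieu.disc (√2 * ‖a‖) 0 ∩ Mathieu.PN a) = 1 ∧
        Mathieu.numEigenvalues (Mathieu.H 0 a) (Mathieu.disc ((1 + √2) * ‖a‖) 4) = 2 ∧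
        Mathieu.numEigenvalues (Mathieu.H 0 a)
          (Mathieu.disc ((1 + √2) * ‖a‖) 4 ∩ Mathieu.PN a) = 1 ∧
        Mathieu.numEigenvalues (Mathieu.H 0 a)
          (Mathieu.disc ((1 + √2) * ‖a‖) 4 ∩ Mathieu.PD a) = 1)) := by
  refine ⟨fun a ha n hn => ?_, fun a ha n hn => ?_, fun a ha =>
    Mathieu.low_periodic_eigenvalues ha⟩
  -- The frequency $2n-1$ has index $n-1$ because the modes are numbered by $2j+1$.
  · have h := Mathieu.eigenvalues_of_separated (Or.inr rfl) ha (n := (n : ℤ) - 1) (by omega)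
    have e : Mathieu.freqSq 1 ((n : ℤ) - 1) = (2 * (n : ℂ) - 1) ^ 2 := by
      rw [Mathieu.freqSq]; push_cast; ring
    rw [e, Mathieu.Hτ_one] at h
    exact h
  · have h := Mathieu.eigenvalues_of_separated (Or.inl rfl) ha (n := (n : ℤ)) (by omega)
    have e : Mathieu.freqSq 0 (n : ℤ) = (2 * (n : ℂ)) ^ 2 := by
      rw [Mathieu.freqSq]; push_cast; ring
    rw [e, Mathieu.Hτ_zero] at h
    exact h
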